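/- Let $\mathbb G$ be an arbitrary compact quantum group (not necessarily of Kac type), given by its Hopf $*$-algebra $\mathrm{Pol}(\mathbb G)$, i.e. a Hopf $*$-algebra spanned by the coefficients of its finite-dimensional unitary representations. Let $h$ be its Haar state, i.e. the unique left and right invariant state on $\mathrm{Pol}(\mathbb G)$. For each class $\alpha\in\mathrm{Irr}(\mathbb G)$ of irreducible unitary representations fix a representative $U^\alpha=[u^\alpha_{ij}]$ of size $n_\alpha$, and let $Q_\alpha\in M_{n_\alpha}$ be the unique positive invertible matrix with $\mathrm{Tr}(Q_\alpha)=\mathrm{Tr}(Q_\alpha^{-1})=:d_\alpha$ and $$h\big(u^\alpha_{ij}(u^\alpha_{kl})^*\big)=\delta_{ik}\frac{(Q_\alpha)_{lj}}{d_\alpha},\qquad h\big((u^\alpha_{ij})^*u^\alpha_{kl}\big)=\delta_{jl}\frac{(Q_\alpha^{-1})_{ki}}{d_\alpha}$$ (the existence of $h$ and of the $Q_\alpha$ is part of the claim). For families $X=(X_\alpha)$, $a=(a_\alpha)$ in $\prod_\alpha M_{n_\alpha}$, one of them finitely supported, put $\hat h(X)=\sum_\alpha d_\alpha\mathrm{Tr}(Q_\alpha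 X_\alpha)$ for finitely supported $X$ and $(X\cdot\hat h)(a)=\hat h(aX)$. Let $\hat\Delta:\prod_\alpha M_{n_\alpha}\to\prod_{\beta,\gamma}M_{n_\beta}\otimes M_{n_\gamma}$ be the dual comultiplication, $\hat\Delta(a)=(\mathrm{id}\otimes\mathrm{id}\otimes\langle\cdot,a\rangle)(U_{12}U_{13})$, where $U=\sum_\alpha\sum_{i,j}e^\alpha_{ij}\otimes u^\alpha_{ij}$ and $\langle\cdot,\cdot\rangle$ is the duality $\langle x,a\rangle=(\mathcal F(x)\cdot\hat h)(a)$ between $\mathrm{Pol}(\mathbb G)$ and $\prod_\alpha M_{n_\alpha}$, with $\mathcal F(x)_\alpha=\big[h((u^\alpha_{ji})^*x)\big]_{ij}$; it satisfies $(\hat\Delta\otimes \mathrm{id})U=U_{12}U_{13}$. For finitely supported $X,Y$ put $\hat\Delta_*(X\cdot\hat h\otimes Y\cdot\hat h)=(X\cdot\hat h\otimes Y\cdot\hat h)\circ\hat\Delta$. Let $A_\Delta(\mathbb G)$ be the space of all $X\cdot\hat h$, $X\in\prod_\alpha M_{n_\alpha}$, with $$\|X\cdot\hat h\|_{A_\Delta(\mathbb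 G)}=\sum_\alpha d_\alpha^{3/2}\,\|X_\alpha Q_\alpha^{1/2}\|_{S^2_{n_\alpha}}<\infty ,$$ and give it the matrix norms of the $\ell^1$-direct sum $\ell^1\text{-}\bigoplus_\alpha d_\alpha^{3/2}(S^2_{n_\alpha})_r$ of row Hilbert spaces via $X\cdot\hat h\mapsto (X_\alpha Q_\alpha^{1/2})_\alpha$; at the first matrix level this is the norm above. Then $A_\Delta(\mathbb G)$ is an operator space (complete, with matrix norms satisfying Ruan's axioms), and $\hat\Delta_*$ extends, uniquely, from finitely supported elements to a bilinear multiplication on $A_\Delta(\mathbb G)$ for which $A_\Delta(\mathbb G)$ is a completely contractive Banach algebra: the multiplication is associative, satisfies $\|fg\|\le\|f\|\,\|g\|$, and is completely contractive from the (algebraic tensor product with the matrix norms of the) operator space projective tensor product $A_\Delta(\mathbb G)\widehat\otimes A_\Delta(\mathbb G)$ to $A_\Delta(\mathbb G)$. -/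

import Mathlib

open scoped TensorProduct Matrix

/-! ### Operator spaces -/

namespace OpSpace

open scoped Matrix.Norms.L2Operator in
/-- The operator norm of a (possibly rectangular) complex matrix, acting between the Euclidean
spaces `ℂ^κ → ℂ^ι`. -/
noncomputable def opNorm {ι κ : Type*} [Fintype ι] [Fintype κ] [DecidableEq κ]
    (M : Matrix ι κ ℂ) : ℝ := ‖M‖

/-- The Hilbert-Schmidt norm of a complex matrix. -/
noncomputable def hsNorm {ι κ : Type*} [Fintype ι] [Fintype κ] (M : Matrix ι κ ℂ) : ℝ :=
  Real.sqrt (∑ i, ∑ j, ‖M i j‖ ^ 2)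

/-- A candidate for an operator space structure on `E`: one function on each `M_n(E)`. -/
abbrev MatNorm (E : Type*) := ∀ n : ℕ, Matrix (Fin n) (Fin n) E → ℝ

/-- Two-sided multiplication `a x b` of a matrix `x` over a complex vector space by scalar
matrices. -/
def scalarMul {E : Type*} [AddCommGroup E] [Module ℂ E] {ι κ : Type*} [Fintype κ]
    (a : Matrix ι κ ℂ) (x : Matrix κ κ E) (b : Matrix κ ι ℂ) : Matrix ι ι E :=
  Matrix.of fun i j => ∑ k, ∑ l, (a i k * b l j) • x k l

/-- `E` with the matrix norms `N` is an operator space: the `N n` are norms, they satisfy Ruan's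
two axioms, and `E` is complete for `N 1`. -/
structure IsOperatorSpace {E : Type*} [AddCommGroup E] [Module ℂ E] (N : MatNorm E) : Prop where
  add_le : ∀ (n : ℕ) (x y : Matrix (Fin n) (Fin n) E), N n (x + y) ≤ N n x + N n y
  smul_eq : ∀ (n : ℕ) (c : ℂ) (x : Matrix (Fin n) (Fin n) E), N n (c • x) = ‖c‖ * N n x
  eq_zero : ∀ (n : ℕ) (x : Matrix (Fin n) (Fin n) E), N n x = 0 → x = 0
  block_diag : ∀ (m n : ℕ) (x : Matrix (Fin m) (Fin m) E) (y : Matrix (Fin n) (Fin n) E),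
    N (m + n) ((Matrix.fromBlocks x 0 0 y).submatrix finSumFinEquiv.symm finSumFinEquiv.symm) =
      max (N m x) (N n y)
  scalarMul_le : ∀ (m n : ℕ) (a : Matrix (Fin m) (Fin n) ℂ) (x : Matrix (Fin n) (Fin n) E)
    (b : Matrix (Fin n) (Fin m) ℂ), N m (scalarMul a x b) ≤ opNorm a * N n x * opNorm b
  complete : ∀ s : ℕ → E,
    (∀ ε > 0, ∃ K, ∀ i ≥ K, ∀ j ≥ K, N 1 (Matrix.of fun _ _ => s i - s j) < ε) →
    ∃ x : E, ∀ ε > 0, ∃ K, ∀ i ≥ K, N 1 (Matrix.of fun _ _ => s i - x) < ε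

/-- All the amplifications of `u` to matrices are contractive. -/
def IsCompletelyContractive {E F : Type*} [AddCommGroup E] [Module ℂ E] [AddCommGroup F]
    [Module ℂ F] (N : MatNorm E) (N' : MatNorm F) (u : E →ₗ[ℂ] F) : Prop :=
  ∀ (n : ℕ) (x : Matrix (Fin n) (Fin n) E), N' n (x.map u) ≤ N n x

/-- The operator space structure of the matrix algebra `M_m`, from `M_n(M_m) = M_{nm}`. -/
noncomputable def matAlgNorm (m : ℕ) : MatNorm (Matrix (Fin m) (Fin m) ℂ) :=
  fun n x => opNorm (Matrix.of fun (p q : Fin n × Fin m) => x p.1 q.1 p.2 q.2)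

/-- The row operator space structure of the Hilbert space `S²_n` of Hilbert-Schmidt `n × n`
matrices: the matrix unit `e_{ab}` is sent to the row vector unit with index `(a, b)`. -/
noncomputable def rowHSNorm (n : ℕ) : MatNorm (Matrix (Fin n) (Fin n) ℂ) :=
  fun k x => opNorm (Matrix.of fun (i : Fin k) (q : Fin k × (Fin n × Fin n)) =>
    x i q.1 q.2.1 q.2.2)

/-- The matrix norms of the `ℓ¹`-direct sum of a family of operator spaces: the norm of
`x ∈ M_n(ℓ¹-⊕ E_i)` is the supremum of the norms of `∑_i u_i(x_i) ∈ M_n(M_m)` over all `m` and all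
families of complete contractions `u_i : E_i → M_m` (that is, over all elements of the unit balls
of the spaces `M_m(ℓ^∞-⊕ E_i^*)`). -/
noncomputable def l1SumNorm {I : Type*} {E : I → Type*} [∀ i, AddCommGroup (E i)]
    [∀ i, Module ℂ (E i)] (N : ∀ i, MatNorm (E i)) : MatNorm (∀ i, E i) :=
  fun n x => sSup {r : ℝ | ∃ (m : ℕ) (u : ∀ i, E i →ₗ[ℂ] Matrix (Fin m) (Fin m) ℂ),
    (∀ i, IsCompletelyContractive (N i) (matAlgNorm m) (u i)) ∧
    r = matAlgNorm m n (Matrix.of fun k l => Matrix.of fun a b => ∑' i, u i (x k l i) a b)}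

/-- The matrix norms of the projective tensor product of operator spaces, on the algebraic tensor
product: `‖u‖ = inf ‖a‖ ‖x‖ ‖y‖ ‖b‖` over the representations `u = a (x ⊗ y) b` with
`x ∈ M_p(E)`, `y ∈ M_q(F)`, `a ∈ M_{n,pq}`, `b ∈ M_{pq,n}`. -/
noncomputable def projNorm {E F : Type*} [AddCommGroup E] [Module ℂ E] [AddCommGroup F]
    [Module ℂ F] (N : MatNorm E) (N' : MatNorm F) : MatNorm (E ⊗[ℂ] F) :=
  fun n u => sInf {r : ℝ | ∃ (p q : ℕ) (x : Matrix (Fin p) (Fin p) E)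
    (y : Matrix (Fin q) (Fin q) F) (a : Matrix (Fin n) (Fin p × Fin q) ℂ)
    (b : Matrix (Fin p × Fin q) (Fin n) ℂ),
    u = scalarMul a (Matrix.of fun s t => x s.1 t.1 ⊗ₜ[ℂ] y s.2 t.2) b ∧
    r = opNorm a * N p x * N' q y * opNorm b}

/-- `E`, with the matrix norms `N` and the multiplication `mul`, is a completely contractive Banach
algebra: an operator space and a Banach algebra whose multiplication is completely contractive on
the projective tensor product of `E` with itself. -/
structure IsCompletelyContractiveBanachAlgebra {E : Type*} [AddCommGroup E] [Module ℂ E]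
    (N : MatNorm E) (mul : E →ₗ[ℂ] E →ₗ[ℂ] E) : Prop where
  isOperatorSpace : IsOperatorSpace N
  mul_assoc : ∀ x y z, mul (mul x y) z = mul x (mul y z)
  norm_mul_le : ∀ x y, N 1 (Matrix.of fun _ _ => mul x y) ≤
    N 1 (Matrix.of fun _ _ => x) * N 1 (Matrix.of fun _ _ => y)
  completelyContractive : IsCompletelyContractive (projNorm N N) N (TensorProduct.lift mul)

end OpSpace

/-! ### Compact quantum groups -/

namespace CQG

/-- A finite-dimensional unitary representation of a compact quantum group, where `A` is the Hopf
`*`-algebra of the quantum group. -/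
structure UnitaryRep (A : Type*) [Ring A] [StarRing A] [HopfAlgebra ℂ A] where
  /-- the dimension -/
  n : ℕ
  /-- the matrix of coefficients -/
  u : Matrix (Fin n) (Fin n) A
  comul_apply : ∀ i j, Coalgebra.comul (R := ℂ) (u i j) = ∑ k, u i k ⊗ₜ[ℂ] u k j
  mul_star : u * uᴴ = 1
  star_mul : uᴴ * u = 1

/-- `A` is the Hopf `*`-algebra `Pol(𝔾)` of a compact quantum group `𝔾` (a CQG algebra): the
comultiplication is a `*`-homomorphism and `A` is spanned by the coefficients of the
finite-dimensional unitary representations. -/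
class IsPol (A : Type*) [Ring A] [StarRing A] [HopfAlgebra ℂ A] [StarModule ℂ A] : Prop where
  comul_star : ∀ a : A, Coalgebra.comul (R := ℂ) (star a) = star (Coalgebra.comul (R := ℂ) a)
  span_coeff : Submodule.span ℂ {a : A | ∃ (V : UnitaryRep A) (i j : Fin V.n), a = V.u i j} = ⊤

/-- An irreducible (nonzero) finite-dimensional unitary representation. -/
structure IrrRep (A : Type*) [Ring A] [StarRing A] [HopfAlgebra ℂ A] extends UnitaryRep A where
  n_pos : 0 < n
  irreducible : ∀ T : Matrix (Fin n) (Fin n) ℂ,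
    u * T.map (algebraMap ℂ A) = T.map (algebraMap ℂ A) * u → ∃ c : ℂ, T = c • 1

section

variable {A : Type*} [Ring A] [StarRing A] [HopfAlgebra ℂ A]

/-- Unitary equivalence of representations. -/
def IrrRep.Equivalent (V W : IrrRep A) : Prop :=
  ∃ T : Matrix (Fin V.n) (Fin W.n) ℂ, T * Tᴴ = 1 ∧ Tᴴ * T = 1 ∧
    V.u * T.map (algebraMap ℂ A) = T.map (algebraMap ℂ A) * W.u

theorem IrrRep.Equivalent.refl (V : IrrRep A) : V.Equivalent V := by
  refine ⟨1, by simp, by simp, ?_⟩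
  rw [Matrix.map_one _ (map_zero _) (map_one _)]
  simp

theorem IrrRep.Equivalent.symm {V W : IrrRep A} (h : V.Equivalent W) : W.Equivalent V := by
  obtain ⟨T, h1, h2, h3⟩ := h
  refine ⟨Tᴴ, by simpa using h2, by simpa using h1, ?_⟩
  have e1 : T.map (algebraMap ℂ A) * Tᴴ.map (algebraMap ℂ A) = 1 := by
    rw [← Matrix.map_mul, h1, Matrix.map_one _ (map_zero _) (map_one _)]
  have e2 : Tᴴ.map (algebraMap ℂ A) * T.map (algebraMap ℂ A) = 1 := by
    rw [← Matrix.map_mul, h2, Matrix.map_one _ (map_zero _) (map_one _)]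
  calc W.u * Tᴴ.map (algebraMap ℂ A)
      = Tᴴ.map (algebraMap ℂ A) * (T.map (algebraMap ℂ A) * W.u) * Tᴴ.map (algebraMap ℂ A) := by
        rw [← Matrix.mul_assoc, e2, Matrix.one_mul]
    _ = Tᴴ.map (algebraMap ℂ A) * V.u := by
        rw [← h3, Matrix.mul_assoc, Matrix.mul_assoc, e1, Matrix.mul_one]

theorem IrrRep.Equivalent.trans {V W Z : IrrRep A} (h : V.Equivalent W) (h' : W.Equivalent Z) :
    V.Equivalent Z := by
  obtain ⟨T, h1, h2, h3⟩ := h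
  obtain ⟨S, g1, g2, g3⟩ := h'
  refine ⟨T * S, ?_, ?_, ?_⟩
  · rw [Matrix.conjTranspose_mul, Matrix.mul_assoc, ← Matrix.mul_assoc S, g1, Matrix.one_mul, h1]
  · rw [Matrix.conjTranspose_mul, Matrix.mul_assoc, ← Matrix.mul_assoc Tᴴ, h2, Matrix.one_mul, g2]
  · rw [Matrix.map_mul, ← Matrix.mul_assoc, h3, Matrix.mul_assoc, g3, Matrix.mul_assoc]

end

/-- Equivalence of irreducible unitary representations, as a setoid. -/
instance irrSetoid (A : Type*) [Ring A] [StarRing A] [HopfAlgebra ℂ A] : Setoid (IrrRep A) where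
  r := IrrRep.Equivalent
  iseqv := ⟨IrrRep.Equivalent.refl, IrrRep.Equivalent.symm, IrrRep.Equivalent.trans⟩

/-- `Irr(𝔾)`: the set of equivalence classes of irreducible unitary representations. -/
abbrev Irr (A : Type*) [Ring A] [StarRing A] [HopfAlgebra ℂ A] := Quotient (irrSetoid A)

open scoped ComplexOrder in
/-- `h` is a left and right invariant state on `A = Pol(𝔾)`. -/
structure IsHaarState {A : Type*} [Ring A] [StarRing A] [HopfAlgebra ℂ A] (h : A →ₗ[ℂ] ℂ) :
    Prop where
  map_one : h 1 = 1
  nonneg : ∀ a : A, 0 ≤ h (star a * a)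
  left_invariant : ∀ a : A,
    TensorProduct.lid ℂ A (h.rTensor A (Coalgebra.comul (R := ℂ) a)) = h a • (1 : A)
  right_invariant : ∀ a : A,
    TensorProduct.rid ℂ A (h.lTensor A (Coalgebra.comul (R := ℂ) a)) = h a • (1 : A)

/-- The Haar state: the unique left and right invariant state. -/
noncomputable def haar (A : Type*) [Ring A] [StarRing A] [HopfAlgebra ℂ A] : A →ₗ[ℂ] ℂ :=
  Classical.epsilon IsHaarState

section

variable {A : Type*} [Ring A] [StarRing A] [HopfAlgebra ℂ A]

open scoped ComplexOrder in
/-- The properties which determine the matrix `Q_V` of an irreducible representation `V`: it is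
positive and invertible, it satisfies `Tr(Q) = Tr(Q⁻¹)`, and the orthogonality relations for the
coefficients of `V` hold. -/
structure IsQMatrix (V : IrrRep A) (Q : Matrix (Fin V.n) (Fin V.n) ℂ) : Prop where
  posDef : Q.PosDef
  trace_eq : Q.trace = Q⁻¹.trace
  haar_mul_star : ∀ i j k l, haar A (V.u i j * star (V.u k l)) =
    if i = k then Q l j / Q.trace else 0
  haar_star_mul : ∀ i j k l, haar A (star (V.u i j) * V.u k l) =
    if j = l then Q⁻¹ k i / Q.trace else 0

/-- The unique matrix `Q_V`. -/
noncomputable def qMatrix (V : IrrRep A) : Matrix (Fin V.n) (Fin V.n) ℂ :=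
  Classical.epsilon (IsQMatrix V)

/-- The quantum dimension `d_V = Tr(Q_V)`. -/
noncomputable def qDim (V : IrrRep A) : ℝ := (qMatrix V).trace.re

open scoped MatrixOrder in
/-- The positive square root of `Q_V`. -/
noncomputable def qSqrt (V : IrrRep A) : Matrix (Fin V.n) (Fin V.n) ℂ := CFC.sqrt (qMatrix V)

/-! In the rest `U α` is a chosen representative of the class `α ∈ Irr(𝔾)`. -/

/-- The space `∏_α M_{n_α}` of all families of matrices. -/
abbrev MatFam (U : Irr A → IrrRep A) := ∀ α, Matrix (Fin (U α).n) (Fin (U α).n) ℂ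

/-- The left Haar weight `ĥ(X) = ∑_α d_α Tr(Q_α X_α)` of the dual, for finitely supported `X`. -/
noncomputable def dualHaar (U : Irr A → IrrRep A) (X : MatFam U) : ℂ :=
  ∑ᶠ α, (qDim (U α) : ℂ) * (qMatrix (U α) * X α).trace

/-- The Fourier transform `ℱ(x) = (x · h ⊗ id)(U^*)`, where `(x · h)(b) = h(b x)`. -/
noncomputable def fourier (U : Irr A → IrrRep A) (x : A) : MatFam U :=
  fun α => Matrix.of fun i j => haar A (star ((U α).u j i) * x)

/-- The value `(X · ĥ)(a) = ĥ(a X)`; it is used if `X` or `a` is finitely supported. -/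
noncomputable def funct (U : Irr A → IrrRep A) (X a : MatFam U) : ℂ :=
  dualHaar U (fun α => a α * X α)

/-- The comultiplication of the dual, `Δ̂ : ∏_α M_{n_α} → ∏_{β,γ} M_{n_β} ⊗ M_{n_γ}`. With
`⟨x, a⟩ = (ℱ(x) · ĥ)(a)` the duality of `Pol(𝔾)` and `∏_α M_{n_α}`, it is given by
`Δ̂(a) = (id ⊗ id ⊗ ⟨·, a⟩)(U₁₂ U₁₃)` for the multiplicative unitary
`U = ∑_α ∑_{i,j} e^α_{ij} ⊗ u^α_{ij}`, which is the solution of `(Δ̂ ⊗ id) U = U₁₂ U₁₃`. -/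
noncomputable def dualComul (U : Irr A → IrrRep A) (a : MatFam U) (β γ : Irr A) :
    Matrix (Fin (U β).n × Fin (U γ).n) (Fin (U β).n × Fin (U γ).n) ℂ :=
  Matrix.of fun s t => funct U (fourier U ((U β).u s.1 t.1 * (U γ).u s.2 t.2)) a

/-- The value `Δ̂_*(X · ĥ ⊗ Y · ĥ)(a) = (X · ĥ ⊗ Y · ĥ)(Δ̂(a))`, for finitely supported `X`, `Y`. -/
noncomputable def dualConv (U : Irr A → IrrRep A) (X Y a : MatFam U) : ℂ :=
  ∑ᶠ p : Irr A × Irr A, (qDim (U p.1) : ℂ) * (qDim (U p.2) : ℂ) *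
    (Matrix.kronecker (qMatrix (U p.1)) (qMatrix (U p.2)) *
      (dualComul U a p.1 p.2 * Matrix.kronecker (X p.1) (Y p.2))).trace

open Classical in
/-- The matrix unit `e^α_{ij}` in `∏_α M_{n_α}`. -/
noncomputable def matUnit (U : Irr A → IrrRep A) (α : Irr A) (i j : Fin (U α).n) : MatFam U :=
  Pi.single α (Matrix.single i j 1)

/-- The terms `d_α^{3/2} ‖X_α Q_α^{1/2}‖_{S²}` of the norm. -/
noncomputable def aTerm (U : Irr A → IrrRep A) (X : MatFam U) (α : Irr A) : ℝ :=
  qDim (U α) ^ (3 / 2 : ℝ) * OpSpace.hsNorm (X α * qSqrt (U α))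

theorem abs_aTerm_smul_le (U : Irr A → IrrRep A) (c : ℂ) (X : MatFam U) (α : Irr A) :
    |aTerm U (c • X) α| = ‖c‖ * |aTerm U X α| := by
  have : OpSpace.hsNorm ((c • X) α * qSqrt (U α)) =
      ‖c‖ * OpSpace.hsNorm (X α * qSqrt (U α)) := by
    simp only [OpSpace.hsNorm, Pi.smul_apply, Matrix.smul_mul, Matrix.smul_apply, norm_smul,
      mul_pow, ← Finset.mul_sum]
    rw [Real.sqrt_mul (by positivity), Real.sqrt_sq (norm_nonneg c)]
  simp only [aTerm, this, abs_mul, abs_norm]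
  ring

theorem hsNorm_add_le {ι κ : Type*} [Fintype ι] [Fintype κ] (M N : Matrix ι κ ℂ) :
    OpSpace.hsNorm (M + N) ≤ OpSpace.hsNorm M + OpSpace.hsNorm N := by
  have key : ∀ P : Matrix ι κ ℂ, OpSpace.hsNorm P =
      ‖(WithLp.toLp 2 (fun p : ι × κ => P p.1 p.2) : EuclideanSpace ℂ (ι × κ))‖ := by
    intro P
    rw [EuclideanSpace.norm_eq, OpSpace.hsNorm, Fintype.sum_prod_type]
  rw [key, key, key]
  exact norm_add_le (WithLp.toLp 2 (fun p : ι × κ => M p.1 p.2) : EuclideanSpace ℂ (ι × κ))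
    (WithLp.toLp 2 (fun p : ι × κ => N p.1 p.2))

theorem abs_aTerm_add_le (U : Irr A → IrrRep A) (X Y : MatFam U) (α : Irr A) :
    |aTerm U (X + Y) α| ≤ |aTerm U X α| + |aTerm U Y α| := by
  simp only [aTerm, abs_mul, ← mul_add]
  refine mul_le_mul_of_nonneg_left ?_ (abs_nonneg _)
  have hn : ∀ P : Matrix (Fin (U α).n) (Fin (U α).n) ℂ, 0 ≤ OpSpace.hsNorm P :=
    fun P => Real.sqrt_nonneg _
  rw [abs_of_nonneg (hn _), abs_of_nonneg (hn _), abs_of_nonneg (hn _), Pi.add_apply,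
    Matrix.add_mul]
  exact hsNorm_add_le _ _

/-- The space `A_Δ(𝔾)`: all families `X` (standing for `X · ĥ`) for which the norm
`∑_α d_α^{3/2} ‖X_α Q_α^{1/2}‖_{S²}` is finite. -/
noncomputable def ADelta (U : Irr A → IrrRep A) : Submodule ℂ (MatFam U) where
  carrier := {X | Summable (aTerm U X)}
  zero_mem' := by
    have : aTerm U (0 : MatFam U) = 0 := by
      funext α
      simp [aTerm, OpSpace.hsNorm]
    change Summable (aTerm U (0 : MatFam U))
    rw [this]
    exact summable_zero
  add_mem' := by
    intro X Y hX hY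
    exact Summable.of_norm_bounded (hX.abs.add hY.abs) fun α => abs_aTerm_add_le U X Y α
  smul_mem' := by
    intro c X hX
    exact Summable.of_norm_bounded (hX.abs.mul_left ‖c‖)
      fun α => (abs_aTerm_smul_le U c X α).le

/-- The norm of `A_Δ(𝔾)`. -/
noncomputable def aDeltaNorm (U : Irr A → IrrRep A) (X : ADelta U) : ℝ :=
  ∑' α, aTerm U X.1 α

/-- The operator space `d_α^{3/2} (S²_{n_α})_r`, with `X_α` represented by `X_α Q_α^{1/2}`. -/
noncomputable def blockNorm (U : Irr A → IrrRep A) (α : Irr A) :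
    OpSpace.MatNorm (Matrix (Fin (U α).n) (Fin (U α).n) ℂ) :=
  fun k x => qDim (U α) ^ (3 / 2 : ℝ) *
    OpSpace.rowHSNorm (U α).n k (x.map fun M => M * qSqrt (U α))

/-- The operator space structure of `A_Δ(𝔾)`, as the `ℓ¹`-direct sum of the spaces
`d_α^{3/2} (S²_{n_α})_r`. -/
noncomputable def aDeltaMatNorm (U : Irr A → IrrRep A) : OpSpace.MatNorm (ADelta U) :=
  fun k x => OpSpace.l1SumNorm (blockNorm U) k (x.map Subtype.val)

/-- `mul` extends `Δ̂_*`: for finitely supported `X`, `Y` the functional `mul X Y · ĥ` is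
`Δ̂_*(X · ĥ ⊗ Y · ĥ)`. -/
def ExtendsDualConv (U : Irr A → IrrRep A)
    (mul : ADelta U →ₗ[ℂ] ADelta U →ₗ[ℂ] ADelta U) : Prop :=
  ∀ X Y : ADelta U, {α | X.1 α ≠ 0}.Finite → {α | Y.1 α ≠ 0}.Finite →
    {α | (mul X Y).1 α ≠ 0}.Finite ∧ ∀ a : MatFam U, funct U (mul X Y).1 a = dualConv U X.1 Y.1 a

end

end CQG

/-!
The proof has an algebraic and an analytic half.

*Algebra.* Since the antipode maps a unitary representation `u` to `uᴴ`, a projection onto an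
invariant subspace commutes with `u` (`commute_of_invariant`). This gives complete reducibility
(`IsUnitaryCorep.nonempty_decomp`) and the linear independence of the coefficients of inequivalent
irreducible representations, hence the Peter-Weyl basis (`peterWeyl`). The coordinate at the trivial
representation is an invariant functional. By Schur's lemma its values at `u_{ij} u_{kl}*` and
`u_{ij}* u_{kl}` are given by two matrices, and an intertwiner of the conjugate of `u` with a
unitary representation shows that these are positive and inverse to each other up to a scalar and a
transposition (`IsInvariant.exists_orthogonality`). So the functional is the Haar state, and the
matrices `Q_α` exist. The orthogonality relations also make the linear map `σ(u^α) = Q_α u^α Q_α`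
satisfy `h(ab) = h(b σ(a))`; therefore `σ` is multiplicative, and so is `u^α ↦ Q_α²`. Taking square
roots, `Q_β^{1/2} ⊗ Q_γ^{1/2}` is the direct sum of the matrices `Q_r^{1/2}` of the summands of
`u^β ⊗ u^γ` (`kronecker_qSqrt`), and `d_β d_γ = ∑_r d_r` (`qDim_mul_qDim`).

By Fourier inversion the finitely supported elements of `A_Δ(𝔾)` are the Fourier transforms of the
elements of `Pol(𝔾)`, and `Δ̂_*` is the product of `Pol(𝔾)` (`dualConv_eq`). On elements supported
in single classes `β` and `γ` it is `X ⊗ Y ↦ ⨁_r (d_β d_γ / d_r) W_rᴴ (X ⊗ Y) W_r`, for the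
inclusions `W_r` of the summands of `u^β ⊗ u^γ` (`block_mul_block`).

*Analysis.* The main estimate is that this product of two components is jointly completely
contractive (`opNorm_fourier_block_mul_le`). Composed with complete contractions `v_α` into `M_m`,
it factors through the row of the entries of `x Q_β^{1/2} ⊗ y Q_γ^{1/2}`, an isometry made of the
`W_r`, and the column of the matrices `(d_β d_γ / d_r) v_r(e_{ab} Q_r^{-1/2})`. A complete
contraction on the row Hilbert space `d_r^{3/2} (S²)_r` maps its orthonormal basis to a column of
norm at most `d_r^{3/2}`, so the last column has norm at most
`(∑_r (d_β d_γ / d_r)² d_r³)^{1/2} = (d_β d_γ)^{3/2}`, the weight of `‖x‖ ‖y‖`.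

The product of `A_Δ(𝔾)` is then the sum over all pairs of components. As `A_Δ(𝔾)` is an `ℓ¹`-direct
sum of Hilbert spaces (`aDeltaEquiv`), it is complete, the sum converges, and associativity and
uniqueness follow from the density of the finitely supported elements. The universal property of
`ℓ¹`-direct sums (`OpSpace.opNorm_sumAmp_le_mul`), used once in each variable, carries the joint
complete contractivity from the components to `A_Δ(𝔾)`.
-/

namespace CQG

/-! ### Scalar matrices and unitary representations -/

section Scalar

variable {A : Type*} [Ring A] [Algebra ℂ A] {ι κ μ : Type*}

/-- A scalar matrix, regarded as a matrix with entries in the algebra `A`. -/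
def scal (A : Type*) [Ring A] [Algebra ℂ A] {ι κ : Type*} (T : Matrix ι κ ℂ) : Matrix ι κ A :=
  T.map (algebraMap ℂ A)

@[simp] theorem scal_apply (T : Matrix ι κ ℂ) (i : ι) (j : κ) :
    scal A T i j = algebraMap ℂ A (T i j) := rfl

theorem scal_mul [Fintype κ] (T : Matrix ι κ ℂ) (S : Matrix κ μ ℂ) :
    scal A (T * S) = scal A T * scal A S := Matrix.map_mul

theorem scal_one [DecidableEq ι] : scal A (1 : Matrix ι ι ℂ) = 1 :=
  Matrix.map_one _ (map_zero _) (map_one _)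

theorem scal_zero : scal A (0 : Matrix ι κ ℂ) = 0 := by ext; simp

theorem scal_add (T S : Matrix ι κ ℂ) : scal A (T + S) = scal A T + scal A S := by ext; simp

theorem scal_sub (T S : Matrix ι κ ℂ) : scal A (T - S) = scal A T - scal A S := by ext; simp

theorem scal_smul_one [DecidableEq ι] (c : ℂ) :
    scal A (c • (1 : Matrix ι ι ℂ)) = c • 1 := by
  ext i j
  by_cases h : i = j <;> simp [h, Algebra.algebraMap_eq_smul_one]

theorem scal_smul (c : ℂ) (T : Matrix ι κ ℂ) : scal A (c • T) = c • scal A T := by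
  ext i j
  simp [Algebra.algebraMap_eq_smul_one, mul_smul]

theorem scal_conjTranspose [StarRing A] [StarModule ℂ A] (T : Matrix ι κ ℂ) :
    scal A Tᴴ = (scal A T)ᴴ := by
  ext i j
  exact algebraMap_star_comm (T j i)

theorem scal_mul_apply [Fintype κ] (T : Matrix ι κ ℂ) (u : Matrix κ μ A) (i : ι) (j : μ) :
    (scal A T * u) i j = ∑ k, T i k • u k j := by
  simp [Matrix.mul_apply, Algebra.smul_def]

theorem mul_scal_apply [Fintype κ] (u : Matrix ι κ A) (T : Matrix κ μ ℂ) (i : ι) (j : μ) :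
    (u * scal A T) i j = ∑ k, T k j • u i k := by
  simp only [Matrix.mul_apply, Algebra.smul_def, scal_apply]
  exact Finset.sum_congr rfl fun k _ => (Algebra.commutes _ _).symm

/-- Linear maps applied entrywise commute with multiplication by scalar matrices. -/
theorem map_scal_mul {B : Type*} [Ring B] [Algebra ℂ B] [Fintype κ] (φ : A →ₗ[ℂ] B)
    (T : Matrix ι κ ℂ) (u : Matrix κ μ A) : (scal A T * u).map φ = scal B T * u.map φ := by
  ext i j
  simp [scal_mul_apply, map_sum]

theorem map_mul_scal {B : Type*} [Ring B] [Algebra ℂ B] [Fintype κ] (φ : A →ₗ[ℂ] B)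
    (u : Matrix ι κ A) (T : Matrix κ μ ℂ) : (u * scal A T).map φ = u.map φ * scal B T := by
  ext i j
  simp [mul_scal_apply, map_sum]

theorem transpose_scal_mul [Fintype κ] (T : Matrix ι κ ℂ) (u : Matrix κ μ A) :
    (scal A T * u)ᵀ = uᵀ * scal A Tᵀ := by
  ext i j
  rw [Matrix.transpose_apply, scal_mul_apply, mul_scal_apply]
  rfl

theorem transpose_mul_scal [Fintype κ] (u : Matrix ι κ A) (T : Matrix κ μ ℂ) :
    (u * scal A T)ᵀ = scal A Tᵀ * uᵀ := by
  ext i j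
  rw [Matrix.transpose_apply, scal_mul_apply, mul_scal_apply]
  rfl

theorem scal_self (T : Matrix ι κ ℂ) : scal ℂ T = T := by ext; simp

end Scalar

section Slice

variable {A : Type*} [Ring A] [HopfAlgebra ℂ A]

theorem scal_injective {ι κ : Type*} {T S : Matrix ι κ ℂ} (h : scal A T = scal A S) : T = S := by
  ext i j
  have := congrArg (Coalgebra.counit (R := ℂ)) (congrFun (congrFun h i) j)
  simpa using this

/-- The slice map `(id ⊗ φ)Δ`. -/
noncomputable def sliceRight (φ : A →ₗ[ℂ] ℂ) : A →ₗ[ℂ] A :=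
  (TensorProduct.rid ℂ A).toLinearMap ∘ₗ φ.lTensor A ∘ₗ Coalgebra.comul

/-- The slice map `(φ ⊗ id)Δ`. -/
noncomputable def sliceLeft (φ : A →ₗ[ℂ] ℂ) : A →ₗ[ℂ] A :=
  (TensorProduct.lid ℂ A).toLinearMap ∘ₗ φ.rTensor A ∘ₗ Coalgebra.comul

theorem sliceRight_eq {φ : A →ₗ[ℂ] ℂ} {a : A} {J : Type*} [Fintype J] {x y : J → A}
    (h : Coalgebra.comul (R := ℂ) a = ∑ k, x k ⊗ₜ[ℂ] y k) :
    sliceRight φ a = ∑ k, φ (y k) • x k := by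
  simp [sliceRight, h, map_sum]

theorem sliceLeft_eq {φ : A →ₗ[ℂ] ℂ} {a : A} {J : Type*} [Fintype J] {x y : J → A}
    (h : Coalgebra.comul (R := ℂ) a = ∑ k, x k ⊗ₜ[ℂ] y k) :
    sliceLeft φ a = ∑ k, φ (x k) • y k := by
  simp [sliceLeft, h, map_sum]

theorem sliceLeft_counit (a : A) : sliceLeft (Coalgebra.counit (R := ℂ)) a = a := by
  simp [sliceLeft]

end Slice

section Corep

variable {A : Type*} [Ring A] [StarRing A] [HopfAlgebra ℂ A]
variable {ι κ : Type*} [Fintype ι] [DecidableEq ι] [Fintype κ] [DecidableEq κ]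

/-- A unitary representation of the quantum group with Hopf `*`-algebra `A`, on the Hilbert space
with orthonormal basis `ι`. -/
structure IsUnitaryCorep (u : Matrix ι ι A) : Prop where
  comul_apply : ∀ i j, Coalgebra.comul (R := ℂ) (u i j) = ∑ k, u i k ⊗ₜ[ℂ] u k j
  mul_star : u * uᴴ = 1
  star_mul : uᴴ * u = 1

theorem UnitaryRep.isUnitaryCorep (V : UnitaryRep A) : IsUnitaryCorep V.u :=
  ⟨V.comul_apply, V.mul_star, V.star_mul⟩

theorem IsUnitaryCorep.sliceRight_apply {u : Matrix ι ι A} (hu : IsUnitaryCorep u)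
    (φ : A →ₗ[ℂ] ℂ) (i j : ι) : sliceRight φ (u i j) = ∑ k, φ (u k j) • u i k :=
  sliceRight_eq (hu.comul_apply i j)

theorem IsUnitaryCorep.sliceLeft_apply {u : Matrix ι ι A} (hu : IsUnitaryCorep u)
    (φ : A →ₗ[ℂ] ℂ) (i j : ι) : sliceLeft φ (u i j) = ∑ k, φ (u i k) • u k j :=
  sliceLeft_eq (hu.comul_apply i j)

theorem IsUnitaryCorep.map_counit {u : Matrix ι ι A} (hu : IsUnitaryCorep u) :
    u.map (Coalgebra.counit (R := ℂ)) = 1 := by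
  have h : scal A (u.map (Coalgebra.counit (R := ℂ))) * u = u := by
    ext i j
    rw [scal_mul_apply]
    exact (hu.sliceLeft_apply _ i j).symm.trans (sliceLeft_counit _)
  apply scal_injective (A := A)
  rw [scal_one, ← hu.mul_star, ← congrArg (· * uᴴ) h]
  simp only [Matrix.mul_assoc, hu.mul_star, Matrix.mul_one]

theorem IsUnitaryCorep.counit_apply {u : Matrix ι ι A} (hu : IsUnitaryCorep u) (i j : ι) :
    Coalgebra.counit (R := ℂ) (u i j) = if i = j then 1 else 0 := by
  rw [← Matrix.one_apply, ← hu.map_counit]; rfl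

/-- The antipode maps a unitary representation to its adjoint. -/
theorem IsUnitaryCorep.map_antipode {u : Matrix ι ι A} (hu : IsUnitaryCorep u) :
    u.map (HopfAlgebra.antipode ℂ (A := A)) = uᴴ := by
  have h : u.map (HopfAlgebra.antipode ℂ (A := A)) * u = 1 := by
    ext i j
    have := HopfAlgebra.mul_antipode_rTensor_comul_apply (R := ℂ) (u i j)
    rw [hu.comul_apply, hu.counit_apply] at this
    simp only [map_sum, LinearMap.rTensor_tmul, LinearMap.mul'_apply] at this
    rw [Matrix.mul_apply, Matrix.one_apply]
    simpa using this
  rw [← Matrix.mul_one (u.map _), ← hu.mul_star, ← Matrix.mul_assoc, h, Matrix.one_mul]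

theorem IsUnitaryCorep.entry_ne_zero {u : Matrix ι ι A} (hu : IsUnitaryCorep u) (i : ι) :
    u i i ≠ 0 := fun h => by
  simpa [h] using hu.counit_apply i i

variable [StarModule ℂ A]

/-- The range of a projection which is invariant under a unitary representation is reducing: the
antipode turns invariance under `u` into invariance under `u*`. -/
theorem commute_of_invariant {u : Matrix ι ι A}
    (hu : u.map (HopfAlgebra.antipode ℂ (A := A)) = uᴴ)
    {p : Matrix ι ι ℂ} (hp : pᴴ = p) (hpp : p * p = p) (h : scal A (1 - p) * u * scal A p = 0) :
    u * scal A p = scal A p * u := by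
  have h1 := congrArg (fun M => M.map (HopfAlgebra.antipode ℂ (A := A))) h
  simp only [map_mul_scal, map_scal_mul, hu] at h1
  have h2 : scal A p * u * scal A (1 - p) = 0 := by
    have := congrArg Matrix.conjTranspose h1
    simp only [Matrix.conjTranspose_mul, ← scal_conjTranspose, Matrix.conjTranspose_conjTranspose,
      Matrix.conjTranspose_sub, Matrix.conjTranspose_one, hp] at this
    rw [Matrix.mul_assoc, this]
    ext; simp
  simp only [scal_sub, scal_one, Matrix.sub_mul, Matrix.mul_sub, Matrix.one_mul, Matrix.mul_one,
    sub_eq_zero] at h h2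
  rw [h, h2, Matrix.mul_assoc _ (scal A p), ← scal_mul, hpp]

/-- The intertwiners between unitary representations are closed under adjoints. -/
theorem IsUnitaryCorep.intertwiner_adjoint {u : Matrix ι ι A} {v : Matrix κ κ A}
    (hu : IsUnitaryCorep u) (hv : IsUnitaryCorep v) {T : Matrix ι κ ℂ}
    (h : u * scal A T = scal A T * v) : v * scal A Tᴴ = scal A Tᴴ * u := by
  have h1 : scal A Tᴴ * uᴴ = vᴴ * scal A Tᴴ := by
    simpa [Matrix.conjTranspose_mul, scal_conjTranspose] using congrArg Matrix.conjTranspose h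
  calc v * scal A Tᴴ = v * (scal A Tᴴ * uᴴ) * u := by
        rw [Matrix.mul_assoc, Matrix.mul_assoc, hu.star_mul, Matrix.mul_one]
    _ = scal A Tᴴ * u := by
        rw [h1, ← Matrix.mul_assoc v, hv.mul_star, Matrix.one_mul]

end Corep

/-- The kernel of a matrix `T`: there are a unitary `V` and a set `s` of its columns which form an
orthonormal basis of the kernel, and on the orthogonal complement of the kernel `T` has a left
inverse `X`. -/
theorem exists_kernel_basis {ι κ : Type*} [Fintype ι] [DecidableEq ι] [Fintype κ]
    (T : Matrix κ ι ℂ) : ∃ (V : Matrix ι ι ℂ) (s : Set ι) (X : Matrix ι κ ℂ),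
      V * Vᴴ = 1 ∧ Vᴴ * V = 1 ∧ (∀ k, ∀ i ∈ s, (T * V) k i = 0) ∧
      X * T = 1 - V * Matrix.diagonal (s.indicator 1) * Vᴴ := by
  classical
  have hH : (Tᴴ * T).IsHermitian := Matrix.isHermitian_conjTranspose_mul_self T
  set V : Matrix ι ι ℂ := hH.eigenvectorUnitary.1 with hV
  have hV1 : V * Vᴴ = 1 := Unitary.mul_star_self_of_mem hH.eigenvectorUnitary.2
  have hV2 : Vᴴ * V = 1 := Unitary.star_mul_self_of_mem hH.eigenvectorUnitary.2
  set e : ι → ℂ := fun i => (hH.eigenvalues i : ℂ) with he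
  have hsp : Tᴴ * T = V * Matrix.diagonal e * Vᴴ := by
    have := hH.spectral_theorem
    rw [Unitary.conjStarAlgAut_apply] at this
    exact this
  have hTV : (T * V)ᴴ * (T * V) = Matrix.diagonal e := by
    rw [Matrix.conjTranspose_mul, Matrix.mul_assoc, ← Matrix.mul_assoc Tᴴ, hsp]
    simp only [Matrix.mul_assoc, hV2, Matrix.mul_one]
    rw [← Matrix.mul_assoc, hV2, Matrix.one_mul]
  refine ⟨V, {i | e i = 0}, V * Matrix.diagonal (fun i => (e i)⁻¹) * Vᴴ * Tᴴ, hV1, hV2, ?_, ?_⟩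
  · intro k i hi
    have h1 := congrFun (congrFun hTV i) i
    rw [Matrix.diagonal_apply_eq, show e i = 0 from hi, Matrix.mul_apply] at h1
    have h2 : ∑ j, ‖(T * V) j i‖ ^ 2 = 0 := by
      have h3 : ((∑ j, ‖(T * V) j i‖ ^ 2 : ℝ) : ℂ) = 0 := by
        rw [← h1]
        push_cast
        refine Finset.sum_congr rfl fun j _ => ?_
        rw [Matrix.conjTranspose_apply, ← starRingEnd_apply, Complex.conj_mul']
      exact_mod_cast h3
    have := (Finset.sum_eq_zero_iff_of_nonneg fun j _ => by positivity).1 h2 k (Finset.mem_univ _)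
    simpa using this
  · rw [Matrix.mul_assoc _ Tᴴ, hsp]
    have : Matrix.diagonal (({i | e i = 0} : Set ι).indicator (1 : ι → ℂ)) =
        1 - Matrix.diagonal (fun i => (e i)⁻¹) * Matrix.diagonal e := by
      rw [Matrix.diagonal_mul_diagonal, ← Matrix.diagonal_one, Matrix.diagonal_sub]
      congr 1
      ext i
      by_cases h : e i = 0 <;> simp [h]
    rw [this]
    simp only [Matrix.mul_sub, Matrix.sub_mul, Matrix.mul_one, hV1, sub_sub_cancel]
    simp only [Matrix.mul_assoc]
    rw [← Matrix.mul_assoc Vᴴ V, hV2, Matrix.one_mul]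

/-- The orthogonal projection onto the kernel of a matrix. -/
theorem exists_kernel_projection {ι κ : Type*} [Fintype ι] [DecidableEq ι] [Fintype κ]
    (T : Matrix κ ι ℂ) : ∃ (p : Matrix ι ι ℂ) (X : Matrix ι κ ℂ),
      pᴴ = p ∧ p * p = p ∧ T * p = 0 ∧ X * T = 1 - p := by
  obtain ⟨V, s, X, hV1, hV2, hs, hX⟩ := exists_kernel_basis T
  set d : Matrix ι ι ℂ := Matrix.diagonal (s.indicator 1) with hd
  have hdd : d * d = d := by
    rw [hd, Matrix.diagonal_mul_diagonal]
    congr 1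
    ext i
    by_cases h : i ∈ s <;> simp [h]
  have hdc : dᴴ = d := by
    rw [hd, Matrix.diagonal_conjTranspose]
    congr 1
    ext i
    by_cases h : i ∈ s <;> simp [h]
  refine ⟨V * d * Vᴴ, X, ?_, ?_, ?_, hX⟩
  · simp only [Matrix.conjTranspose_mul, Matrix.conjTranspose_conjTranspose, hdc, Matrix.mul_assoc]
  · calc _ = V * d * (Vᴴ * V) * d * Vᴴ := by simp only [Matrix.mul_assoc]
      _ = _ := by rw [hV2, Matrix.mul_one, Matrix.mul_assoc V, hdd]
  · have : T * V * d = 0 := by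
      ext k i
      rw [hd, Matrix.mul_diagonal]
      by_cases h : i ∈ s
      · rw [hs k i h, zero_mul]; rfl
      · simp [h]
    rw [← Matrix.mul_assoc, ← Matrix.mul_assoc, this, Matrix.zero_mul]

/-! ### Schur's lemma and the decomposition into irreducible representations -/

section Schur

variable {A : Type*} [Ring A] [StarRing A] [HopfAlgebra ℂ A] [StarModule ℂ A]

/-- **Schur's lemma** for irreducible unitary representations. -/
theorem IrrRep.eq_zero_or_equivalent (V W : IrrRep A) {T : Matrix (Fin V.n) (Fin W.n) ℂ}
    (h : V.u * scal A T = scal A T * W.u) : T = 0 ∨ V.Equivalent W := by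
  by_cases hT : T = 0
  · exact Or.inl hT
  right
  have h' := V.isUnitaryCorep.intertwiner_adjoint W.isUnitaryCorep h
  obtain ⟨c, hc⟩ := V.irreducible (T * Tᴴ) (by
    change V.u * scal A _ = scal A _ * V.u
    rw [scal_mul, ← Matrix.mul_assoc, h, Matrix.mul_assoc, h', Matrix.mul_assoc])
  obtain ⟨d, hd⟩ := W.irreducible (Tᴴ * T) (by
    change W.u * scal A _ = scal A _ * W.u
    rw [scal_mul, ← Matrix.mul_assoc, h', Matrix.mul_assoc, h, Matrix.mul_assoc])
  obtain ⟨i, j, hij⟩ : ∃ i j, T i j ≠ 0 := by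
    by_contra! hcon
    exact hT (by ext i j; exact hcon i j)
  have hcd : c = d := by
    have h1 : (T * Tᴴ) * T = T * (Tᴴ * T) := Matrix.mul_assoc _ _ _
    rw [hc, hd] at h1
    have h2 := congrFun (congrFun h1 i) j
    simp only [Matrix.smul_mul, Matrix.one_mul, Matrix.mul_smul, Matrix.mul_one,
      Matrix.smul_apply, smul_eq_mul] at h2
    exact mul_right_cancel₀ hij h2
  have hcr : c = ((∑ k, ‖T i k‖ ^ 2 : ℝ) : ℂ) := by
    have h1 := congrFun (congrFun hc i) i
    rw [Matrix.mul_apply, Matrix.smul_apply, Matrix.one_apply_eq, smul_eq_mul, mul_one] at h1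
    rw [← h1]
    push_cast
    refine Finset.sum_congr rfl fun k _ => ?_
    rw [Matrix.conjTranspose_apply, ← starRingEnd_apply, Complex.mul_conj']
  set r : ℝ := ∑ k, ‖T i k‖ ^ 2 with hr
  have hr0 : 0 < r := by
    refine Finset.sum_pos' (fun _ _ => by positivity) ⟨j, Finset.mem_univ _, ?_⟩
    have := norm_pos_iff.2 hij
    positivity
  have hs : (((Real.sqrt r)⁻¹ : ℝ) : ℂ) * ((((Real.sqrt r)⁻¹ : ℝ) : ℂ) * c) = 1 := by
    rw [hcr, ← Complex.ofReal_mul, ← Complex.ofReal_mul, ← Complex.ofReal_one]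
    congr 1
    have h1 := Real.mul_self_sqrt hr0.le
    have h2 : Real.sqrt r ≠ 0 := (Real.sqrt_pos.2 hr0).ne'
    field_simp
    rw [sq, h1]
  refine ⟨(((Real.sqrt r)⁻¹ : ℝ) : ℂ) • T, ?_, ?_, ?_⟩
  · rw [Matrix.conjTranspose_smul, Matrix.smul_mul, Matrix.mul_smul, hc]
    simp only [smul_smul, ← starRingEnd_apply, Complex.conj_ofReal]
    rw [hs, one_smul]
  · rw [Matrix.conjTranspose_smul, Matrix.smul_mul, Matrix.mul_smul, hd, ← hcd]
    simp only [smul_smul, ← starRingEnd_apply, Complex.conj_ofReal]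
    rw [hs, one_smul]
  · change V.u * scal A _ = scal A _ * W.u
    rw [scal_smul, Matrix.mul_smul, h, Matrix.smul_mul]

end Schur

section Coproduct

variable {A : Type*} [Ring A] [HopfAlgebra ℂ A] {ι : Type*} [Fintype ι]

/-- The comultiplication of the coefficients of `u`, as an identity of matrices over `A ⊗ A`. -/
theorem map_comul_iff {u : Matrix ι ι A} :
    u.map (Coalgebra.comul (R := ℂ)) =
      u.map (Algebra.TensorProduct.includeLeft (R := ℂ) (S := ℂ) (A := A) (B := A)).toLinearMap *
      u.map (Algebra.TensorProduct.includeRight (R := ℂ) (A := A) (B := A)).toLinearMap ↔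
    ∀ i j, Coalgebra.comul (R := ℂ) (u i j) = ∑ k, u i k ⊗ₜ[ℂ] u k j := by
  rw [← Matrix.ext_iff]
  simp [Matrix.mul_apply]

end Coproduct

section Decomposition

variable {A : Type*} [Ring A] [StarRing A] [HopfAlgebra ℂ A]
variable {ι κ : Type*} [Fintype ι] [DecidableEq ι] [Fintype κ] [DecidableEq κ]

theorem IsUnitaryCorep.submatrix {u : Matrix ι ι A} (hu : IsUnitaryCorep u) (e : κ ≃ ι) :
    IsUnitaryCorep (u.submatrix e e) := by
  refine ⟨fun i j => ?_, ?_, ?_⟩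
  · rw [Matrix.submatrix_apply, hu.comul_apply]
    exact (e.sum_comp fun k => u (e i) k ⊗ₜ[ℂ] u k (e j)).symm
  · rw [Matrix.conjTranspose_submatrix, Matrix.submatrix_mul_equiv, hu.mul_star,
      Matrix.submatrix_one_equiv]
  · rw [Matrix.conjTranspose_submatrix, Matrix.submatrix_mul_equiv, hu.star_mul,
      Matrix.submatrix_one_equiv]

/-- A decomposition of the unitary representation `u` into irreducible ones: an orthogonal family
of isometries `W r` which intertwine the chosen representatives of the classes `cls r` with `u`. A
class may occur several times. -/
structure Decomp (U : Irr A → IrrRep A) (u : Matrix ι ι A) where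
  /-- the index set of the summands -/
  R : Type
  /-- there are finitely many summands -/
  fintype : Fintype R
  /-- the class of a summand -/
  cls : R → Irr A
  /-- the inclusion of a summand -/
  W : ∀ r, Matrix ι (Fin (U (cls r)).n) ℂ
  isometry : ∀ r, (W r)ᴴ * W r = 1
  orthogonal : ∀ r r', r ≠ r' → (W r)ᴴ * W r' = 0
  eq_sum : u = ∑ r, scal A (W r) * (U (cls r)).u * scal A (W r)ᴴ

attribute [instance] Decomp.fintype

theorem mul_isometry_conjTranspose_mul {ι κ μ ν : Type*} [Fintype ι] [Fintype κ] [DecidableEq κ]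
    {J : Matrix ι κ ℂ} (hJ : Jᴴ * J = 1) (W : Matrix κ μ ℂ) (W' : Matrix κ ν ℂ) :
    (J * W)ᴴ * (J * W') = Wᴴ * W' := by
  rw [Matrix.conjTranspose_mul, Matrix.mul_assoc, ← Matrix.mul_assoc Jᴴ, hJ, Matrix.one_mul]

theorem mul_orthogonal_conjTranspose_mul {ι κ κ' μ ν : Type*} [Fintype ι] [Fintype κ]
    [Fintype κ'] {J : Matrix ι κ ℂ} {K : Matrix ι κ' ℂ} (h : Jᴴ * K = 0) (W : Matrix κ μ ℂ)
    (W' : Matrix κ' ν ℂ) : (J * W)ᴴ * (K * W') = 0 := by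
  rw [Matrix.conjTranspose_mul, Matrix.mul_assoc, ← Matrix.mul_assoc Jᴴ, h, Matrix.zero_mul,
    Matrix.mul_zero]

theorem scal_conj_conj {A : Type*} [Ring A] [Algebra ℂ A] {ι κ μ : Type*} [Fintype κ] [Fintype μ]
    (J : Matrix ι κ ℂ) (W : Matrix κ μ ℂ) (u : Matrix μ μ A) :
    scal A J * (scal A W * u * scal A Wᴴ) * scal A Jᴴ =
      scal A (J * W) * u * scal A (J * W)ᴴ := by
  simp only [Matrix.conjTranspose_mul, scal_mul, Matrix.mul_assoc]

/-- Two complementary reducing subspaces of a unitary representation, given by orthonormal bases: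
decompositions of the two parts give one of the whole. -/
theorem Decomp.nonempty_of_blocks {U : Irr A → IrrRep A} {u : Matrix ι ι A}
    {κ' : Type*} [Fintype κ'] [DecidableEq κ'] {J : Matrix ι κ ℂ} {K : Matrix ι κ' ℂ}
    (hJ : Jᴴ * J = 1) (hK : Kᴴ * K = 1) (hJK : Jᴴ * K = 0) (hadd : J * Jᴴ + K * Kᴴ = 1)
    (h : u * scal A (J * Jᴴ) = scal A (J * Jᴴ) * u)
    (h1 : Nonempty (Decomp U (scal A Jᴴ * u * scal A J)))
    (h2 : Nonempty (Decomp U (scal A Kᴴ * u * scal A K))) : Nonempty (Decomp U u) := by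
  obtain ⟨D⟩ := h1
  obtain ⟨E⟩ := h2
  have hKJ : Kᴴ * J = 0 := by simpa using congrArg Matrix.conjTranspose hJK
  have hpp : J * Jᴴ * (J * Jᴴ) = J * Jᴴ := by
    rw [Matrix.mul_assoc, ← Matrix.mul_assoc Jᴴ, hJ, Matrix.one_mul]
  have hK' : K * Kᴴ = 1 - J * Jᴴ := by rw [← hadd, add_sub_cancel_left]
  refine ⟨⟨D.R ⊕ E.R, inferInstance, Sum.elim D.cls E.cls,
    fun r => match r with
      | Sum.inl r => J * D.W r
      | Sum.inr r => K * E.W r, ?_, ?_, ?_⟩⟩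
  · rintro (r | r)
    · exact (mul_isometry_conjTranspose_mul hJ (D.W r) (D.W r)).trans (D.isometry r)
    · exact (mul_isometry_conjTranspose_mul hK (E.W r) (E.W r)).trans (E.isometry r)
  · rintro (r | r) (r' | r') hr
    · exact (mul_isometry_conjTranspose_mul hJ (D.W r) (D.W r')).trans
        (D.orthogonal _ _ fun h => hr (congrArg _ h))
    · exact mul_orthogonal_conjTranspose_mul hJK (D.W r) (E.W r')
    · exact mul_orthogonal_conjTranspose_mul hKJ (E.W r) (D.W r')
    · exact (mul_isometry_conjTranspose_mul hK (E.W r) (E.W r')).trans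
        (E.orthogonal _ _ fun h => hr (congrArg _ h))
  · have e1 : u = scal A J * (scal A Jᴴ * u * scal A J) * scal A Jᴴ +
        scal A K * (scal A Kᴴ * u * scal A K) * scal A Kᴴ := by
      have e2 : scal A J * (scal A Jᴴ * u * scal A J) * scal A Jᴴ = scal A (J * Jᴴ) * u := by
        calc _ = scal A (J * Jᴴ) * u * scal A (J * Jᴴ) := by
              simp only [scal_mul, Matrix.mul_assoc]
          _ = _ := by rw [Matrix.mul_assoc, h, ← Matrix.mul_assoc, ← scal_mul, hpp]
      have e3 : scal A K * (scal A Kᴴ * u * scal A K) * scal A Kᴴ = scal A (K * Kᴴ) * u := by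
        calc _ = scal A (K * Kᴴ) * u * scal A (K * Kᴴ) := by
              simp only [scal_mul, Matrix.mul_assoc]
          _ = _ := by
            rw [hK', Matrix.mul_assoc]
            have : u * scal A (1 - J * Jᴴ) = scal A (1 - J * Jᴴ) * u := by
              rw [scal_sub, Matrix.mul_sub, Matrix.sub_mul, h, scal_one, Matrix.mul_one,
                Matrix.one_mul]
            rw [this, ← Matrix.mul_assoc, ← scal_mul, Matrix.sub_mul, Matrix.one_mul,
              Matrix.mul_sub, Matrix.mul_one, hpp, sub_self, sub_zero]
      rw [e2, e3, ← Matrix.add_mul, ← scal_add, hadd, scal_one, Matrix.one_mul]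
    refine e1.trans ?_
    rw [Fintype.sum_sum_type]
    refine congrArg₂ (· + ·) ?_ ?_
    · refine (congrArg (fun M => scal A J * M * scal A Jᴴ) D.eq_sum).trans ?_
      simp only [Matrix.mul_sum, Matrix.sum_mul]
      refine Finset.sum_congr rfl fun r _ => ?_
      exact scal_conj_conj J (D.W r) (U (D.cls r)).u
    · refine (congrArg (fun M => scal A K * M * scal A Kᴴ) E.eq_sum).trans ?_
      simp only [Matrix.mul_sum, Matrix.sum_mul]
      refine Finset.sum_congr rfl fun r _ => ?_
      exact scal_conj_conj K (E.W r) (U (E.cls r)).u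

variable [StarModule ℂ A]

/-- The compression of a unitary representation to a reducing subspace. -/
theorem IsUnitaryCorep.compress {u : Matrix ι ι A} (hu : IsUnitaryCorep u) {J : Matrix ι κ ℂ}
    (hJ : Jᴴ * J = 1) (h : u * scal A (J * Jᴴ) = scal A (J * Jᴴ) * u) :
    IsUnitaryCorep (scal A Jᴴ * u * scal A J) := by
  have hpJ : J * Jᴴ * J = J := by rw [Matrix.mul_assoc, hJ, Matrix.mul_one]
  have hJp : Jᴴ * (J * Jᴴ) = Jᴴ := by rw [← Matrix.mul_assoc, hJ, Matrix.one_mul]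
  have hc : (scal A Jᴴ * u * scal A J)ᴴ = scal A Jᴴ * uᴴ * scal A J := by
    simp only [Matrix.conjTranspose_mul, ← scal_conjTranspose, Matrix.conjTranspose_conjTranspose,
      Matrix.mul_assoc]
  have e1 : scal A (J * Jᴴ) * u * scal A J = u * scal A J := by
    rw [← h, Matrix.mul_assoc, ← scal_mul, hpJ]
  have e2 : scal A Jᴴ * u * scal A (J * Jᴴ) = scal A Jᴴ * u := by
    rw [Matrix.mul_assoc, h, ← Matrix.mul_assoc, ← scal_mul, hJp]
  refine ⟨map_comul_iff.1 ?_, ?_, ?_⟩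
  · have hR := congrArg
      (fun M => M.map (Algebra.TensorProduct.includeRight (R := ℂ) (A := A) (B := A)).toLinearMap)
      e1
    simp only [map_mul_scal, map_scal_mul] at hR ⊢
    rw [map_comul_iff.2 hu.comul_apply]
    simp only [scal_mul, Matrix.mul_assoc] at hR ⊢
    rw [hR]
  · rw [hc]
    calc scal A Jᴴ * u * scal A J * (scal A Jᴴ * uᴴ * scal A J)
        = scal A Jᴴ * u * (scal A J * scal A Jᴴ) * uᴴ * scal A J := by
          simp only [Matrix.mul_assoc]
      _ = 1 := by
          rw [← scal_mul, e2, Matrix.mul_assoc (scal A Jᴴ) u, hu.mul_star, Matrix.mul_one,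
            ← scal_mul, hJ, scal_one]
  · rw [hc]
    calc scal A Jᴴ * uᴴ * scal A J * (scal A Jᴴ * u * scal A J)
        = scal A Jᴴ * uᴴ * (scal A J * scal A Jᴴ * u * scal A J) := by
          simp only [Matrix.mul_assoc]
      _ = 1 := by
          rw [← scal_mul, e1, Matrix.mul_assoc (scal A Jᴴ) uᴴ, ← Matrix.mul_assoc uᴴ,
            hu.star_mul, Matrix.one_mul, ← scal_mul, hJ, scal_one]

/-- Every finite-dimensional unitary representation is a direct sum of irreducible ones. -/
theorem IsUnitaryCorep.nonempty_decomp (U : Irr A → IrrRep A)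
    (hU : ∀ α, (Quotient.mk _ (U α) : Irr A) = α) :
    ∀ (N : ℕ) {ι : Type} [Fintype ι] [DecidableEq ι] {u : Matrix ι ι A},
      Fintype.card ι = N → IsUnitaryCorep u → Nonempty (Decomp U u) := by
  classical
  intro N
  induction N using Nat.strong_induction_on with
  | _ N ih =>
  intro ι _ _ u hN hu
  by_cases hι : IsEmpty ι
  · exact ⟨⟨Empty, inferInstance, Empty.elim, fun r => r.elim, fun r => r.elim, fun r => r.elim,
      Subsingleton.elim _ _⟩⟩
  rw [not_isEmpty_iff] at hι
  by_cases hirr : ∀ T : Matrix ι ι ℂ, u * scal A T = scal A T * u → ∃ c : ℂ, T = c • 1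
  · -- an irreducible representation is equivalent to the representative of its class
    let e := Fintype.equivFin ι
    have hv := hu.submatrix e.symm
    let V : IrrRep A := ⟨⟨Fintype.card ι, u.submatrix e.symm e.symm, hv.comul_apply, hv.mul_star,
      hv.star_mul⟩, Fintype.card_pos, by
        intro T hT
        have hT' : u.submatrix e.symm e.symm * scal A T =
          scal A T * u.submatrix e.symm e.symm := hT
        obtain ⟨c, hc⟩ := hirr (T.submatrix e e) (by
          have := congrArg (fun M => M.submatrix e e) hT'
          rw [← Matrix.submatrix_mul_equiv _ _ _ e, ← Matrix.submatrix_mul_equiv _ _ _ e] at this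
          exact (by simpa using this : u * (scal A T).submatrix e e = _))
        refine ⟨c, ?_⟩
        have := congrArg (fun M => M.submatrix e.symm e.symm) hc
        simpa [Matrix.submatrix_smul, Matrix.submatrix_one_equiv] using this⟩
    obtain ⟨T, hT1, hT2, hT⟩ := Quotient.exact (hU (Quotient.mk _ V))
    have hT' : (U (Quotient.mk _ V)).u * scal A T = scal A T * V.u := hT
    refine ⟨⟨Unit, inferInstance, fun _ => Quotient.mk _ V, fun _ => Tᴴ.submatrix e id,
      fun _ => ?_, fun r r' h => (h rfl).elim, ?_⟩⟩
    · rw [Matrix.conjTranspose_submatrix, Matrix.submatrix_mul_equiv,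
        Matrix.conjTranspose_conjTranspose, hT1, Matrix.submatrix_id_id]
    · have h1 : V.u = scal A Tᴴ * (U (Quotient.mk _ V)).u * scal A T := by
        rw [Matrix.mul_assoc, hT', ← Matrix.mul_assoc, ← scal_mul, hT2, scal_one, Matrix.one_mul]
      have h2 : u = V.u.submatrix e e := by simp [V]
      rw [h2, h1, Finset.sum_const, Finset.card_univ, Fintype.card_unit, one_smul]
      ext i j
      simp [Matrix.mul_apply]
  · -- otherwise an eigenspace of a non-scalar intertwiner `T` and its orthogonal complement are
    -- nontrivial invariant subspaces
    push Not at hirr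
    obtain ⟨T, hT, hTc⟩ := hirr
    obtain ⟨c, hc⟩ := Module.End.exists_eigenvalue (Matrix.toLin' T)
    obtain ⟨ξ, hξ⟩ := hc.exists_hasEigenvector
    have hξ1 : (T - c • 1).mulVec ξ = 0 := by
      have := hξ.apply_eq_smul
      rw [Matrix.toLin'_apply] at this
      rw [Matrix.sub_mulVec, this, Matrix.smul_mulVec, Matrix.one_mulVec, sub_self]
    obtain ⟨V, s, X, hV1, hV2, hs, hX⟩ := exists_kernel_basis (T - c • 1)
    have hT' : u * scal A (T - c • 1) = scal A (T - c • 1) * u := by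
      rw [scal_sub, Matrix.mul_sub, Matrix.sub_mul, hT, scal_smul_one, Matrix.mul_smul,
        Matrix.smul_mul, Matrix.one_mul, Matrix.mul_one]
    set J : Matrix ι s ℂ := V.submatrix id Subtype.val with hJdef
    set K : Matrix ι (sᶜ : Set ι) ℂ := V.submatrix id Subtype.val with hKdef
    have hVV : ∀ i j, ∑ k, star (V k i) * V k j = (1 : Matrix ι ι ℂ) i j := fun i j => by
      rw [← hV2]; rfl
    have hJ : Jᴴ * J = 1 := by
      ext i j
      have := hVV i j
      rw [Matrix.one_apply] at this
      rw [Matrix.mul_apply, Matrix.one_apply]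
      simpa [hJdef, Subtype.ext_iff] using this
    have hK : Kᴴ * K = 1 := by
      ext i j
      have := hVV i j
      rw [Matrix.one_apply] at this
      rw [Matrix.mul_apply, Matrix.one_apply]
      simpa [hKdef, Subtype.ext_iff] using this
    have hJK : Jᴴ * K = 0 := by
      ext i j
      have := hVV i j
      rw [Matrix.one_apply_ne (fun h : (i : ι) = j => j.2 (show (j : ι) ∈ s from h ▸ i.2))] at this
      rw [Matrix.mul_apply]
      simpa [hJdef, hKdef] using this
    have hJJ : J * Jᴴ = V * Matrix.diagonal (s.indicator 1) * Vᴴ := by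
      ext i j
      rw [Matrix.mul_apply, Matrix.mul_apply]
      simp only [Matrix.mul_diagonal, hJdef, Matrix.submatrix_apply, Matrix.conjTranspose_apply, id]
      rw [← Finset.sum_subtype (s.toFinset) (fun k => by simp) (fun k => V i k * star (V j k))]
      rw [← Finset.sum_subset (Finset.subset_univ s.toFinset)]
      · refine Finset.sum_congr rfl fun k hk => ?_
        rw [Set.indicator_of_mem (by simpa using hk), Pi.one_apply, mul_one]
      · intro k _ hk
        rw [Set.indicator_of_notMem (by simpa using hk), mul_zero, zero_mul]
    have hadd : J * Jᴴ + K * Kᴴ = 1 := by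
      rw [← hV1]
      ext i j
      rw [Matrix.add_apply, Matrix.mul_apply, Matrix.mul_apply, Matrix.mul_apply]
      exact Fintype.sum_subtype_add_sum_subtype (fun k => k ∈ s) fun k => V i k * Vᴴ k j
    have hpJ : (T - c • 1) * (J * Jᴴ) = 0 := by
      have : (T - c • 1) * J = 0 := by
        ext k i
        exact hs k i i.2
      rw [← Matrix.mul_assoc, this, Matrix.zero_mul]
    have hcomm : u * scal A (J * Jᴴ) = scal A (J * Jᴴ) * u := by
      refine commute_of_invariant hu.map_antipode (by simp) ?_ ?_
      · rw [Matrix.mul_assoc, ← Matrix.mul_assoc Jᴴ, hJ, Matrix.one_mul]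
      · rw [hJJ, ← hX, ← hJJ, scal_mul, Matrix.mul_assoc (scal A X), ← hT', Matrix.mul_assoc,
          Matrix.mul_assoc, ← scal_mul, hpJ, scal_zero, Matrix.mul_zero, Matrix.mul_zero]
    have hs1 : s.Nonempty := by
      by_contra hne
      rw [Set.not_nonempty_iff_eq_empty] at hne
      apply hξ.2
      have h1 : (X * (T - c • 1)).mulVec ξ = 0 := by
        rw [← Matrix.mulVec_mulVec, hξ1, Matrix.mulVec_zero]
      rw [hX, hne] at h1
      simpa using h1
    have hs2 : sᶜ.Nonempty := by
      by_contra hne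
      rw [Set.not_nonempty_iff_eq_empty, Set.compl_empty_iff] at hne
      apply hTc c
      have h1 : (T - c • 1) * V = 0 := by
        ext k i
        exact hs k i (hne ▸ Set.mem_univ i)
      have h2 : (T - c • 1) = 0 := by
        calc T - c • 1 = (T - c • 1) * V * Vᴴ := by
              rw [Matrix.mul_assoc, hV1, Matrix.mul_one]
          _ = 0 := by rw [h1, Matrix.zero_mul]
      exact sub_eq_zero.1 h2
    have hcomm' : u * scal A (K * Kᴴ) = scal A (K * Kᴴ) * u := by
      rw [eq_sub_of_add_eq' hadd, scal_sub, Matrix.mul_sub, Matrix.sub_mul, hcomm, scal_one,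
        Matrix.mul_one, Matrix.one_mul]
    have c1 : Fintype.card s < N := hN ▸ Fintype.card_subtype_lt (x := hs2.some) hs2.some_mem
    have c2 : Fintype.card (sᶜ : Set ι) < N :=
      hN ▸ Fintype.card_subtype_lt (x := hs1.some) (fun h => h hs1.some_mem)
    exact Decomp.nonempty_of_blocks hJ hK hJK hadd hcomm
      (ih _ c1 rfl (hu.compress hJ hcomm)) (ih _ c2 rfl (hu.compress hK hcomm'))

end Decomposition

/-! ### The Peter-Weyl basis -/

theorem blockDiagonal'_mul_apply {A o : Type*} [Ring A] [Fintype o] [DecidableEq o] {m : o → Type*}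
    [∀ i, Fintype (m i)] {μ : Type*} (M : ∀ i, Matrix (m i) (m i) A)
    (N : Matrix (Σ i, m i) μ A) (i : o) (x : m i) (t : μ) :
    (Matrix.blockDiagonal' M * N) ⟨i, x⟩ t = ∑ y, M i x y * N ⟨i, y⟩ t := by
  rw [Matrix.mul_apply, Fintype.sum_sigma, Finset.sum_eq_single i]
  · simp
  · intro j _ hj
    refine Finset.sum_eq_zero fun y _ => ?_
    rw [Matrix.blockDiagonal'_apply_ne _ _ _ hj.symm, zero_mul]
  · simp

theorem mul_blockDiagonal'_apply {A o : Type*} [Ring A] [Fintype o] [DecidableEq o] {m : o → Type*}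
    [∀ i, Fintype (m i)] {μ : Type*} (M : ∀ i, Matrix (m i) (m i) A)
    (N : Matrix μ (Σ i, m i) A) (i : o) (x : m i) (t : μ) :
    (N * Matrix.blockDiagonal' M) t ⟨i, x⟩ = ∑ y, N t ⟨i, y⟩ * M i y x := by
  rw [Matrix.mul_apply, Fintype.sum_sigma, Finset.sum_eq_single i]
  · simp
  · intro j _ hj
    refine Finset.sum_eq_zero fun y _ => ?_
    rw [Matrix.blockDiagonal'_apply_ne _ _ _ hj, mul_zero]
  · simp

section PeterWeyl

variable {A : Type*} [Ring A] [StarRing A] [HopfAlgebra ℂ A]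

/-- The coefficients of the chosen irreducible representations. -/
def coef (U : Irr A → IrrRep A) (s : Σ α, Fin (U α).n × Fin (U α).n) : A :=
  (U s.1).u s.2.1 s.2.2

theorem eq_of_equivalent {U : Irr A → IrrRep A}
    (hU : ∀ α, (Quotient.mk _ (U α) : Irr A) = α) {α β : Irr A} (h : (U α).Equivalent (U β)) :
    α = β := by
  rw [← hU α, ← hU β]
  exact Quotient.sound h

variable [StarModule ℂ A]

/-- The linear independence of the coefficients of finitely many inequivalent irreducible
representations. The projection `p` onto the space of linear relations commutes with
`⨁_α 1 ⊗ u^α`, so by Schur's lemma it is of the form `⨁_α C_α ⊗ 1`; since its columns are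
relations, `C_αᵀ u^α = 0`, and `p = 0`. -/
theorem coef_relation_eq_zero {U : Irr A → IrrRep A}
    (hU : ∀ α, (Quotient.mk _ (U α) : Irr A) = α) (F : Finset (Irr A))
    (c : (Σ α : F, Fin (U α).n × Fin (U α).n) → ℂ)
    (hc : ∑ s, c s • (U s.1).u s.2.1 s.2.2 = 0) : c = 0 := by
  classical
  let e : (Σ α : F, Fin (U α).n × Fin (U α).n) → A := fun s => (U s.1).u s.2.1 s.2.2
  let L : ((Σ α : F, Fin (U α).n × Fin (U α).n) → ℂ) →ₗ[ℂ] A := Fintype.linearCombination ℂ e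
  have hL : ∀ c, L c = ∑ s, c s • e s := fun c => Fintype.linearCombination_apply ℂ e c
  let T := LinearMap.toMatrix'
    ((Module.finBasis ℂ L.range).equivFun.toLinearMap ∘ₗ L.rangeRestrict)
  have hT : ∀ c, T.mulVec c = 0 ↔ L c = 0 := by
    intro c
    rw [← Matrix.toLin'_apply, Matrix.toLin'_toMatrix']
    simp only [LinearMap.comp_apply, LinearEquiv.coe_coe, LinearEquiv.map_eq_zero_iff]
    rw [Subtype.ext_iff]
    rfl
  obtain ⟨p, X, hps, hpp, hTp, hX⟩ := exists_kernel_projection T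
  have hcol : ∀ m, ∑ t, p t m • e t = 0 := by
    intro m
    rw [← hL fun t => p t m, ← hT]
    ext k
    exact congrFun (congrFun hTp k) m
  let M : ∀ α : F, Matrix (Fin (U α).n × Fin (U α).n) (Fin (U α).n × Fin (U α).n) A :=
    fun α => Matrix.kronecker (1 : Matrix (Fin (U α).n) (Fin (U α).n) A) (U α).u
  have hM : ∀ α, (M α).map (HopfAlgebra.antipode ℂ (A := A)) = (M α)ᴴ := by
    intro α
    ext ⟨i, k⟩ ⟨i', k'⟩
    have h1 := congrFun (congrFun (U α).isUnitaryCorep.map_antipode k) k'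
    rw [Matrix.map_apply] at h1
    by_cases hi : i = i'
    · simp [M, hi, h1]
    · simp [M, hi, Ne.symm hi]
  let Û := Matrix.blockDiagonal' M
  have hÛS : Û.map (HopfAlgebra.antipode ℂ (A := A)) = Ûᴴ := by
    rw [Matrix.blockDiagonal'_map _ _ (map_zero _), Matrix.blockDiagonal'_conjTranspose]
    congr 1
    ext1 α
    exact hM α
  have hslice : ∀ (φ : A →ₗ[ℂ] ℂ) t, sliceRight φ (e t) = ∑ r, φ (Û r t) • e r := by
    rintro φ ⟨α, i, j⟩
    rw [show e ⟨α, i, j⟩ = (U α).u i j from rfl, (U α).isUnitaryCorep.sliceRight_apply,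
      Fintype.sum_sigma, Finset.sum_eq_single α]
    · rw [Fintype.sum_prod_type]
      refine Eq.trans ?_ (Finset.sum_eq_single (f := fun i' => ∑ k, φ (Û ⟨α, i', k⟩ ⟨α, i, j⟩) •
        e ⟨α, i', k⟩) i ?_ ?_).symm
      · simp [Û, M, e]
      · intro i' _ hi
        simp [Û, M, hi]
      · simp
    · intro β _ hβ
      refine Finset.sum_eq_zero fun y _ => ?_
      rw [show Û ⟨β, y⟩ ⟨α, i, j⟩ = 0 from Matrix.blockDiagonal'_apply_ne _ _ _ hβ, map_zero,
        zero_smul]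
    · simp
  have hinv : scal A (1 - p) * Û * scal A p = 0 := by
    rw [← hX, scal_mul]
    have : scal A T * Û * scal A p = 0 := by
      ext k m
      rw [Matrix.zero_apply, ← Module.forall_dual_apply_eq_zero_iff ℂ]
      intro φ
      have h1 : (scal A T * Û * scal A p).map φ = T * (Û.map φ * p) := by
        rw [map_mul_scal, map_scal_mul, scal_self, scal_self, Matrix.mul_assoc]
      have h2 := congrFun (congrFun h1 k) m
      rw [Matrix.map_apply] at h2
      rw [h2]
      have h3 : L (fun r => (Û.map φ * p) r m) = 0 := by
        rw [hL]
        calc ∑ r, (Û.map φ * p) r m • e r = ∑ t, p t m • sliceRight φ (e t) := by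
              simp only [Matrix.mul_apply, hslice, Finset.smul_sum, Finset.sum_smul,
                Matrix.map_apply, smul_smul]
              rw [Finset.sum_comm]
              refine Finset.sum_congr rfl fun t _ => Finset.sum_congr rfl fun r _ => ?_
              rw [mul_comm]
          _ = sliceRight φ (∑ t, p t m • e t) := by simp [map_sum]
          _ = 0 := by rw [hcol, map_zero]
      exact congrFun ((hT _).2 h3) k
    rw [Matrix.mul_assoc (scal A X), Matrix.mul_assoc, this, Matrix.mul_zero]
  have hcomm := commute_of_invariant hÛS hps hpp hinv
  -- the block of `p` with indices `i`, `i'` intertwines `u^β` and `u^α`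
  have hblock : ∀ (α β : F) (i : Fin (U α).n) (i' : Fin (U β).n),
      (U α).u * scal A (Matrix.of fun k k' => p ⟨α, i, k⟩ ⟨β, i', k'⟩) =
        scal A (Matrix.of fun k k' => p ⟨α, i, k⟩ ⟨β, i', k'⟩) * (U β).u := by
    intro α β i i'
    ext k k'
    have h1 := congrFun (congrFun hcomm ⟨α, i, k⟩) ⟨β, i', k'⟩
    rw [blockDiagonal'_mul_apply, mul_blockDiagonal'_apply, Fintype.sum_prod_type,
      Fintype.sum_prod_type, Finset.sum_eq_single i, Finset.sum_eq_single i'] at h1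
    · simpa [M, Matrix.mul_apply] using h1
    · intro b _ hb
      simp [M, hb]
    · simp
    · intro b _ hb
      simp [M, hb.symm]
    · simp
  have hne : ∀ (α β : F), α ≠ β → ∀ (i k) (i' k'), p ⟨α, i, k⟩ ⟨β, i', k'⟩ = 0 := by
    intro α β hαβ i k i' k'
    rcases IrrRep.eq_zero_or_equivalent _ _ (hblock α β i i') with h | h
    · exact congrFun (congrFun h k) k'
    · exact (hαβ (Subtype.ext (eq_of_equivalent hU h))).elim
  have hsc : ∀ (α : F), ∃ C : Matrix (Fin (U α).n) (Fin (U α).n) ℂ, ∀ i k i' k',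
      p ⟨α, i, k⟩ ⟨α, i', k'⟩ = if k = k' then C i i' else 0 := by
    intro α
    choose C hC using fun i i' => (U α).irreducible _ (hblock α α i i')
    refine ⟨Matrix.of C, fun i k i' k' => ?_⟩
    have := congrFun (congrFun (hC i i') k) k'
    rw [Matrix.of_apply] at this
    rw [this, Matrix.smul_apply, Matrix.one_apply]
    simp
  have hp0 : p = 0 := by
    ext ⟨α, i, k⟩ ⟨β, i', k'⟩
    by_cases hαβ : α = β
    · subst hαβ
      obtain ⟨C, hC⟩ := hsc α
      have h1 : scal A Cᵀ * (U α).u = 0 := by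
        ext a b
        rw [scal_mul_apply]
        have h2 := hcol ⟨α, a, b⟩
        rw [Fintype.sum_sigma, Finset.sum_eq_single α, Fintype.sum_prod_type] at h2
        · simpa [hC, e] using h2
        · intro β _ hβ
          refine Finset.sum_eq_zero fun y _ => ?_
          rw [hne β α hβ, zero_smul]
        · simp
      have h3 : Cᵀ = 0 := by
        apply scal_injective (A := A)
        rw [scal_zero, ← Matrix.mul_one (scal A Cᵀ), ← (U α).mul_star, ← Matrix.mul_assoc, h1,
          Matrix.zero_mul]
      have h4 : C = 0 := by simpa using congrArg Matrix.transpose h3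
      rw [hC, h4]
      simp
    · exact hne α β hαβ i k i' k'
  have hXT : X * T = 1 := by rw [hX, hp0, sub_zero]
  have : T.mulVec c = 0 := (hT c).2 (by rw [hL]; exact hc)
  rw [← Matrix.one_mulVec c, ← hXT, ← Matrix.mulVec_mulVec, this, Matrix.mulVec_zero]

theorem linearIndependent_coef {U : Irr A → IrrRep A}
    (hU : ∀ α, (Quotient.mk _ (U α) : Irr A) = α) : LinearIndependent ℂ (coef U) := by
  classical
  rw [linearIndependent_iff']
  intro s g hg r hr
  let F := s.image Sigma.fst
  have hmem : r.1 ∈ F := Finset.mem_image_of_mem _ hr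
  let c : (Σ α : F, Fin (U α).n × Fin (U α).n) → ℂ :=
    fun t => if (⟨t.1, t.2⟩ : Σ α, Fin (U α).n × Fin (U α).n) ∈ s then g ⟨t.1, t.2⟩ else 0
  have hc := coef_relation_eq_zero hU F c (by
    rw [← hg]
    simp only [c, ite_smul, zero_smul]
    rw [← Finset.sum_filter]
    refine Finset.sum_bij' (fun t _ => ⟨t.1, t.2⟩)
      (fun t ht => ⟨⟨t.1, Finset.mem_image_of_mem _ ht⟩, t.2⟩) ?_ ?_ ?_ ?_ ?_
    · intro t ht; simpa using ht
    · intro t ht; simpa using ht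
    · intro t ht; rfl
    · intro t ht; rfl
    · intro t ht; rfl)
  have := congrFun hc ⟨⟨r.1, hmem⟩, r.2⟩
  simpa [c, hr] using this

variable [IsPol A]

theorem span_coef {U : Irr A → IrrRep A}
    (hU : ∀ α, (Quotient.mk _ (U α) : Irr A) = α) :
    ⊤ ≤ Submodule.span ℂ (Set.range (coef U)) := by
  rw [← IsPol.span_coeff (A := A), Submodule.span_le]
  rintro _ ⟨V, i, j, rfl⟩
  obtain ⟨D⟩ := V.isUnitaryCorep.nonempty_decomp U hU _ rfl
  have h1 := congrFun (congrFun D.eq_sum i) j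
  rw [SetLike.mem_coe, h1, Matrix.sum_apply]
  refine Submodule.sum_mem _ fun r _ => ?_
  rw [mul_scal_apply]
  refine Submodule.sum_mem _ fun b _ => Submodule.smul_mem _ _ ?_
  rw [scal_mul_apply]
  refine Submodule.sum_mem _ fun a _ => Submodule.smul_mem _ _ (Submodule.subset_span ?_)
  exact ⟨⟨D.cls r, a, b⟩, rfl⟩

/-- The Peter-Weyl basis of `Pol(𝔾)`, consisting of the coefficients of the irreducible
representations. -/
noncomputable def peterWeyl {U : Irr A → IrrRep A}
    (hU : ∀ α, (Quotient.mk _ (U α) : Irr A) = α) :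
    Module.Basis (Σ α, Fin (U α).n × Fin (U α).n) ℂ A :=
  Module.Basis.mk (linearIndependent_coef hU) (span_coef hU)

theorem peterWeyl_apply {U : Irr A → IrrRep A}
    (hU : ∀ α, (Quotient.mk _ (U α) : Irr A) = α) (α : Irr A) (i j : Fin (U α).n) :
    peterWeyl hU ⟨α, i, j⟩ = (U α).u i j := by
  rw [peterWeyl, Module.Basis.mk_apply]; rfl

end PeterWeyl

/-! ### Invariant functionals and the orthogonality relations -/

section Invariant

variable {A : Type*} [Ring A] [StarRing A] [HopfAlgebra ℂ A]

/-- A normalized functional on `Pol(𝔾)` which is left and right invariant. -/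
structure IsInvariant (h : A →ₗ[ℂ] ℂ) : Prop where
  map_one : h 1 = 1
  left : ∀ a, sliceLeft h a = h a • 1
  right : ∀ a, sliceRight h a = h a • 1

theorem IsHaarState.isInvariant {h : A →ₗ[ℂ] ℂ} (hh : IsHaarState h) : IsInvariant h :=
  ⟨hh.map_one, hh.left_invariant, hh.right_invariant⟩

/-- The trivial representation. -/
def trivialRep (A : Type*) [Ring A] [StarRing A] [HopfAlgebra ℂ A] : IrrRep A where
  n := 1
  u := 1
  comul_apply i j := by
    obtain rfl := Subsingleton.elim i 0
    obtain rfl := Subsingleton.elim j 0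
    simp [Algebra.TensorProduct.one_def]
  mul_star := by simp
  star_mul := by simp
  n_pos := one_pos
  irreducible T _ := ⟨T 0 0, by ext i j; rw [Subsingleton.elim i 0, Subsingleton.elim j 0]; simp⟩

theorem rep_trivial_eq_one {U : Irr A → IrrRep A}
    (hU : ∀ α, (Quotient.mk _ (U α) : Irr A) = α) :
    (U (Quotient.mk _ (trivialRep A))).u = 1 := by
  set V := U (Quotient.mk _ (trivialRep A)) with hV
  obtain ⟨T, hT1, hT2, hT⟩ : V.Equivalent (trivialRep A) := Quotient.exact (hU _)
  have hT' : V.u * scal A T = scal A T * (trivialRep A).u := hT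
  have h1 : (trivialRep A).u = 1 := rfl
  rw [h1, Matrix.mul_one] at hT'
  calc V.u = V.u * scal A T * scal A Tᴴ := by
        rw [Matrix.mul_assoc, ← scal_mul, hT1, scal_one, Matrix.mul_one]
    _ = 1 := by rw [hT', ← scal_mul, hT1, scal_one]

section Orthogonality

variable [StarModule ℂ A] [IsPol A]

theorem comul_star_mul (V W : UnitaryRep A) (i j : Fin V.n) (k l : Fin W.n) :
    Coalgebra.comul (R := ℂ) (star (V.u i j) * W.u k l) =
      ∑ p : Fin V.n × Fin W.n,
        (star (V.u i p.1) * W.u k p.2) ⊗ₜ[ℂ] (star (V.u p.1 j) * W.u p.2 l) := by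
  rw [Bialgebra.comul_mul, IsPol.comul_star, V.comul_apply, W.comul_apply, star_sum,
    Finset.sum_mul_sum, Fintype.sum_prod_type]
  simp

theorem comul_mul_star (V W : UnitaryRep A) (i j : Fin V.n) (k l : Fin W.n) :
    Coalgebra.comul (R := ℂ) (V.u i j * star (W.u k l)) =
      ∑ p : Fin V.n × Fin W.n,
        (V.u i p.1 * star (W.u k p.2)) ⊗ₜ[ℂ] (V.u p.1 j * star (W.u p.2 l)) := by
  rw [Bialgebra.comul_mul, IsPol.comul_star, V.comul_apply, W.comul_apply, star_sum,
    Finset.sum_mul_sum, Fintype.sum_prod_type]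
  simp

theorem comul_star_coef (V : UnitaryRep A) (i j : Fin V.n) :
    Coalgebra.comul (R := ℂ) (star (V.u i j)) =
      ∑ p, star (V.u i p) ⊗ₜ[ℂ] star (V.u p j) := by
  rw [IsPol.comul_star, V.comul_apply, star_sum]
  simp

variable {h : A →ₗ[ℂ] ℂ}

/-- By left invariance the matrix `[h((v_ir)* w_ks)]_{rs}` intertwines `w` and `v`. -/
theorem IsInvariant.star_mul_intertwiner (hh : IsInvariant h) (V W : IrrRep A) (i : Fin V.n)
    (k : Fin W.n) :
    V.u * scal A (Matrix.of fun r s => h (star (V.u i r) * W.u k s)) =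
      scal A (Matrix.of fun r s => h (star (V.u i r) * W.u k s)) * W.u := by
  set M : Matrix (Fin V.n) (Fin W.n) ℂ := Matrix.of fun r s => h (star (V.u i r) * W.u k s) with hM
  have h1 : V.uᴴ * (scal A M * W.u) = scal A M := by
    ext j l
    have h2 := hh.left (star (V.u i j) * W.u k l)
    rw [sliceLeft_eq (comul_star_mul _ _ _ _ _ _), Fintype.sum_prod_type] at h2
    rw [Matrix.mul_apply, scal_apply, hM, Matrix.of_apply, Algebra.algebraMap_eq_smul_one, ← h2]
    refine Finset.sum_congr rfl fun r _ => ?_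
    rw [scal_mul_apply, Finset.mul_sum]
    refine Finset.sum_congr rfl fun s _ => ?_
    rw [Matrix.conjTranspose_apply, mul_smul_comm]; rfl
  rw [← h1, ← Matrix.mul_assoc, V.mul_star, Matrix.one_mul, h1]

/-- By right invariance the matrix `[h(v_rj (w_sl)*)]_{rs}` intertwines `w` and `v`. -/
theorem IsInvariant.mul_star_intertwiner (hh : IsInvariant h) (V W : IrrRep A) (j : Fin V.n)
    (l : Fin W.n) :
    V.u * scal A (Matrix.of fun r s => h (V.u r j * star (W.u s l))) =
      scal A (Matrix.of fun r s => h (V.u r j * star (W.u s l))) * W.u := by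
  set M : Matrix (Fin V.n) (Fin W.n) ℂ := Matrix.of fun r s => h (V.u r j * star (W.u s l)) with hM
  have h1 : V.u * scal A M * W.uᴴ = scal A M := by
    ext i k
    have h2 := hh.right (V.u i j * star (W.u k l))
    rw [sliceRight_eq (comul_mul_star _ _ _ _ _ _), Fintype.sum_prod_type,
      Finset.sum_comm] at h2
    rw [Matrix.mul_apply, scal_apply, hM, Matrix.of_apply, Algebra.algebraMap_eq_smul_one, ← h2]
    refine Finset.sum_congr rfl fun r _ => ?_
    rw [mul_scal_apply, Finset.sum_mul]
    refine Finset.sum_congr rfl fun s _ => ?_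
    rw [Matrix.conjTranspose_apply, smul_mul_assoc]; rfl
  rw [← congrArg (· * W.u) h1]
  simp only [Matrix.mul_assoc, W.star_mul, Matrix.mul_one]

theorem IsInvariant.star_mul_of_not_equivalent (hh : IsInvariant h) {V W : IrrRep A}
    (hVW : ¬ V.Equivalent W) (i j : Fin V.n) (k l : Fin W.n) :
    h (star (V.u i j) * W.u k l) = 0 := by
  rcases IrrRep.eq_zero_or_equivalent _ _ (hh.star_mul_intertwiner V W i k) with h1 | h1
  · exact congrFun (congrFun h1 j) l
  · exact (hVW h1).elim

theorem IsInvariant.mul_star_of_not_equivalent (hh : IsInvariant h) {V W : IrrRep A}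
    (hVW : ¬ V.Equivalent W) (i j : Fin V.n) (k l : Fin W.n) :
    h (V.u i j * star (W.u k l)) = 0 := by
  rcases IrrRep.eq_zero_or_equivalent _ _ (hh.mul_star_intertwiner V W j l) with h1 | h1
  · exact congrFun (congrFun h1 i) k
  · exact (hVW h1).elim

theorem IsInvariant.exists_star_mul (hh : IsInvariant h) (V : IrrRep A) :
    ∃ D : Matrix (Fin V.n) (Fin V.n) ℂ,
      ∀ i j k l, h (star (V.u i j) * V.u k l) = if j = l then D i k else 0 := by
  choose D hD using fun i k => V.irreducible _ (hh.star_mul_intertwiner V V i k)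
  refine ⟨Matrix.of D, fun i j k l => ?_⟩
  have := congrFun (congrFun (hD i k) j) l
  rw [Matrix.of_apply] at this
  rw [this, Matrix.smul_apply, Matrix.one_apply]
  simp

theorem IsInvariant.exists_mul_star (hh : IsInvariant h) (V : IrrRep A) :
    ∃ C : Matrix (Fin V.n) (Fin V.n) ℂ,
      ∀ i j k l, h (V.u i j * star (V.u k l)) = if i = k then C j l else 0 := by
  choose D hD using fun i k => V.irreducible _ (hh.mul_star_intertwiner V V i k)
  refine ⟨Matrix.of D, fun i j k l => ?_⟩
  have := congrFun (congrFun (hD j l) i) k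
  rw [Matrix.of_apply] at this
  rw [this, Matrix.smul_apply, Matrix.one_apply]
  simp

/-- Slicing with the coordinate at `u^β_{rl}` maps `u^β_{kl}` to `u^β_{kr}`, and all other
coefficients to `0`. -/
theorem sliceRight_coord {U : Irr A → IrrRep A}
    (hU : ∀ α, (Quotient.mk _ (U α) : Irr A) = α) (β : Irr A) (r l : Fin (U β).n) (a : A) :
    sliceRight ((peterWeyl hU).coord ⟨β, r, l⟩) a =
      ∑ k, (peterWeyl hU).repr a ⟨β, k, l⟩ • (U β).u k r := by
  classical
  let f : A →ₗ[ℂ] A := ∑ k, ((peterWeyl hU).coord ⟨β, k, l⟩).smulRight ((U β).u k r)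
  have hf : sliceRight ((peterWeyl hU).coord ⟨β, r, l⟩) = f := by
    refine (peterWeyl hU).ext fun s => ?_
    obtain ⟨α, i, j⟩ := s
    rw [peterWeyl_apply, (U α).isUnitaryCorep.sliceRight_apply]
    simp only [f, LinearMap.sum_apply, LinearMap.smulRight_apply, Module.Basis.coord_apply,
      ← peterWeyl_apply hU, Module.Basis.repr_self]
    by_cases hαβ : α = β
    · subst hαβ
      simp [Finsupp.single_apply, ite_and]
    · have : ∀ x y, (⟨α, x⟩ : Σ α, Fin (U α).n × Fin (U α).n) ≠ ⟨β, y⟩ := fun x y hxy =>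
        hαβ (congrArg Sigma.fst hxy)
      simp [this]
  rw [hf]
  simp [f]

/-- The conjugate of an irreducible representation is equivalent, by a non-unitary intertwiner
`T`, to an irreducible unitary representation `v`. -/
theorem IrrRep.exists_conj_intertwiner {U : Irr A → IrrRep A}
    (hU : ∀ α, (Quotient.mk _ (U α) : Irr A) = α) (V : IrrRep A) :
    ∃ (β : Irr A) (T : Matrix (Fin V.n) (Fin (U β).n) ℂ), T ≠ 0 ∧
      V.u.map star * scal A T = scal A T * (U β).u := by
  have hne : star (V.u ⟨0, V.n_pos⟩ ⟨0, V.n_pos⟩) ≠ 0 :=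
    star_ne_zero.2 (V.isUnitaryCorep.entry_ne_zero _)
  obtain ⟨⟨β, k, l⟩, hs⟩ : ∃ s,
      (peterWeyl hU).repr (star (V.u ⟨0, V.n_pos⟩ ⟨0, V.n_pos⟩)) s ≠ 0 := by
    by_contra! hcon
    exact hne ((peterWeyl hU).repr.map_eq_zero_iff.1 (Finsupp.ext hcon))
  refine ⟨β, Matrix.of fun m r => (peterWeyl hU).repr (star (V.u m ⟨0, V.n_pos⟩)) ⟨β, r, l⟩,
    fun h0 => hs (congrFun (congrFun h0 ⟨0, V.n_pos⟩) k), ?_⟩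
  ext i r
  rw [mul_scal_apply, scal_mul_apply]
  have h1 := sliceRight_coord hU β r l (star (V.u i ⟨0, V.n_pos⟩))
  rw [sliceRight_eq (comul_star_coef _ _ _)] at h1
  exact h1

omit [IsPol A] in
/-- The range of a nonzero intertwiner `T` from a representation to the conjugate of `V` is
invariant; as `V` is irreducible, it is everything. -/
theorem IrrRep.surjective_of_conj_intertwiner (V : IrrRep A) {κ : Type*} [Fintype κ]
    [DecidableEq κ] {T : Matrix (Fin V.n) κ ℂ} (hT : T ≠ 0) {v : Matrix κ κ A}
    (h : V.u.map star * scal A T = scal A T * v) : ∃ X : Matrix κ (Fin V.n) ℂ, T * X = 1 := by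
  obtain ⟨p, X, hp, hpp, hTp, hX⟩ := exists_kernel_projection Tᴴ
  have hpT : p * T = 0 := by simpa [hp] using congrArg Matrix.conjTranspose hTp
  have hX' : T * Xᴴ = 1 - p := by simpa [hp] using congrArg Matrix.conjTranspose hX
  have h1 : scal A p * V.u.map star * scal A (1 - p) = 0 := by
    rw [← hX', scal_mul, ← Matrix.mul_assoc, Matrix.mul_assoc (scal A p), h, ← Matrix.mul_assoc,
      ← scal_mul, hpT, scal_zero, Matrix.zero_mul, Matrix.zero_mul]
  -- taking adjoints entrywise, the conjugate of `p` is the projection onto a subspace which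
  -- is invariant under `V`
  have h2 : scal A (1 - (1 - pᵀ)) * V.u * scal A (1 - pᵀ) = 0 := by
    have h3 := congrArg (fun M => Mᴴᵀ) h1
    have h4 : (V.u.map star)ᴴ = V.uᵀ := by ext; simp
    simp only [Matrix.conjTranspose_mul, ← scal_conjTranspose, h4, hp, Matrix.conjTranspose_sub,
      Matrix.conjTranspose_one, Matrix.conjTranspose_zero, Matrix.transpose_zero] at h3
    rw [transpose_scal_mul, transpose_mul_scal, Matrix.transpose_transpose] at h3
    simpa using h3
  have hpt : pᵀᴴ = pᵀ := by
    ext i j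
    exact congrFun (congrFun hp j) i
  have hptt : pᵀ * pᵀ = pᵀ := by rw [← Matrix.transpose_mul, hpp]
  have h3 := commute_of_invariant V.isUnitaryCorep.map_antipode (p := 1 - pᵀ)
    (by rw [Matrix.conjTranspose_sub, hpt, Matrix.conjTranspose_one])
    (by simp [Matrix.sub_mul, Matrix.mul_sub, hptt]) h2
  obtain ⟨c, hc⟩ := V.irreducible _ h3
  have hpc : p = (1 - c) • 1 := by
    have : pᵀ = (1 - c) • 1 := by rw [sub_smul, ← hc]; simp
    simpa using congrArg Matrix.transpose this
  have hc0 : 1 - c = 0 := by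
    by_contra hc0
    rw [hpc, Matrix.smul_mul, Matrix.one_mul, smul_eq_zero] at hpT
    exact hpT.elim hc0 hT
  exact ⟨Xᴴ, by rw [hX', hpc, hc0, zero_smul, sub_zero]⟩

open scoped ComplexOrder in
/-- The matrices of the orthogonality relations. If `T` intertwines the conjugate of `V` with a
unitary representation, both `D` and the inverse of `C` are multiples of the positive matrix
`G = T Tᴴ`. -/
theorem IsInvariant.exists_orthogonality (hh : IsInvariant h) {U : Irr A → IrrRep A}
    (hU : ∀ α, (Quotient.mk _ (U α) : Irr A) = α) (V : IrrRep A) :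
    ∃ G : Matrix (Fin V.n) (Fin V.n) ℂ, G.PosDef ∧
      (∀ i j k l, h (V.u i j * star (V.u k l)) = if i = k then G⁻¹ j l / G⁻¹.trace else 0) ∧
      (∀ i j k l, h (star (V.u i j) * V.u k l) = if j = l then G i k / G.trace else 0) := by
  obtain ⟨C, hC⟩ := hh.exists_mul_star V
  obtain ⟨D, hD⟩ := hh.exists_star_mul V
  let z : Fin V.n := ⟨0, V.n_pos⟩
  have hCtr : C.trace = 1 := by
    have h1 := congrArg h (congrFun (congrFun V.mul_star z) z)
    rw [Matrix.mul_apply, Matrix.one_apply_eq, hh.map_one, map_sum] at h1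
    simpa [Matrix.conjTranspose_apply, hC, Matrix.trace] using h1
  have hDtr : D.trace = 1 := by
    have h1 := congrArg h (congrFun (congrFun V.star_mul z) z)
    rw [Matrix.mul_apply, Matrix.one_apply_eq, hh.map_one, map_sum] at h1
    simpa [Matrix.conjTranspose_apply, hD, Matrix.trace] using h1
  have hCu : V.uᵀ * scal A C * V.u.map star = scal A C := by
    ext j l
    have h2 := hh.left (V.u z j * star (V.u z l))
    rw [sliceLeft_eq (comul_mul_star _ _ _ _ _ _), Fintype.sum_prod_type, Finset.sum_comm] at h2
    simp only [hC, if_true] at h2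
    rw [Matrix.mul_apply, scal_apply, Algebra.algebraMap_eq_smul_one, ← h2]
    refine Finset.sum_congr rfl fun s _ => ?_
    rw [mul_scal_apply, Finset.sum_mul]
    refine Finset.sum_congr rfl fun r _ => ?_
    rw [smul_mul_assoc]; rfl
  have hDu : V.u.map star * scal A D * V.uᵀ = scal A D := by
    ext i k
    have h2 := hh.right (star (V.u i z) * V.u k z)
    rw [sliceRight_eq (comul_star_mul _ _ _ _ _ _), Fintype.sum_prod_type, Finset.sum_comm] at h2
    simp only [hD, if_true] at h2
    rw [Matrix.mul_apply, scal_apply, Algebra.algebraMap_eq_smul_one, ← h2]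
    refine Finset.sum_congr rfl fun s _ => ?_
    rw [mul_scal_apply, Finset.sum_mul]
    refine Finset.sum_congr rfl fun r _ => ?_
    rw [smul_mul_assoc]; rfl
  obtain ⟨β, T, hT0, hT⟩ := V.exists_conj_intertwiner hU
  obtain ⟨X, hX⟩ := V.surjective_of_conj_intertwiner hT0 hT
  have hGu : V.u.map star * scal A (T * Tᴴ) * V.uᵀ = scal A (T * Tᴴ) := by
    have h1 : scal A Tᴴ * V.uᵀ = (U β).uᴴ * scal A Tᴴ := by
      have h2 := congrArg Matrix.conjTranspose hT
      have h4 : (V.u.map star)ᴴ = V.uᵀ := by ext; simp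
      simpa only [Matrix.conjTranspose_mul, ← scal_conjTranspose, h4] using h2
    rw [scal_mul, ← Matrix.mul_assoc, hT, Matrix.mul_assoc, h1, Matrix.mul_assoc,
      ← Matrix.mul_assoc (U β).u, (U β).mul_star, Matrix.one_mul]
  have hGpos : (T * Tᴴ).PosDef := by
    refine Matrix.PosDef.mul_conjTranspose_self T fun x y hxy => ?_
    have h1 := congrArg (fun v => Matrix.vecMul v X) hxy
    simpa [Matrix.vecMul_vecMul, hX] using h1
  set G := T * Tᴴ with hG
  have hGunit : IsUnit G.det := (Matrix.isUnit_iff_isUnit_det _).1 hGpos.isUnit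
  -- `C H` commutes with the transpose of `V` whenever `ū H uᵀ = H`
  have hscalar : ∀ H : Matrix (Fin V.n) (Fin V.n) ℂ,
      V.u.map star * scal A H * V.uᵀ = scal A H → ∃ c : ℂ, C * H = c • 1 := by
    intro H hH
    have h1 : scal A (C * H) * V.uᵀ = V.uᵀ * scal A (C * H) := by
      calc scal A (C * H) * V.uᵀ = V.uᵀ * scal A C * V.u.map star * scal A H * V.uᵀ := by
            rw [hCu, scal_mul]
        _ = V.uᵀ * scal A C * (V.u.map star * scal A H * V.uᵀ) := by
            simp only [Matrix.mul_assoc]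
        _ = _ := by rw [hH, scal_mul, Matrix.mul_assoc]
    have h2 := congrArg Matrix.transpose h1
    rw [transpose_scal_mul, transpose_mul_scal, Matrix.transpose_transpose] at h2
    obtain ⟨c, hc⟩ := V.irreducible _ h2
    refine ⟨c, ?_⟩
    simpa using congrArg Matrix.transpose hc
  obtain ⟨a, ha⟩ := hscalar G hGu
  obtain ⟨b, hb⟩ := hscalar D hDu
  have hCG : C = a • G⁻¹ := by
    rw [← Matrix.mul_one C, ← Matrix.mul_nonsing_inv G hGunit, ← Matrix.mul_assoc, ha,
      Matrix.smul_mul, Matrix.one_mul]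
  have ha1 : a * G⁻¹.trace = 1 := by
    rw [← hCtr, hCG, Matrix.trace_smul, smul_eq_mul]
  have ha0 : a ≠ 0 := left_ne_zero_of_mul_eq_one ha1
  have hDG : D = (b / a) • G := by
    have h1 : G⁻¹ * D = (b / a) • 1 := by
      rw [hCG, Matrix.smul_mul] at hb
      rw [div_eq_inv_mul, mul_smul, ← hb, smul_smul, inv_mul_cancel₀ ha0, one_smul]
    rw [← Matrix.one_mul D, ← Matrix.mul_nonsing_inv G hGunit, Matrix.mul_assoc, h1,
      Matrix.mul_smul, Matrix.mul_one]
  have hb1 : b / a * G.trace = 1 := by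
    rw [← hDtr, hDG, Matrix.trace_smul, smul_eq_mul]
  refine ⟨G, hGpos, fun i j k l => ?_, fun i j k l => ?_⟩
  · rw [hC, hCG, Matrix.smul_apply, smul_eq_mul, eq_inv_of_mul_eq_one_left ha1,
      div_eq_inv_mul]
  · rw [hD, hDG, Matrix.smul_apply, smul_eq_mul, eq_inv_of_mul_eq_one_left hb1,
      div_eq_inv_mul]

end Orthogonality

end Invariant

/-! ### The Haar state and the matrices `Q` -/

section Haar

variable {A : Type*} [Ring A] [StarRing A] [HopfAlgebra ℂ A] [StarModule ℂ A] [IsPol A]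
variable {U : Irr A → IrrRep A} (hU : ∀ α, (Quotient.mk _ (U α) : Irr A) = α)

theorem eq_sum_coord (a : A) {F : Finset (Irr A)}
    (hF : ∀ α ∉ F, ∀ i j, (peterWeyl hU).repr a ⟨α, i, j⟩ = 0) :
    a = ∑ α ∈ F, ∑ i, ∑ j, (peterWeyl hU).repr a ⟨α, i, j⟩ • (U α).u i j := by
  classical
  set f := (peterWeyl hU).repr a
  have h1 : a = ∑ s ∈ f.support, f s • peterWeyl hU s :=
    ((peterWeyl hU).linearCombination_repr a).symm
  have h2 : f.support ⊆ F.sigma fun α => (Finset.univ : Finset (Fin (U α).n × Fin (U α).n)) := by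
    rintro ⟨α, i, j⟩ hs
    rw [Finset.mem_sigma]
    refine ⟨?_, Finset.mem_univ _⟩
    by_contra hα
    exact Finsupp.mem_support_iff.1 hs (hF α hα i j)
  rw [Finset.sum_subset h2 fun s _ hs => by rw [Finsupp.notMem_support_iff.1 hs, zero_smul],
    Finset.sum_sigma] at h1
  refine h1.trans (Finset.sum_congr rfl fun α _ => ?_)
  rw [Fintype.sum_prod_type]
  simp only [peterWeyl_apply]

theorem exists_finset_coord (a : A) : ∃ F : Finset (Irr A),
    ∀ α ∉ F, ∀ i j, (peterWeyl hU).repr a ⟨α, i, j⟩ = 0 := by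
  classical
  refine ⟨((peterWeyl hU).repr a).support.image Sigma.fst, fun α hα i j => ?_⟩
  by_contra hne
  exact hα (Finset.mem_image_of_mem Sigma.fst (Finsupp.mem_support_iff.2 hne))

open Classical in
/-- The Haar functional: the sum of the diagonal coordinates at the trivial representation. -/
noncomputable def haarFunctional : A →ₗ[ℂ] ℂ :=
  (peterWeyl hU).constr ℂ fun s =>
    if s.1 = Quotient.mk _ (trivialRep A) ∧ s.2.1 = s.2.2 then 1 else 0

theorem haarFunctional_trivial (i j : Fin (U (Quotient.mk _ (trivialRep A))).n) :
    haarFunctional hU ((U (Quotient.mk _ (trivialRep A))).u i j) = if i = j then 1 else 0 := by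
  rw [← peterWeyl_apply hU, haarFunctional, Module.Basis.constr_basis]
  simp

theorem haarFunctional_of_ne {α : Irr A} (hα : α ≠ Quotient.mk _ (trivialRep A))
    (i j : Fin (U α).n) : haarFunctional hU ((U α).u i j) = 0 := by
  rw [← peterWeyl_apply hU, haarFunctional, Module.Basis.constr_basis]
  simp [hα]

theorem haarFunctional_isInvariant : IsInvariant (haarFunctional hU) := by
  set τ : Irr A := Quotient.mk _ (trivialRep A) with hτ
  have h1 : (U τ).u = 1 := rep_trivial_eq_one hU
  have hentry : ∀ i j, (U τ).u i j = if i = j then 1 else 0 := fun i j => by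
    rw [h1, Matrix.one_apply]
  have htr : ∀ i j, haarFunctional hU ((U τ).u i j) = if i = j then 1 else 0 :=
    haarFunctional_trivial hU
  refine ⟨?_, ?_, ?_⟩
  · have := htr ⟨0, (U τ).n_pos⟩ ⟨0, (U τ).n_pos⟩
    rw [hentry] at this
    simpa using this
  · intro a
    have : sliceLeft (haarFunctional hU) = (haarFunctional hU).smulRight 1 := by
      refine (peterWeyl hU).ext fun ⟨α, i, j⟩ => ?_
      rw [peterWeyl_apply, (U α).isUnitaryCorep.sliceLeft_apply, LinearMap.smulRight_apply]
      by_cases hα : α = τ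
      · subst hα
        simp only [htr]
        simp [hentry]
      · simp [haarFunctional_of_ne hU hα]
    rw [this]; rfl
  · intro a
    have : sliceRight (haarFunctional hU) = (haarFunctional hU).smulRight 1 := by
      refine (peterWeyl hU).ext fun ⟨α, i, j⟩ => ?_
      rw [peterWeyl_apply, (U α).isUnitaryCorep.sliceRight_apply, LinearMap.smulRight_apply]
      by_cases hα : α = τ
      · subst hα
        simp only [htr]
        simp [hentry]
      · simp [haarFunctional_of_ne hU hα]
    rw [this]; rfl

include hU

open scoped ComplexOrder in
/-- The positivity of an invariant functional follows from the orthogonality relations. -/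
theorem IsInvariant.nonneg {h : A →ₗ[ℂ] ℂ} (hh : IsInvariant h) (a : A) :
    0 ≤ h (star a * a) := by
  classical
  obtain ⟨F, hF⟩ := exists_finset_coord hU a
  have ha := eq_sum_coord hU a hF
  set c := (peterWeyl hU).repr a
  have key : ∀ α ∈ F, h (star (∑ i, ∑ j, c ⟨α, i, j⟩ • (U α).u i j) * a) =
      h (star (∑ i, ∑ j, c ⟨α, i, j⟩ • (U α).u i j) *
        ∑ i, ∑ j, c ⟨α, i, j⟩ • (U α).u i j) := by
    intro α hα
    conv_lhs => rw [ha, Finset.mul_sum, map_sum]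
    rw [Finset.sum_eq_single α]
    · intro β _ hβ
      simp only [star_sum, star_smul, Finset.sum_mul, Finset.mul_sum, smul_mul_assoc,
        mul_smul_comm, map_sum, map_smul]
      simp [hh.star_mul_of_not_equivalent fun h => hβ (eq_of_equivalent hU h).symm]
    · exact fun h => (h hα).elim
  have e1 : h (star a * a) = ∑ α ∈ F, h (star (∑ i, ∑ j, c ⟨α, i, j⟩ • (U α).u i j) *
      ∑ i, ∑ j, c ⟨α, i, j⟩ • (U α).u i j) := by
    rw [← Finset.sum_congr rfl key, ← map_sum, ← Finset.sum_mul, ← star_sum, ← ha]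
  rw [e1]
  refine Finset.sum_nonneg fun α _ => ?_
  obtain ⟨G, hG, -, hGh⟩ := hh.exists_orthogonality hU (U α)
  have : Nonempty (Fin (U α).n) := ⟨⟨0, (U α).n_pos⟩⟩
  have e2 : h (star (∑ i, ∑ j, c ⟨α, i, j⟩ • (U α).u i j) *
      ∑ i, ∑ j, c ⟨α, i, j⟩ • (U α).u i j) =
      (∑ j, star (fun i => c ⟨α, i, j⟩) ⬝ᵥ G.mulVec fun i => c ⟨α, i, j⟩) / G.trace := by
    simp only [star_sum, star_smul, Finset.sum_mul, Finset.mul_sum, smul_mul_assoc,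
        mul_smul_comm, map_sum, map_smul, hGh, dotProduct, Matrix.mulVec, Finset.sum_div]
    rw [Finset.sum_comm]
    refine Finset.sum_congr rfl fun j _ => ?_
    simp only [smul_eq_mul, mul_ite, mul_zero, Finset.sum_ite_eq', Finset.mem_univ, if_true,
      Finset.mul_sum]
    rw [Finset.sum_comm]
    refine Finset.sum_congr rfl fun i _ => Finset.sum_congr rfl fun k _ => ?_
    rw [Pi.star_apply]
    ring
  rw [e2]
  refine div_nonneg (Finset.sum_nonneg fun j _ => ?_) hG.trace_pos.le
  exact hG.posSemidef.dotProduct_mulVec_nonneg _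

theorem isHaarState_haar : IsHaarState (haar A) := by
  have h1 := haarFunctional_isInvariant hU
  exact Classical.epsilon_spec (p := IsHaarState)
    ⟨haarFunctional hU, h1.map_one, h1.nonneg hU, h1.left, h1.right⟩

open scoped ComplexOrder in
theorem isQMatrix_qMatrix (V : IrrRep A) : IsQMatrix V (qMatrix V) := by
  refine Classical.epsilon_spec (p := IsQMatrix V) ?_
  obtain ⟨G, hG, h1, h2⟩ := (isHaarState_haar hU).isInvariant.exists_orthogonality hU V
  have : Nonempty (Fin V.n) := ⟨⟨0, V.n_pos⟩⟩
  have hGdet : IsUnit G.det := (Matrix.isUnit_iff_isUnit_det _).1 hG.isUnit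
  have hGi := hG.inv
  obtain ⟨s, hs, hs'⟩ : ∃ s : ℝ, 0 < s ∧ (s : ℂ) = G.trace := by
    have := Complex.pos_iff.1 hG.trace_pos
    exact ⟨G.trace.re, this.1, Complex.ext rfl this.2⟩
  obtain ⟨t, ht, ht'⟩ : ∃ t : ℝ, 0 < t ∧ (t : ℂ) = G⁻¹.trace := by
    have := Complex.pos_iff.1 hGi.trace_pos
    exact ⟨G⁻¹.trace.re, this.1, Complex.ext rfl this.2⟩
  -- the multiple `τ G⁻ᵀ` of `G⁻ᵀ` which has the same trace as its inverse
  set τ : ℝ := Real.sqrt (s / t) with hτ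
  have hτ0 : 0 < τ := Real.sqrt_pos.2 (div_pos hs ht)
  have hτ2 : τ * τ * t = s := by
    rw [Real.mul_self_sqrt (div_pos hs ht).le, div_mul_cancel₀ _ ht.ne']
  have hτc : (τ : ℂ) ≠ 0 := by exact_mod_cast hτ0.ne'
  have hsc : (s : ℂ) ≠ 0 := by exact_mod_cast hs.ne'
  have htc : (t : ℂ) ≠ 0 := by exact_mod_cast ht.ne'
  have hinv : ((τ : ℂ) • G⁻¹ᵀ)⁻¹ = (τ : ℂ)⁻¹ • Gᵀ := by
    refine Matrix.inv_eq_right_inv ?_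
    rw [Matrix.smul_mul, Matrix.mul_smul, ← Matrix.transpose_mul, Matrix.mul_nonsing_inv _ hGdet,
      smul_smul, mul_inv_cancel₀ hτc, one_smul, Matrix.transpose_one]
  refine ⟨(τ : ℂ) • G⁻¹ᵀ, hGi.transpose.smul (by exact_mod_cast hτ0), ?_, ?_, ?_⟩
  · rw [hinv, Matrix.trace_smul, Matrix.trace_smul, Matrix.trace_transpose,
      Matrix.trace_transpose, ← hs', ← ht', ← hτ2]
    push_cast
    simp only [smul_eq_mul]
    field_simp
  · intro i j k l
    rw [h1, Matrix.trace_smul, Matrix.trace_transpose, Matrix.smul_apply, Matrix.transpose_apply,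
      smul_eq_mul, smul_eq_mul, mul_div_mul_left _ _ hτc]
  · intro i j k l
    rw [h2, Matrix.trace_smul, hinv, Matrix.trace_transpose, Matrix.smul_apply,
      Matrix.transpose_apply, ← hs', ← ht', ← hτ2]
    simp only [smul_eq_mul]
    push_cast
    congr 1
    field_simp

end Haar

/-! ### Fourier inversion and the modular automorphism of the Haar state -/

section QMatrix

variable {A : Type*} [Ring A] [StarRing A] [HopfAlgebra ℂ A] {V : IrrRep A}

open scoped ComplexOrder in
theorem IsQMatrix.qDim_pos (hQ : IsQMatrix V (qMatrix V)) : 0 < qDim V := by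
  have : Nonempty (Fin V.n) := ⟨⟨0, V.n_pos⟩⟩
  exact (Complex.pos_iff.1 hQ.posDef.trace_pos).1

open scoped ComplexOrder in
theorem IsQMatrix.qDim_coe (hQ : IsQMatrix V (qMatrix V)) :
    (qDim V : ℂ) = (qMatrix V).trace := by
  have : Nonempty (Fin V.n) := ⟨⟨0, V.n_pos⟩⟩
  exact Complex.ext rfl (Complex.pos_iff.1 hQ.posDef.trace_pos).2

theorem IsQMatrix.qDim_ne_zero (hQ : IsQMatrix V (qMatrix V)) : (qDim V : ℂ) ≠ 0 := by
  exact_mod_cast hQ.qDim_pos.ne'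

open scoped ComplexOrder in
theorem IsQMatrix.isUnit_det (hQ : IsQMatrix V (qMatrix V)) : IsUnit (qMatrix V).det :=
  (Matrix.isUnit_iff_isUnit_det _).1 hQ.posDef.isUnit

open scoped MatrixOrder ComplexOrder in
theorem IsQMatrix.qSqrt_mul_self (hQ : IsQMatrix V (qMatrix V)) :
    qSqrt V * qSqrt V = qMatrix V :=
  CFC.sqrt_mul_sqrt_self _ hQ.posDef.posSemidef.nonneg

open scoped MatrixOrder ComplexOrder in
theorem qSqrt_posSemidef (V : IrrRep A) : (qSqrt V).PosSemidef :=
  Matrix.nonneg_iff_posSemidef.1 (CFC.sqrt_nonneg _)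

theorem IsQMatrix.isUnit_det_qSqrt (hQ : IsQMatrix V (qMatrix V)) : IsUnit (qSqrt V).det := by
  have := hQ.isUnit_det
  rw [← hQ.qSqrt_mul_self, Matrix.det_mul] at this
  exact isUnit_of_mul_isUnit_left this

end QMatrix

section Fourier

variable {A : Type*} [Ring A] [StarRing A] [HopfAlgebra ℂ A] {U : Irr A → IrrRep A}

theorem funct_matUnit (X : MatFam U) (α : Irr A) (i j : Fin (U α).n) :
    funct U X (matUnit U α i j) = (qDim (U α) : ℂ) * (X α * qMatrix (U α)) j i := by
  classical
  rw [funct, dualHaar, finsum_eq_single _ α]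
  · rw [matUnit, Pi.single_eq_same, Matrix.trace_mul_comm, Matrix.mul_assoc,
      Matrix.trace_single_mul, one_smul]
  · intro β hβ
    rw [matUnit, Pi.single_eq_of_ne hβ, Matrix.zero_mul, Matrix.mul_zero, Matrix.trace_zero,
      mul_zero]

variable [StarModule ℂ A] [IsPol A] (hU : ∀ α, (Quotient.mk _ (U α) : Irr A) = α)

/-- **Fourier inversion**: the coordinates of `x` in the Peter-Weyl basis. -/
theorem repr_eq_fourier (x : A) (α : Irr A) (i j : Fin (U α).n) :
    (peterWeyl hU).repr x ⟨α, i, j⟩ =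
      (qDim (U α) : ℂ) * (fourier U x α * qMatrix (U α)) j i := by
  classical
  have hQ := isQMatrix_qMatrix hU (U α)
  let f : A →ₗ[ℂ] ℂ := (qDim (U α) : ℂ) • ∑ b, qMatrix (U α) b i •
    (haar A ∘ₗ LinearMap.mulLeft ℂ (star ((U α).u b j)))
  have hf : ∀ x, f x = (qDim (U α) : ℂ) * (fourier U x α * qMatrix (U α)) j i := by
    intro x
    simp [f, Matrix.mul_apply, fourier, mul_comm]
  rw [← hf, ← Module.Basis.coord_apply]
  congr 1
  refine (peterWeyl hU).ext fun ⟨β, r, s⟩ => ?_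
  rw [hf, peterWeyl_apply, ← peterWeyl_apply hU, Module.Basis.coord_apply,
    Module.Basis.repr_self, peterWeyl_apply, Matrix.mul_apply]
  by_cases hαβ : β = α
  · subst hαβ
    simp only [fourier, Matrix.of_apply, hQ.haar_star_mul, ← hQ.qDim_coe]
    have h1 := congrFun (congrFun (Matrix.nonsing_inv_mul _ hQ.isUnit_det) r) i
    rw [Matrix.mul_apply, Matrix.one_apply] at h1
    have h2 : ∀ b, (if j = s then (qMatrix (U β))⁻¹ r b / (qDim (U β) : ℂ) else 0) *
        qMatrix (U β) b i = (if j = s then (qDim (U β) : ℂ)⁻¹ else 0) *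
          ((qMatrix (U β))⁻¹ r b * qMatrix (U β) b i) := by
      intro b
      split_ifs <;> ring
    simp only [h2]
    rw [← Finset.mul_sum, h1, Finsupp.single_apply]
    have h3 := hQ.qDim_ne_zero
    by_cases hj : j = s <;> by_cases hr : r = i <;> simp [hj, hr, h3]
    exact fun h => (hj h.symm).elim
  · have h1 := (isHaarState_haar hU).isInvariant.star_mul_of_not_equivalent (V := U α) (W := U β)
      fun h => hαβ (eq_of_equivalent hU h).symm
    rw [Finsupp.single_eq_of_ne (fun h => hαβ (congrArg Sigma.fst h).symm)]
    simp [fourier, h1]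

theorem funct_fourier_matUnit (x : A) (α : Irr A) (i j : Fin (U α).n) :
    funct U (fourier U x) (matUnit U α i j) = (peterWeyl hU).repr x ⟨α, i, j⟩ := by
  rw [funct_matUnit, repr_eq_fourier]

theorem eq_finsum_coord (x : A) :
    x = ∑ᶠ α, ∑ i, ∑ j, (peterWeyl hU).repr x ⟨α, i, j⟩ • (U α).u i j := by
  obtain ⟨F, hF⟩ := exists_finset_coord hU x
  rw [finsum_eq_sum_of_support_subset (s := F)]
  · exact eq_sum_coord hU x hF
  · intro α hα
    by_contra hαF
    refine hα ?_
    simp [hF α hαF]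

include hU

/-- The products of coefficients are expanded by the dual comultiplication, that is,
`(Δ̂ ⊗ id) U = U₁₂ U₁₃`. -/
theorem coef_mul_coef (β γ : Irr A) (k l : Fin (U β).n) (p q : Fin (U γ).n) :
    (U β).u k l * (U γ).u p q = ∑ᶠ α, ∑ i, ∑ j,
      dualComul U (matUnit U α i j) β γ (k, p) (l, q) • (U α).u i j := by
  conv_lhs => rw [eq_finsum_coord hU ((U β).u k l * (U γ).u p q)]
  simp only [dualComul, Matrix.of_apply, funct_fourier_matUnit hU]

theorem coef_induction {p : A → Prop} (h0 : p 0) (hadd : ∀ a b, p a → p b → p (a + b))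
    (hsmul : ∀ (c : ℂ) a, p a → p (c • a)) (hcoef : ∀ α i j, p ((U α).u i j)) (a : A) : p a := by
  have ha : a ∈ Submodule.span ℂ (Set.range (coef U)) := span_coef hU trivial
  induction ha using Submodule.span_induction with
  | mem x hx => obtain ⟨⟨α, i, j⟩, rfl⟩ := hx; exact hcoef α i j
  | zero => exact h0
  | add x y _ _ hx hy => exact hadd x y hx hy
  | smul c x _ hx => exact hsmul c x hx

/-- The Haar state is nondegenerate. -/
theorem eq_zero_of_haar_mul_eq_zero {x : A} (hx : ∀ c, haar A (c * x) = 0) : x = 0 := by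
  apply (peterWeyl hU).repr.map_eq_zero_iff.1
  ext ⟨α, i, j⟩
  rw [repr_eq_fourier]
  simp [Matrix.mul_apply, fourier, hx]

/-- The modular automorphism `σ` of the Haar state, `σ(u^α) = Q_α u^α Q_α`. It is defined as a
linear map. -/
noncomputable def modular : A →ₗ[ℂ] A :=
  (peterWeyl hU).constr ℂ fun s =>
    (scal A (qMatrix (U s.1)) * (U s.1).u * scal A (qMatrix (U s.1))) s.2.1 s.2.2

theorem modular_coef (α : Irr A) (i j : Fin (U α).n) : modular hU ((U α).u i j) =
    (scal A (qMatrix (U α)) * (U α).u * scal A (qMatrix (U α))) i j := by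
  rw [← peterWeyl_apply hU, modular, Module.Basis.constr_basis]

/-- The twisted trace property `h(ab) = h(b σ(a))`, a consequence of the orthogonality relations. -/
theorem haar_mul_eq (a b : A) : haar A (a * b) = haar A (b * modular hU a) := by
  classical
  revert b
  suffices hs : ∀ c, haar A (a * star c) = haar A (star c * modular hU a) by
    intro b
    simpa using hs (star b)
  refine coef_induction hU (p := fun a => ∀ c, haar A (a * star c) =
    haar A (star c * modular hU a)) ?_ ?_ ?_ ?_ a
  · simp
  · intro a b ha hb c
    rw [add_mul, map_add, map_add, mul_add, map_add, ha, hb]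
  · intro r a ha c
    rw [smul_mul_assoc, map_smul, map_smul, mul_smul_comm, map_smul, ha]
  intro α k l c
  refine coef_induction hU (p := fun c => haar A ((U α).u k l * star c) =
    haar A (star c * modular hU ((U α).u k l))) ?_ ?_ ?_ ?_ c
  · simp
  · intro a b ha hb
    rw [star_add, mul_add, map_add, add_mul, map_add, ha, hb]
  · intro r a ha
    rw [star_smul, smul_mul_assoc, map_smul, mul_smul_comm, map_smul, ha]
  intro β i j
  rw [modular_coef, mul_scal_apply]
  simp only [scal_mul_apply, Finset.mul_sum, mul_smul_comm, Finset.smul_sum, map_sum, map_smul]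
  by_cases hαβ : α = β
  · subst hαβ
    have hQ := isQMatrix_qMatrix hU (U α)
    simp only [hQ.haar_mul_star, hQ.haar_star_mul]
    have h1 := congrFun (congrFun (Matrix.mul_nonsing_inv _ hQ.isUnit_det) k) i
    rw [Matrix.mul_apply, Matrix.one_apply] at h1
    simp only [smul_eq_mul, mul_ite, mul_zero]
    rw [Finset.sum_comm]
    simp only [Finset.sum_ite_eq, Finset.mem_univ, if_true]
    calc _ = (if k = i then 1 else 0) * (qMatrix (U α) j l / (qMatrix (U α)).trace) := by
          split_ifs <;> simp
      _ = _ := by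
          rw [← h1, Finset.sum_mul]
          refine Finset.sum_congr rfl fun r _ => ?_
          ring
  · have h1 := (isHaarState_haar hU).isInvariant.mul_star_of_not_equivalent (V := U α) (W := U β)
      fun h => hαβ (eq_of_equivalent hU h)
    have h2 := (isHaarState_haar hU).isInvariant.star_mul_of_not_equivalent (V := U β) (W := U α)
      fun h => hαβ (eq_of_equivalent hU h).symm
    simp [h1, h2]

/-- As `h` is nondegenerate, the twisted trace property makes `σ` multiplicative. -/
theorem modular_mul (a b : A) : modular hU (a * b) = modular hU a * modular hU b := by
  refine sub_eq_zero.1 (eq_zero_of_haar_mul_eq_zero hU fun c => ?_)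
  rw [mul_sub, map_sub, ← haar_mul_eq, mul_assoc, haar_mul_eq hU a, mul_assoc b c,
    haar_mul_eq hU b, mul_assoc c, sub_self]

/-- The character `ε ∘ σ`, whose value at `u^α` is `Q_α²`. -/
noncomputable def sqCharacter : A →ₗ[ℂ] ℂ := Coalgebra.counit ∘ₗ modular hU

theorem sqCharacter_mul (a b : A) :
    sqCharacter hU (a * b) = sqCharacter hU a * sqCharacter hU b := by
  simp [sqCharacter, modular_mul, Bialgebra.counit_mul]

theorem map_sqCharacter (α : Irr A) :
    (U α).u.map (sqCharacter hU) = qMatrix (U α) * qMatrix (U α) := by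
  have h1 : (U α).u.map (sqCharacter hU) =
      (scal A (qMatrix (U α)) * (U α).u * scal A (qMatrix (U α))).map
        (Coalgebra.counit (R := ℂ) (A := A)) := by
    ext i j
    simp [sqCharacter, modular_coef]
  rw [h1, map_mul_scal, map_scal_mul, (U α).isUnitaryCorep.map_counit, scal_self, Matrix.mul_one]

end Fourier

/-! ### Tensor products and the multiplicativity of the matrices `Q` -/

section TensorRep

variable {A : Type*} [Ring A] [StarRing A] [HopfAlgebra ℂ A]

/-- The tensor product of two representations. -/
def tensorRep (V W : UnitaryRep A) : Matrix (Fin V.n × Fin W.n) (Fin V.n × Fin W.n) A :=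
  Matrix.kronecker V.u W.u

theorem tensorRep_apply (V W : UnitaryRep A) (s t : Fin V.n × Fin W.n) :
    tensorRep V W s t = V.u s.1 t.1 * W.u s.2 t.2 := rfl

theorem tensorRep_isUnitaryCorep (V W : UnitaryRep A) : IsUnitaryCorep (tensorRep V W) := by
  classical
  refine ⟨?_, ?_, ?_⟩
  · rintro ⟨i, j⟩ ⟨k, l⟩
    rw [tensorRep_apply, Bialgebra.comul_mul, V.comul_apply, W.comul_apply, Finset.sum_mul_sum,
      Fintype.sum_prod_type]
    simp [tensorRep_apply]
  · ext ⟨i, j⟩ ⟨k, l⟩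
    have h1 := congrFun (congrFun W.mul_star j) l
    have h2 := congrFun (congrFun V.mul_star i) k
    rw [Matrix.mul_apply] at h1 h2 ⊢
    simp only [Matrix.conjTranspose_apply, tensorRep_apply, star_mul] at h1 h2 ⊢
    rw [Fintype.sum_prod_type]
    have h3 : ∀ x, ∑ y, V.u i x * W.u j y * (star (W.u l y) * star (V.u k x)) =
        V.u i x * (1 : Matrix _ _ A) j l * star (V.u k x) := by
      intro x
      rw [← h1, Finset.mul_sum, Finset.sum_mul]
      simp only [mul_assoc]
    simp only [h3]
    by_cases hjl : j = l
    · subst hjl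
      simp only [Matrix.one_apply_eq, mul_one, h2]
      simp [Matrix.one_apply]
    · simp [hjl]
  · ext ⟨i, j⟩ ⟨k, l⟩
    have h1 := congrFun (congrFun W.star_mul j) l
    have h2 := congrFun (congrFun V.star_mul i) k
    rw [Matrix.mul_apply] at h1 h2 ⊢
    simp only [Matrix.conjTranspose_apply, tensorRep_apply, star_mul] at h1 h2 ⊢
    rw [Fintype.sum_prod_type, Finset.sum_comm]
    have h3 : ∀ y, ∑ x, star (W.u y j) * star (V.u x i) * (V.u x k * W.u y l) =
        star (W.u y j) * (1 : Matrix _ _ A) i k * W.u y l := by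
      intro x
      rw [← h2, Finset.mul_sum, Finset.sum_mul]
      simp only [mul_assoc]
    simp only [h3]
    by_cases hik : i = k
    · subst hik
      simp only [Matrix.one_apply_eq, mul_one, h1]
      simp [Matrix.one_apply]
    · simp [hik]

end TensorRep

section DecompSum

variable {A : Type*} [Ring A] [StarRing A] [HopfAlgebra ℂ A] {U : Irr A → IrrRep A}

theorem Decomp.conj_mul_conj {ι : Type*} [Fintype ι] [DecidableEq ι] {u : Matrix ι ι A}
    (D : Decomp U u) (M N : ∀ r, Matrix (Fin (U (D.cls r)).n) (Fin (U (D.cls r)).n) ℂ) :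
    (∑ r, D.W r * M r * (D.W r)ᴴ) * (∑ r, D.W r * N r * (D.W r)ᴴ) =
      ∑ r, D.W r * (M r * N r) * (D.W r)ᴴ := by
  rw [Finset.sum_mul]
  refine Finset.sum_congr rfl fun r _ => ?_
  rw [Finset.mul_sum, Finset.sum_eq_single r]
  · calc _ = D.W r * M r * ((D.W r)ᴴ * D.W r) * N r * (D.W r)ᴴ := by simp only [Matrix.mul_assoc]
      _ = _ := by rw [D.isometry, Matrix.mul_one, Matrix.mul_assoc (D.W r)]
  · intro s _ hs
    calc _ = D.W r * M r * ((D.W r)ᴴ * D.W s) * N s * (D.W s)ᴴ := by simp only [Matrix.mul_assoc]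
      _ = _ := by rw [D.orthogonal _ _ hs.symm]; simp
  · simp

end DecompSum

section Multiplicativity

variable {A : Type*} [Ring A] [StarRing A] [HopfAlgebra ℂ A] [StarModule ℂ A] [IsPol A]
variable {U : Irr A → IrrRep A} (hU : ∀ α, (Quotient.mk _ (U α) : Irr A) = α)

include hU

open scoped MatrixOrder ComplexOrder in
/-- The square roots of the matrices `Q` are multiplicative: the squares of the matrices `Q` are the
values of the character `ε ∘ σ`, and positive square roots are unique. -/
theorem kronecker_qSqrt {β γ : Irr A} (D : Decomp U (tensorRep (U β).toUnitaryRep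
    (U γ).toUnitaryRep)) : Matrix.kronecker (qSqrt (U β)) (qSqrt (U γ)) =
      ∑ r, D.W r * qSqrt (U (D.cls r)) * (D.W r)ᴴ := by
  have hQ : ∀ α, qSqrt (U α) * qSqrt (U α) = qMatrix (U α) := fun α =>
    (isQMatrix_qMatrix hU (U α)).qSqrt_mul_self
  have hpos : ∀ α, (qMatrix (U α)).PosSemidef := fun α =>
    (isQMatrix_qMatrix hU (U α)).posDef.posSemidef
  have hsum : ∀ M : ∀ α, Matrix (Fin (U α).n) (Fin (U α).n) ℂ, (∀ α, (M α).PosSemidef) →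
      0 ≤ ∑ r, D.W r * M (D.cls r) * (D.W r)ᴴ := fun M hM =>
    Finset.sum_nonneg fun r _ => ((hM _).mul_mul_conjTranspose_same _).nonneg
  have h1 : Matrix.kronecker (qMatrix (U β) * qMatrix (U β)) (qMatrix (U γ) * qMatrix (U γ)) =
      ∑ r, D.W r * (qMatrix (U (D.cls r)) * qMatrix (U (D.cls r))) * (D.W r)ᴴ := by
    rw [← map_sqCharacter hU, ← map_sqCharacter hU]
    have h2 := congrArg (fun M => M.map (sqCharacter hU)) D.eq_sum
    have h3 : (tensorRep (U β).toUnitaryRep (U γ).toUnitaryRep).map (sqCharacter hU) =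
        Matrix.kronecker ((U β).u.map (sqCharacter hU)) ((U γ).u.map (sqCharacter hU)) := by
      ext s t
      exact sqCharacter_mul hU _ _
    rw [← h3, h2]
    ext i j
    simp only [Matrix.map_apply, Matrix.sum_apply, map_sum]
    refine Finset.sum_congr rfl fun r _ => ?_
    have h2 : (scal A (D.W r) * (U (D.cls r)).u * scal A (D.W r)ᴴ).map (sqCharacter hU) =
        D.W r * (qMatrix (U (D.cls r)) * qMatrix (U (D.cls r))) * (D.W r)ᴴ := by
      rw [map_mul_scal, map_scal_mul, map_sqCharacter, scal_self, scal_self]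
    exact congrFun (congrFun h2 i) j
  have h2 : Matrix.kronecker (qMatrix (U β)) (qMatrix (U γ)) =
      ∑ r, D.W r * qMatrix (U (D.cls r)) * (D.W r)ᴴ := by
    refine (CFC.mul_self_eq_mul_self_iff _ _ ((hpos β).kronecker (hpos γ)).nonneg
      (hsum (fun α => qMatrix (U α)) hpos)).1 ?_
    rw [D.conj_mul_conj, ← h1]
    exact (Matrix.mul_kronecker_mul _ _ _ _).symm
  refine (CFC.mul_self_eq_mul_self_iff _ _ ((qSqrt_posSemidef _).kronecker
    (qSqrt_posSemidef _)).nonneg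
    (hsum (fun α => qSqrt (U α)) fun α => qSqrt_posSemidef _)).1 ?_
  rw [D.conj_mul_conj]
  simp only [hQ]
  rw [← h2, ← hQ β, ← hQ γ]
  exact (Matrix.mul_kronecker_mul _ _ _ _).symm

theorem kronecker_qMatrix {β γ : Irr A} (D : Decomp U (tensorRep (U β).toUnitaryRep
    (U γ).toUnitaryRep)) : Matrix.kronecker (qMatrix (U β)) (qMatrix (U γ)) =
      ∑ r, D.W r * qMatrix (U (D.cls r)) * (D.W r)ᴴ := by
  have hQ : ∀ α, qSqrt (U α) * qSqrt (U α) = qMatrix (U α) := fun α =>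
    (isQMatrix_qMatrix hU (U α)).qSqrt_mul_self
  rw [← hQ β, ← hQ γ]
  refine (Matrix.mul_kronecker_mul _ _ _ _).trans ?_
  rw [show Matrix.kroneckerMap (fun x1 x2 => x1 * x2) (qSqrt (U β)) (qSqrt (U γ)) =
    Matrix.kronecker (qSqrt (U β)) (qSqrt (U γ)) from rfl, kronecker_qSqrt hU D, D.conj_mul_conj]
  simp only [hQ]

/-- The quantum dimension is multiplicative. -/
theorem qDim_mul_qDim {β γ : Irr A} (D : Decomp U (tensorRep (U β).toUnitaryRep
    (U γ).toUnitaryRep)) : qDim (U β) * qDim (U γ) = ∑ r, qDim (U (D.cls r)) := by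
  have hQ : ∀ α, (qDim (U α) : ℂ) = (qMatrix (U α)).trace := fun α =>
    (isQMatrix_qMatrix hU (U α)).qDim_coe
  have h1 := congrArg Matrix.trace (kronecker_qMatrix hU D)
  rw [Matrix.trace_sum] at h1
  have h2 : (Matrix.kronecker (qMatrix (U β)) (qMatrix (U γ))).trace =
    (qMatrix (U β)).trace * (qMatrix (U γ)).trace := Matrix.trace_kronecker _ _
  rw [h2, ← hQ, ← hQ] at h1
  have h3 : ∀ r, (D.W r * qMatrix (U (D.cls r)) * (D.W r)ᴴ).trace = (qDim (U (D.cls r)) : ℂ) := by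
    intro r
    rw [Matrix.trace_mul_comm, ← Matrix.mul_assoc, D.isometry, Matrix.one_mul, hQ]
  simp only [h3] at h1
  exact_mod_cast h1

/-- The square roots of the matrices `Q` are intertwined by the inclusions of the summands of a
tensor product. -/
theorem kronecker_qSqrt_mul {β γ : Irr A} (D : Decomp U (tensorRep (U β).toUnitaryRep
    (U γ).toUnitaryRep)) (r : D.R) :
    Matrix.kronecker (qSqrt (U β)) (qSqrt (U γ)) * D.W r = D.W r * qSqrt (U (D.cls r)) := by
  rw [kronecker_qSqrt hU D, Matrix.sum_mul, Finset.sum_eq_single r]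
  · rw [Matrix.mul_assoc, D.isometry, Matrix.mul_one]
  · intro s _ hs
    rw [Matrix.mul_assoc, D.orthogonal _ _ hs, Matrix.mul_zero]
  · simp

end Multiplicativity

/-! ### The Fourier transform of a product -/

theorem trace_mul_scal {A : Type*} [Ring A] [Algebra ℂ A] {ι κ : Type*} [Fintype ι] [Fintype κ]
    (u : Matrix ι κ A) (T : Matrix κ ι ℂ) : (u * scal A T).trace = (scal A T * u).trace := by
  simp only [Matrix.trace, Matrix.diag, mul_scal_apply, scal_mul_apply]
  exact Finset.sum_comm

theorem kronecker_apply' {ι κ μ ν : Type*} {R : Type*} [Mul R] (X : Matrix ι κ R)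
    (Y : Matrix μ ν R) (s : ι × μ) (t : κ × ν) :
    Matrix.kronecker X Y s t = X s.1 t.1 * Y s.2 t.2 := rfl

section Blocks

variable {A : Type*} [Ring A] [StarRing A] [HopfAlgebra ℂ A]

/-- The inverse Fourier transform of a family `M` which is supported in a single class `α`. -/
noncomputable def block (U : Irr A → IrrRep A) (α : Irr A) :
    Matrix (Fin (U α).n) (Fin (U α).n) ℂ →ₗ[ℂ] A where
  toFun M := (qDim (U α) : ℂ) • (scal A (M * qMatrix (U α)) * (U α).u).trace
  map_add' M N := by
    rw [Matrix.add_mul, scal_add, Matrix.add_mul, Matrix.trace_add, smul_add]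
  map_smul' c M := by
    rw [Matrix.smul_mul, scal_smul, Matrix.smul_mul, Matrix.trace_smul, smul_comm]; rfl

theorem block_apply (U : Irr A → IrrRep A) (α : Irr A)
    (M : Matrix (Fin (U α).n) (Fin (U α).n) ℂ) :
    block U α M = (qDim (U α) : ℂ) • (scal A (M * qMatrix (U α)) * (U α).u).trace := rfl

theorem block_eq_sum (U : Irr A → IrrRep A) (α : Irr A)
    (M : Matrix (Fin (U α).n) (Fin (U α).n) ℂ) :
    block U α M = ∑ i, ∑ j,
      ((qDim (U α) : ℂ) * (M * qMatrix (U α)) j i) • (U α).u i j := by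
  simp only [block_apply, Matrix.trace, Matrix.diag, scal_mul_apply, Finset.smul_sum, smul_smul]
  exact Finset.sum_comm

/-- The Fourier transform as a linear map. -/
noncomputable def fourierLin (U : Irr A → IrrRep A) : A →ₗ[ℂ] MatFam U where
  toFun := fourier U
  map_add' x y := by ext α i j; simp [fourier, mul_add]
  map_smul' c x := by ext α i j; simp [fourier]

theorem fourierLin_apply (U : Irr A → IrrRep A) (x : A) : fourierLin U x = fourier U x := rfl

variable [StarModule ℂ A] [IsPol A]
variable {U : Irr A → IrrRep A} (hU : ∀ α, (Quotient.mk _ (U α) : Irr A) = α)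

theorem kronecker_qMatrix_mul (hU : ∀ α, (Quotient.mk _ (U α) : Irr A) = α) {β γ : Irr A}
    (D : Decomp U (tensorRep (U β).toUnitaryRep (U γ).toUnitaryRep)) (r : D.R) :
    Matrix.kronecker (qMatrix (U β)) (qMatrix (U γ)) * D.W r = D.W r * qMatrix (U (D.cls r)) := by
  rw [kronecker_qMatrix hU D, Matrix.sum_mul, Finset.sum_eq_single r]
  · rw [Matrix.mul_assoc, D.isometry, Matrix.mul_one]
  · intro s _ hs
    rw [Matrix.mul_assoc, D.orthogonal _ _ hs, Matrix.mul_zero]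
  · simp

/-- The product of two elements with Fourier transforms supported in a single class. -/
theorem block_mul_block (hU : ∀ α, (Quotient.mk _ (U α) : Irr A) = α) {β γ : Irr A}
    (D : Decomp U (tensorRep (U β).toUnitaryRep (U γ).toUnitaryRep))
    (X : Matrix (Fin (U β).n) (Fin (U β).n) ℂ) (Y : Matrix (Fin (U γ).n) (Fin (U γ).n) ℂ) :
    block U β X * block U γ Y = ∑ r, block U (D.cls r)
      (((qDim (U β) * qDim (U γ) / qDim (U (D.cls r)) : ℝ) : ℂ) •
        ((D.W r)ᴴ * Matrix.kronecker X Y * D.W r)) := by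
  have h1 : (scal A (X * qMatrix (U β)) * (U β).u).trace *
      (scal A (Y * qMatrix (U γ)) * (U γ).u).trace =
      (scal A (Matrix.kronecker (X * qMatrix (U β)) (Y * qMatrix (U γ))) *
        tensorRep (U β).toUnitaryRep (U γ).toUnitaryRep).trace := by
    simp only [Matrix.trace, Matrix.diag, scal_mul_apply, Fintype.sum_prod_type,
      Finset.sum_mul_sum, kronecker_apply', tensorRep_apply, smul_mul_smul_comm]
  have h2 : Matrix.kronecker (X * qMatrix (U β)) (Y * qMatrix (U γ)) =
      Matrix.kronecker X Y * Matrix.kronecker (qMatrix (U β)) (qMatrix (U γ)) :=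
    Matrix.mul_kronecker_mul _ _ _ _
  have h0 : ∀ K : Matrix _ _ A, (K * tensorRep (U β).toUnitaryRep (U γ).toUnitaryRep).trace =
      ∑ r, (K * (scal A (D.W r) * (U (D.cls r)).u * scal A (D.W r)ᴴ)).trace := fun K => by
    conv_lhs => rw [D.eq_sum]
    rw [Matrix.mul_sum, Matrix.trace_sum]
  rw [block_apply, block_apply, smul_mul_smul_comm, h1, h0, Finset.smul_sum]
  refine Finset.sum_congr rfl fun r _ => ?_
  have hd := (isQMatrix_qMatrix hU (U (D.cls r))).qDim_ne_zero
  have h3 : (scal A (Matrix.kronecker (X * qMatrix (U β)) (Y * qMatrix (U γ))) *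
      (scal A (D.W r) * (U (D.cls r)).u * scal A (D.W r)ᴴ)).trace =
      (scal A ((D.W r)ᴴ * Matrix.kronecker X Y * D.W r * qMatrix (U (D.cls r))) *
        (U (D.cls r)).u).trace := by
    rw [← Matrix.mul_assoc, trace_mul_scal, ← Matrix.mul_assoc, ← Matrix.mul_assoc, ← scal_mul,
      ← scal_mul, h2]
    congr 3
    simp only [Matrix.mul_assoc]
    rw [kronecker_qMatrix_mul hU D]
  rw [h3, map_smul, block_apply, smul_smul]
  congr 1
  push_cast
  field_simp

theorem repr_block (α : Irr A) (M : Matrix (Fin (U α).n) (Fin (U α).n) ℂ) (i j : Fin (U α).n) :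
    (peterWeyl hU).repr (block U α M) ⟨α, i, j⟩ =
      (qDim (U α) : ℂ) * (M * qMatrix (U α)) j i := by
  classical
  rw [block_eq_sum]
  simp only [map_sum, map_smul, ← peterWeyl_apply hU, Module.Basis.repr_self, Finsupp.coe_finsetSum,
    Finset.sum_apply, Finsupp.smul_apply, Finsupp.single_apply, smul_eq_mul, mul_ite, mul_one,
    mul_zero, Sigma.mk.injEq, heq_eq_eq, Prod.mk.injEq, true_and, ite_and]
  simp

theorem repr_block_of_ne {α β : Irr A} (h : β ≠ α) (M : Matrix (Fin (U α).n) (Fin (U α).n) ℂ)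
    (i j : Fin (U β).n) : (peterWeyl hU).repr (block U α M) ⟨β, i, j⟩ = 0 := by
  rw [block_eq_sum]
  simp only [map_sum, map_smul, ← peterWeyl_apply hU, Module.Basis.repr_self, Finsupp.coe_finsetSum,
    Finset.sum_apply, Finsupp.smul_apply]
  refine Finset.sum_eq_zero fun k _ => Finset.sum_eq_zero fun l _ => ?_
  rw [Finsupp.single_eq_of_ne fun hh => h (congrArg Sigma.fst hh), smul_zero]

include hU

theorem eq_of_mul_qMatrix_eq {α : Irr A} {M N : Matrix (Fin (U α).n) (Fin (U α).n) ℂ}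
    (h : ∀ i j, (qDim (U α) : ℂ) * (M * qMatrix (U α)) j i =
      (qDim (U α) : ℂ) * (N * qMatrix (U α)) j i) : M = N := by
  have hQ := isQMatrix_qMatrix hU (U α)
  have h1 : M * qMatrix (U α) = N * qMatrix (U α) := by
    ext j i
    exact mul_left_cancel₀ hQ.qDim_ne_zero (h i j)
  calc M = M * qMatrix (U α) * (qMatrix (U α))⁻¹ := by
        rw [Matrix.mul_assoc, Matrix.mul_nonsing_inv _ hQ.isUnit_det, Matrix.mul_one]
    _ = N := by
        rw [h1, Matrix.mul_assoc, Matrix.mul_nonsing_inv _ hQ.isUnit_det, Matrix.mul_one]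

open Classical in
theorem fourier_block (α : Irr A) (M : Matrix (Fin (U α).n) (Fin (U α).n) ℂ) :
    fourier U (block U α M) = Pi.single α M := by
  ext1 β
  by_cases h : β = α
  · subst h
    rw [Pi.single_eq_same]
    refine eq_of_mul_qMatrix_eq hU fun i j => ?_
    rw [← repr_eq_fourier hU, repr_block]
  · rw [Pi.single_eq_of_ne h]
    refine eq_of_mul_qMatrix_eq hU fun i j => ?_
    rw [← repr_eq_fourier hU, repr_block_of_ne hU h]
    simp

theorem fourier_injective : Function.Injective (fourierLin U) := by
  intro x y hxy
  apply (peterWeyl hU).repr.injective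
  ext ⟨α, i, j⟩
  rw [repr_eq_fourier, repr_eq_fourier, ← fourierLin_apply, hxy, fourierLin_apply]

theorem finite_support_fourier (x : A) : {α | fourier U x α ≠ 0}.Finite := by
  obtain ⟨F, hF⟩ := exists_finset_coord hU x
  refine F.finite_toSet.subset fun α hα => ?_
  by_contra hαF
  refine hα (eq_of_mul_qMatrix_eq hU fun i j => ?_)
  rw [← repr_eq_fourier hU, hF α hαF]
  simp

/-- Finitely supported families are Fourier transforms. -/
theorem fourier_sum_block {X : MatFam U} {F : Finset (Irr A)} (hX : ∀ α ∉ F, X α = 0) :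
    fourier U (∑ α ∈ F, block U α (X α)) = X := by
  classical
  rw [← fourierLin_apply, map_sum]
  ext1 β
  rw [Finset.sum_apply]
  simp only [fourierLin_apply, fourier_block hU]
  by_cases hβ : β ∈ F
  · rw [Finset.sum_eq_single β]
    · rw [Pi.single_eq_same]
    · intro α _ hα
      rw [Pi.single_eq_of_ne hα.symm]
    · exact fun h => (h hβ).elim
  · rw [hX β hβ]
    refine Finset.sum_eq_zero fun α hα => ?_
    rw [Pi.single_eq_of_ne fun h : β = α => hβ (h.symm ▸ hα)]

/-- The pairing of `Pol(𝔾)` with a family of matrices `a`. -/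
noncomputable def pairing (a : MatFam U) :
    A →ₗ[ℂ] ℂ :=
  (peterWeyl hU).constr ℂ fun s => a s.1 s.2.1 s.2.2

theorem funct_fourier (a : MatFam U) (x : A) : funct U (fourier U x) a = pairing hU a x := by
  obtain ⟨F, hF⟩ := exists_finset_coord hU x
  rw [funct, dualHaar, finsum_eq_sum_of_support_subset (s := F)]
  · conv_rhs => rw [eq_sum_coord hU x hF]
    rw [map_sum]
    refine Finset.sum_congr rfl fun α _ => ?_
    simp only [map_sum, map_smul, smul_eq_mul]
    rw [Matrix.trace_mul_comm, Matrix.mul_assoc, Matrix.trace, Finset.mul_sum]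
    refine Finset.sum_congr rfl fun i _ => ?_
    rw [Matrix.diag, Matrix.mul_apply, Finset.mul_sum]
    refine Finset.sum_congr rfl fun j _ => ?_
    rw [repr_eq_fourier, ← peterWeyl_apply hU, pairing, Module.Basis.constr_basis]
    ring
  · intro α hα
    by_contra hαF
    refine hα ?_
    have : fourier U x α = 0 := by
      refine eq_of_mul_qMatrix_eq hU fun i j => ?_
      rw [← repr_eq_fourier hU, hF α hαF]
      simp
    simp [this]

/-- For finitely supported families, `Δ̂_*` is the product of `Pol(𝔾)`, transported by the Fourier
transform. -/
theorem dualConv_eq {X Y : MatFam U} {F G : Finset (Irr A)} (hX : ∀ α ∉ F, X α = 0)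
    (hY : ∀ α ∉ G, Y α = 0) (a : MatFam U) :
    dualConv U X Y a = funct U
      (fourier U ((∑ α ∈ F, block U α (X α)) * ∑ α ∈ G, block U α (Y α))) a := by
  rw [funct_fourier hU, Finset.sum_mul_sum, map_sum, dualConv,
    finsum_eq_sum_of_support_subset (s := F ×ˢ G), Finset.sum_product]
  · refine Finset.sum_congr rfl fun β _ => ?_
    rw [map_sum]
    refine Finset.sum_congr rfl fun γ _ => ?_
    have h1 : Matrix.kronecker (X β) (Y γ) *
        Matrix.kronecker (qMatrix (U β)) (qMatrix (U γ)) =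
        Matrix.kronecker (X β * qMatrix (U β)) (Y γ * qMatrix (U γ)) :=
      (Matrix.mul_kronecker_mul _ _ _ _).symm
    rw [Matrix.trace_mul_comm, Matrix.mul_assoc, h1, block_eq_sum, block_eq_sum]
    have h2 : ∀ M : Matrix (Fin (U β).n × Fin (U γ).n) (Fin (U β).n × Fin (U γ).n) ℂ,
        (dualComul U a β γ * M).trace = ∑ i, ∑ j, ∑ k, ∑ l,
          pairing hU a ((U β).u i k * (U γ).u j l) * M (k, l) (i, j) := by
      intro M
      simp only [Matrix.trace, Matrix.diag, Matrix.mul_apply, Fintype.sum_prod_type, dualComul,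
        Matrix.of_apply, funct_fourier hU]
    rw [h2]
    simp only [Finset.mul_sum, Finset.sum_mul, map_sum, smul_mul_smul_comm, map_smul,
      kronecker_apply', smul_eq_mul]
    refine Eq.trans ?_ (Finset.sum_congr rfl fun j _ => Finset.sum_comm)
    refine Eq.trans ?_ Finset.sum_comm
    refine Finset.sum_congr rfl fun i _ => Finset.sum_congr rfl fun j _ => ?_
    rw [Finset.sum_comm]
    refine Finset.sum_congr rfl fun l _ => Finset.sum_congr rfl fun k _ => ?_
    ring
  · rintro ⟨β, γ⟩ hp
    rw [Finset.mem_coe, Finset.mem_product]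
    by_contra hn
    refine hp ?_
    rw [not_and_or] at hn
    rcases hn with hn | hn
    · simp [hX β hn]
    · simp [hY γ hn]

/-- The Fourier transform as a map into `A_Δ(𝔾)`. -/
noncomputable def toADelta : A →ₗ[ℂ] ADelta U :=
  (fourierLin U).codRestrict (ADelta U) fun x => by
    refine summable_of_hasFiniteSupport ((finite_support_fourier hU x).subset fun α hα h => hα ?_)
    rw [aTerm, fourierLin_apply, h, Matrix.zero_mul]
    simp [OpSpace.hsNorm]

theorem coe_toADelta (x : A) : (toADelta hU x : MatFam U) = fourier U x := rfl

end Blocks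

end CQG

namespace OpSpace

/-! ### The operator norm of matrices -/

section OpNorm

variable {ι κ μ ν : Type*} [Fintype ι] [Fintype κ] [Fintype μ] [Fintype ν]

open scoped Matrix.Norms.L2Operator in
theorem opNorm_nonneg [DecidableEq κ] (M : Matrix ι κ ℂ) : 0 ≤ opNorm M := norm_nonneg M

open scoped Matrix.Norms.L2Operator in
theorem opNorm_add_le [DecidableEq κ] (M N : Matrix ι κ ℂ) :
    opNorm (M + N) ≤ opNorm M + opNorm N := norm_add_le M N

open scoped Matrix.Norms.L2Operator in
theorem opNorm_smul [DecidableEq κ] (c : ℂ) (M : Matrix ι κ ℂ) :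
    opNorm (c • M) = ‖c‖ * opNorm M := norm_smul c M

open scoped Matrix.Norms.L2Operator in
theorem opNorm_mul_le [DecidableEq κ] [DecidableEq μ] (M : Matrix ι κ ℂ) (N : Matrix κ μ ℂ) :
    opNorm (M * N) ≤ opNorm M * opNorm N := Matrix.l2_opNorm_mul M N

open scoped Matrix.Norms.L2Operator in
theorem sum_sq_mulVec_le [DecidableEq κ] (M : Matrix ι κ ℂ) (v : κ → ℂ) :
    ∑ i, ‖M.mulVec v i‖ ^ 2 ≤ opNorm M ^ 2 * ∑ j, ‖v j‖ ^ 2 := by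
  have h := Matrix.l2_opNorm_mulVec M (WithLp.toLp 2 v)
  have h2 := pow_le_pow_left₀ (norm_nonneg _) h 2
  rw [mul_pow, EuclideanSpace.norm_sq_eq, EuclideanSpace.norm_sq_eq] at h2
  exact h2

open scoped Matrix.Norms.L2Operator in
theorem opNorm_le_of_sum_sq [DecidableEq κ] {M : Matrix ι κ ℂ} {c : ℝ} (hc : 0 ≤ c)
    (h : ∀ v : κ → ℂ, ∑ i, ‖M.mulVec v i‖ ^ 2 ≤ c ^ 2 * ∑ j, ‖v j‖ ^ 2) : opNorm M ≤ c := by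
  rw [opNorm, Matrix.l2_opNorm_def]
  refine ContinuousLinearMap.opNorm_le_bound _ hc fun v => ?_
  refine (sq_le_sq₀ (norm_nonneg _) (by positivity)).1 ?_
  rw [mul_pow, EuclideanSpace.norm_sq_eq, EuclideanSpace.norm_sq_eq]
  exact h v

theorem opNorm_submatrix_le [DecidableEq κ] [DecidableEq ν] (M : Matrix ι κ ℂ) {e : μ → ι}
    {f : ν → κ} (he : Function.Injective e) (hf : Function.Injective f) :
    opNorm (M.submatrix e f) ≤ opNorm M := by
  classical
  refine opNorm_le_of_sum_sq (opNorm_nonneg _) fun v => ?_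
  let w : κ → ℂ := Function.extend f v 0
  have hw : ∀ j, w (f j) = v j := fun j => hf.extend_apply v 0 j
  have hw0 : ∀ k, k ∉ Set.range f → w k = 0 := fun k hk => by
    rw [show w k = Function.extend f v 0 k from rfl, Function.extend_apply' _ _ _ hk]; rfl
  have h1 : ∀ i, (M.submatrix e f).mulVec v i = M.mulVec w (e i) := by
    intro i
    simp only [Matrix.mulVec, dotProduct, Matrix.submatrix_apply]
    rw [← Finset.sum_subset (Finset.subset_univ (Finset.univ.image f)),
      Finset.sum_image fun x _ y _ h => hf h]
    · simp only [hw]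
    · intro k _ hk
      rw [hw0 k (by simpa using hk), mul_zero]
  have h2 : ∑ k, ‖w k‖ ^ 2 = ∑ j, ‖v j‖ ^ 2 := by
    rw [← Finset.sum_subset (Finset.subset_univ (Finset.univ.image f)),
      Finset.sum_image fun x _ y _ h => hf h]
    · simp only [hw]
    · intro k _ hk
      rw [hw0 k (by simpa using hk)]
      simp
  calc ∑ i, ‖(M.submatrix e f).mulVec v i‖ ^ 2 = ∑ i ∈ Finset.univ.image e, ‖M.mulVec w i‖ ^ 2 := by
        rw [Finset.sum_image fun x _ y _ h => he h]
        simp only [h1]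
    _ ≤ ∑ i, ‖M.mulVec w i‖ ^ 2 :=
        Finset.sum_le_sum_of_subset_of_nonneg (Finset.subset_univ _) fun _ _ _ => by positivity
    _ ≤ _ := h2 ▸ sum_sq_mulVec_le M w

theorem opNorm_submatrix_equiv [DecidableEq κ] [DecidableEq ν] (M : Matrix ι κ ℂ) (e : μ ≃ ι)
    (f : ν ≃ κ) : opNorm (M.submatrix e f) = opNorm M := by
  refine le_antisymm (opNorm_submatrix_le M e.injective f.injective) ?_
  have := opNorm_submatrix_le (M.submatrix e f) e.symm.injective f.symm.injective
  simpa using this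

theorem norm_apply_le_opNorm [DecidableEq κ] (M : Matrix ι κ ℂ) (i : ι) (j : κ) :
    ‖M i j‖ ≤ opNorm M := by
  have h := sum_sq_mulVec_le M (Pi.single j 1)
  have h1 : ∑ k, ‖(Pi.single j 1 : κ → ℂ) k‖ ^ 2 = 1 := by
    rw [Finset.sum_eq_single j] <;> simp +contextual
  rw [h1, mul_one] at h
  refine (sq_le_sq₀ (norm_nonneg _) (opNorm_nonneg _)).1 (le_trans ?_ h)
  refine le_trans ?_ (Finset.single_le_sum (f := fun i => ‖M.mulVec (Pi.single j 1) i‖ ^ 2)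
    (fun _ _ => by positivity) (Finset.mem_univ i))
  simp

theorem opNorm_le_hsNorm [DecidableEq κ] (M : Matrix ι κ ℂ) : opNorm M ≤ hsNorm M := by
  refine opNorm_le_of_sum_sq (Real.sqrt_nonneg _) fun v => ?_
  rw [hsNorm, Real.sq_sqrt (by positivity), Finset.sum_mul]
  refine Finset.sum_le_sum fun i _ => ?_
  have h1 : ‖M.mulVec v i‖ ≤ ∑ j, ‖M i j‖ * ‖v j‖ := by
    refine (norm_sum_le _ _).trans (le_of_eq ?_)
    simp only [norm_mul]
  exact (pow_le_pow_left₀ (norm_nonneg _) h1 2).trans (Finset.sum_mul_sq_le_sq_mul_sq _ _ _)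

theorem opNorm_eq_zero [DecidableEq κ] {M : Matrix ι κ ℂ} (h : opNorm M = 0) : M = 0 := by
  ext i j
  have := norm_apply_le_opNorm M i j
  rw [h] at this
  simpa using this

/-- The operator norm of a row is its Hilbert-Schmidt norm. -/
theorem opNorm_row [Unique ι] [DecidableEq κ] (M : Matrix ι κ ℂ) : opNorm M = hsNorm M := by
  refine le_antisymm (opNorm_le_hsNorm M) ?_
  have h := sum_sq_mulVec_le M fun j => star (M default j)
  have h1 : M.mulVec (fun j => star (M default j)) default =
      ((∑ j, ‖M default j‖ ^ 2 : ℝ) : ℂ) := by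
    simp only [Matrix.mulVec, dotProduct]
    push_cast
    refine Finset.sum_congr rfl fun j _ => ?_
    rw [← starRingEnd_apply, Complex.mul_conj']
  rw [Fintype.sum_unique, h1, Complex.norm_real, Real.norm_eq_abs, sq_abs] at h
  simp only [norm_star] at h
  rw [hsNorm, Fintype.sum_unique]
  set s := ∑ j, ‖M default j‖ ^ 2
  have hs : 0 ≤ s := Finset.sum_nonneg fun _ _ => by positivity
  rcases hs.eq_or_lt with h0 | h0
  · rw [← h0, Real.sqrt_zero]; exact opNorm_nonneg _
  · refine Real.sqrt_le_iff.2 ⟨opNorm_nonneg _, ?_⟩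
    rw [sq] at h
    exact le_of_mul_le_mul_right h h0

theorem ofReal_sum_norm_sq (w : ι → ℂ) : ((∑ i, ‖w i‖ ^ 2 : ℝ) : ℂ) = star w ⬝ᵥ w := by
  simp only [dotProduct]
  push_cast
  refine Finset.sum_congr rfl fun j _ => ?_
  rw [Pi.star_apply, ← starRingEnd_apply, Complex.conj_mul']

theorem sum_sq_mulVec_of_isometry [DecidableEq κ] {M : Matrix ι κ ℂ} (h : Mᴴ * M = 1)
    (v : κ → ℂ) : ∑ i, ‖M.mulVec v i‖ ^ 2 = ∑ i, ‖v i‖ ^ 2 := by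
  have h1 : ((∑ i, ‖M.mulVec v i‖ ^ 2 : ℝ) : ℂ) = ((∑ i, ‖v i‖ ^ 2 : ℝ) : ℂ) := by
    rw [ofReal_sum_norm_sq, ofReal_sum_norm_sq, Matrix.star_mulVec, Matrix.dotProduct_mulVec,
      Matrix.vecMul_vecMul, h, Matrix.vecMul_one]
  exact_mod_cast h1

theorem opNorm_le_one_of_isometry [DecidableEq κ] {M : Matrix ι κ ℂ} (h : Mᴴ * M = 1) :
    opNorm M ≤ 1 := by
  refine opNorm_le_of_sum_sq zero_le_one fun v => le_of_eq ?_
  rw [one_pow, one_mul, sum_sq_mulVec_of_isometry h]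

/-- A column of matrices. -/
theorem opNorm_sq_le_sum {R : Type*} [Fintype R] {m : R → Type*} [∀ r, Fintype (m r)]
    [DecidableEq κ] (M : Matrix (Σ r, m r) κ ℂ) :
    opNorm M ^ 2 ≤ ∑ r, opNorm (M.submatrix (Sigma.mk r) id) ^ 2 := by
  have h0 : 0 ≤ ∑ r, opNorm (M.submatrix (Sigma.mk r) id) ^ 2 :=
    Finset.sum_nonneg fun _ _ => by positivity
  have h : opNorm M ≤ Real.sqrt (∑ r, opNorm (M.submatrix (Sigma.mk r) id) ^ 2) := by
    refine opNorm_le_of_sum_sq (Real.sqrt_nonneg _) fun v => ?_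
    rw [Real.sq_sqrt h0, Fintype.sum_sigma, Finset.sum_mul]
    refine Finset.sum_le_sum fun r _ => ?_
    exact sum_sq_mulVec_le (M.submatrix (Sigma.mk r) id) v
  calc opNorm M ^ 2 ≤ Real.sqrt (∑ r, opNorm (M.submatrix (Sigma.mk r) id) ^ 2) ^ 2 :=
        pow_le_pow_left₀ (opNorm_nonneg _) h 2
    _ = _ := Real.sq_sqrt h0

theorem opNorm_one_kronecker_le [DecidableEq μ] [DecidableEq κ] (M : Matrix ι κ ℂ) :
    opNorm (Matrix.kronecker (1 : Matrix μ μ ℂ) M) ≤ opNorm M := by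
  refine opNorm_le_of_sum_sq (opNorm_nonneg _) fun v => ?_
  rw [Fintype.sum_prod_type, Fintype.sum_prod_type, Finset.mul_sum]
  refine Finset.sum_le_sum fun x _ => ?_
  have h1 : ∀ i, (Matrix.kronecker (1 : Matrix μ μ ℂ) M).mulVec v (x, i) =
      M.mulVec (fun j => v (x, j)) i := by
    intro i
    simp only [Matrix.mulVec, dotProduct, Fintype.sum_prod_type]
    rw [Finset.sum_eq_single x]
    · simp
    · intro y _ hy
      simp [Matrix.one_apply_ne hy.symm]
    · simp
  simp only [h1]
  exact sum_sq_mulVec_le M _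

theorem opNorm_kronecker_one_le [DecidableEq μ] [DecidableEq κ] (M : Matrix ι κ ℂ) :
    opNorm (Matrix.kronecker M (1 : Matrix μ μ ℂ)) ≤ opNorm M := by
  have h : Matrix.kronecker M (1 : Matrix μ μ ℂ) =
      (Matrix.kronecker (1 : Matrix μ μ ℂ) M).submatrix (Equiv.prodComm ι μ)
        (Equiv.prodComm κ μ) := by
    ext ⟨a, b⟩ ⟨c, d⟩
    simp [mul_comm]
  rw [h, opNorm_submatrix_equiv]
  exact opNorm_one_kronecker_le M

theorem opNorm_kronecker_le [DecidableEq κ] [DecidableEq ν] (M : Matrix ι κ ℂ)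
    (N : Matrix μ ν ℂ) : opNorm (Matrix.kronecker M N) ≤ opNorm M * opNorm N := by
  classical
  have h : Matrix.kronecker M N =
      Matrix.kronecker M (1 : Matrix μ μ ℂ) * Matrix.kronecker (1 : Matrix κ κ ℂ) N := by
    refine Eq.trans ?_ (Matrix.mul_kronecker_mul _ _ _ _)
    rw [Matrix.mul_one, Matrix.one_mul]; rfl
  rw [h]
  exact (opNorm_mul_le _ _).trans (mul_le_mul (opNorm_kronecker_one_le _)
    (opNorm_one_kronecker_le _) (opNorm_nonneg _) (opNorm_nonneg _))

theorem opNorm_fromBlocks_diag [DecidableEq κ] [DecidableEq ν] (M : Matrix ι κ ℂ)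
    (N : Matrix μ ν ℂ) : opNorm (Matrix.fromBlocks M 0 0 N) = max (opNorm M) (opNorm N) := by
  refine le_antisymm (opNorm_le_of_sum_sq (le_max_of_le_left (opNorm_nonneg _)) fun v => ?_)
    (max_le ?_ ?_)
  · rw [Fintype.sum_sum_type, Fintype.sum_sum_type, mul_add]
    have h1 : ∀ i, (Matrix.fromBlocks M 0 0 N).mulVec v (Sum.inl i) =
        M.mulVec (fun j => v (Sum.inl j)) i := fun i => by
      simp [Matrix.mulVec, dotProduct, Fintype.sum_sum_type]
    have h2 : ∀ i, (Matrix.fromBlocks M 0 0 N).mulVec v (Sum.inr i) =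
        N.mulVec (fun j => v (Sum.inr j)) i := fun i => by
      simp [Matrix.mulVec, dotProduct, Fintype.sum_sum_type]
    simp only [h1, h2]
    refine add_le_add ((sum_sq_mulVec_le M _).trans ?_) ((sum_sq_mulVec_le N _).trans ?_)
    · refine mul_le_mul_of_nonneg_right ?_ (by positivity)
      exact pow_le_pow_left₀ (opNorm_nonneg _) (le_max_left _ _) 2
    · refine mul_le_mul_of_nonneg_right ?_ (by positivity)
      exact pow_le_pow_left₀ (opNorm_nonneg _) (le_max_right _ _) 2
  · have := opNorm_submatrix_le (Matrix.fromBlocks M 0 0 N) (e := Sum.inl) (f := Sum.inl)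
      Sum.inl_injective Sum.inl_injective
    exact this
  · have := opNorm_submatrix_le (Matrix.fromBlocks M 0 0 N) (e := Sum.inr) (f := Sum.inr)
      Sum.inr_injective Sum.inr_injective
    exact this

open scoped Matrix.Norms.L2Operator in
theorem opNorm_tsum_le [DecidableEq κ] {I : Type*} {M : I → Matrix ι κ ℂ} {b : I → ℝ}
    (hb : Summable b) (h : ∀ i, opNorm (M i) ≤ b i) :
    opNorm (Matrix.of fun x y => ∑' i, M i x y) ≤ ∑' i, b i := by
  have hs : Summable M := Summable.of_norm_bounded hb h
  have h1 : (Matrix.of fun x y => ∑' i, M i x y) = ∑' i, M i := by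
    ext x y
    have h2 : (∑' i, M i) x = ∑' i, M i x := tsum_apply hs
    rw [h2]
    exact (tsum_apply (Pi.summable.1 hs x)).symm
  rw [h1]
  exact tsum_of_norm_bounded hb.hasSum h

theorem hsNorm_nonneg (M : Matrix ι κ ℂ) : 0 ≤ hsNorm M := Real.sqrt_nonneg _

theorem hsNorm_eq_zero {M : Matrix ι κ ℂ} (h : hsNorm M = 0) : M = 0 := by
  classical
  exact opNorm_eq_zero (le_antisymm ((opNorm_le_hsNorm M).trans h.le) (opNorm_nonneg M))

end OpNorm

/-! ### Direct sums of `ℓ¹` type and projective tensor products of operator spaces -/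

section L1Sum

variable {I : Type*} {E : I → Type*} [∀ i, AddCommGroup (E i)] [∀ i, Module ℂ (E i)]
  {N : ∀ i, MatNorm (E i)}

/-- The matrix in `M_n(E_i)` of the `i`-th components of a matrix of families. -/
def component {n : ℕ} (x : Matrix (Fin n) (Fin n) (∀ i, E i)) (i : I) :
    Matrix (Fin n) (Fin n) (E i) := Matrix.of fun k l => x k l i

/-- The image `∑_i u_i(x_i)` in `M_κ ⊗ M_ι`, as a matrix over the product index set. -/
noncomputable def sumAmp {ι κ : Type*} (u : ∀ i, E i →ₗ[ℂ] Matrix ι ι ℂ)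
    (x : Matrix κ κ (∀ i, E i)) : Matrix (κ × ι) (κ × ι) ℂ :=
  Matrix.of fun p q => ∑' i, u i (x p.1 q.1 i) p.2 q.2

/-- The amplification of `u` to matrices, as a matrix over the product index set. -/
def amp {F : Type*} [AddCommGroup F] [Module ℂ F] {ι : Type*} {n : ℕ}
    (u : F →ₗ[ℂ] Matrix ι ι ℂ) (x : Matrix (Fin n) (Fin n) F) :
    Matrix (Fin n × ι) (Fin n × ι) ℂ :=
  Matrix.of fun p q => u (x p.1 q.1) p.2 q.2

theorem norm_apply_le_amp {F : Type*} [AddCommGroup F] [Module ℂ F] {ι : Type*} [Fintype ι]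
    [DecidableEq ι] {n : ℕ} (u : F →ₗ[ℂ] Matrix ι ι ℂ) (x : Matrix (Fin n) (Fin n) F)
    (k l : Fin n) (a b : ι) : ‖u (x k l) a b‖ ≤ opNorm (amp u x) :=
  norm_apply_le_opNorm (amp u x) (k, a) (l, b)

theorem summable_apply {ι : Type*} [Fintype ι] [DecidableEq ι] {n : ℕ} {K : ℝ}
    {u : ∀ i, E i →ₗ[ℂ] Matrix ι ι ℂ}
    (hu : ∀ i (y : Matrix (Fin n) (Fin n) (E i)), opNorm (amp (u i) y) ≤ K * N i n y)
    {x : Matrix (Fin n) (Fin n) (∀ i, E i)} (hx : Summable fun i => N i n (component x i))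
    (k l : Fin n) (a b : ι) : Summable fun i => u i (x k l i) a b :=
  Summable.of_norm_bounded (hx.mul_left K) fun i =>
    (norm_apply_le_amp (u i) (component x i) k l a b).trans (hu i _)

theorem opNorm_sumAmp_le_tsum {ι : Type*} [Fintype ι] [DecidableEq ι] {n : ℕ} {K : ℝ}
    {u : ∀ i, E i →ₗ[ℂ] Matrix ι ι ℂ}
    (hu : ∀ i (y : Matrix (Fin n) (Fin n) (E i)), opNorm (amp (u i) y) ≤ K * N i n y)
    {x : Matrix (Fin n) (Fin n) (∀ i, E i)} (hx : Summable fun i => N i n (component x i)) :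
    opNorm (sumAmp u x) ≤ K * ∑' i, N i n (component x i) := by
  rw [← tsum_mul_left]
  exact opNorm_tsum_le (hx.mul_left K) fun i => hu i (component x i)

theorem IsCompletelyContractive.opNorm_amp_le {F : Type*} [AddCommGroup F] [Module ℂ F]
    {N : MatNorm F} {m : ℕ} {u : F →ₗ[ℂ] Matrix (Fin m) (Fin m) ℂ}
    (hu : IsCompletelyContractive N (matAlgNorm m) u) {n : ℕ} (x : Matrix (Fin n) (Fin n) F) :
    opNorm (amp u x) ≤ 1 * N n x := by
  rw [one_mul]
  exact hu n x

theorem sumAmp_eq (m n : ℕ) (u : ∀ i, E i →ₗ[ℂ] Matrix (Fin m) (Fin m) ℂ)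
    (x : Matrix (Fin n) (Fin n) (∀ i, E i)) :
    matAlgNorm m n (Matrix.of fun k l => Matrix.of fun a b => ∑' i, u i (x k l i) a b) =
      opNorm (sumAmp u x) := rfl

theorem bddAbove_l1SumNorm {n : ℕ} {x : Matrix (Fin n) (Fin n) (∀ i, E i)}
    (hx : Summable fun i => N i n (component x i)) :
    BddAbove {r : ℝ | ∃ (m : ℕ) (u : ∀ i, E i →ₗ[ℂ] Matrix (Fin m) (Fin m) ℂ),
    (∀ i, IsCompletelyContractive (N i) (matAlgNorm m) (u i)) ∧
    r = matAlgNorm m n (Matrix.of fun k l => Matrix.of fun a b => ∑' i, u i (x k l i) a b)} := by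
  refine ⟨∑' i, N i n (component x i), ?_⟩
  rintro r ⟨m, u, hu, rfl⟩
  rw [sumAmp_eq, ← one_mul (∑' i, N i n (component x i))]
  exact opNorm_sumAmp_le_tsum (fun i y => (hu i).opNorm_amp_le y) hx

theorem opNorm_sumAmp_le {n m : ℕ} {x : Matrix (Fin n) (Fin n) (∀ i, E i)}
    (hx : Summable fun i => N i n (component x i))
    {u : ∀ i, E i →ₗ[ℂ] Matrix (Fin m) (Fin m) ℂ}
    (hu : ∀ i, IsCompletelyContractive (N i) (matAlgNorm m) (u i)) :
    opNorm (sumAmp u x) ≤ l1SumNorm N n x :=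
  le_csSup (bddAbove_l1SumNorm hx) ⟨m, u, hu, rfl⟩

theorem l1SumNorm_nonneg {n : ℕ} (x : Matrix (Fin n) (Fin n) (∀ i, E i)) :
    0 ≤ l1SumNorm N n x := by
  refine Real.sSup_nonneg ?_
  rintro r ⟨m, u, _, rfl⟩
  exact opNorm_nonneg _

theorem l1SumNorm_le {n : ℕ} {x : Matrix (Fin n) (Fin n) (∀ i, E i)} {c : ℝ} (hc : 0 ≤ c)
    (h : ∀ (m : ℕ) (u : ∀ i, E i →ₗ[ℂ] Matrix (Fin m) (Fin m) ℂ),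
      (∀ i, IsCompletelyContractive (N i) (matAlgNorm m) (u i)) → opNorm (sumAmp u x) ≤ c) :
    l1SumNorm N n x ≤ c := by
  refine Real.sSup_le ?_ hc
  rintro r ⟨m, u, hu, rfl⟩
  exact h m u hu

theorem l1SumNorm_le_tsum (hN : ∀ i n x, 0 ≤ N i n x) {n : ℕ}
    {x : Matrix (Fin n) (Fin n) (∀ i, E i)} (hx : Summable fun i => N i n (component x i)) :
    l1SumNorm N n x ≤ ∑' i, N i n (component x i) := by
  refine l1SumNorm_le (tsum_nonneg fun i => hN _ _ _) fun m u hu => ?_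
  rw [← one_mul (∑' i, N i n (component x i))]
  exact opNorm_sumAmp_le_tsum (fun i y => (hu i).opNorm_amp_le y) hx

/-- The universal property of the `ℓ¹`-direct sum, for maps into matrix algebras. -/
theorem opNorm_sumAmp_le_mul {ι : Type*} [Fintype ι] [DecidableEq ι] {K : ℝ} (hK : 0 ≤ K)
    {u : ∀ i, E i →ₗ[ℂ] Matrix ι ι ℂ}
    (hu : ∀ i n (y : Matrix (Fin n) (Fin n) (E i)), opNorm (amp (u i) y) ≤ K * N i n y)
    {n : ℕ} {x : Matrix (Fin n) (Fin n) (∀ i, E i)}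
    (hx : Summable fun i => N i n (component x i)) :
    opNorm (sumAmp u x) ≤ K * l1SumNorm N n x := by
  rcases hK.eq_or_lt with rfl | hK
  · have h := opNorm_sumAmp_le_tsum (fun i y => hu i n y) hx
    rwa [zero_mul] at h ⊢
  let e := Fintype.equivFin ι
  -- the rescaled maps, with values in `M_m` for `m` the cardinality of `ι`
  let v : ∀ i, E i →ₗ[ℂ] Matrix (Fin (Fintype.card ι)) (Fin (Fintype.card ι)) ℂ := fun i =>
    ((K⁻¹ : ℝ) : ℂ) • ((Matrix.reindexLinearEquiv ℂ ℂ e e).toLinearMap ∘ₗ u i)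
  have hv : ∀ i n (y : Matrix (Fin n) (Fin n) (E i)), amp (v i) y =
      (((K⁻¹ : ℝ) : ℂ) • amp (u i) y).submatrix (Equiv.prodCongr (Equiv.refl _) e.symm)
        (Equiv.prodCongr (Equiv.refl _) e.symm) := fun i n y => rfl
  have hvc : ∀ i, IsCompletelyContractive (N i) (matAlgNorm _) (v i) := by
    intro i n y
    change opNorm (amp (v i) y) ≤ _
    rw [hv, opNorm_submatrix_equiv, opNorm_smul, Complex.norm_real, Real.norm_eq_abs,
      abs_of_pos (inv_pos.2 hK), inv_mul_le_iff₀ hK]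
    exact hu i n y
  have h := opNorm_sumAmp_le hx hvc
  have hs : sumAmp v x = (((K⁻¹ : ℝ) : ℂ) • sumAmp u x).submatrix
      (Equiv.prodCongr (Equiv.refl _) e.symm) (Equiv.prodCongr (Equiv.refl _) e.symm) := by
    ext p q
    simp only [Matrix.submatrix_apply, Matrix.smul_apply, sumAmp, Matrix.of_apply]
    rw [smul_eq_mul, ← tsum_mul_left]
    rfl
  rwa [hs, opNorm_submatrix_equiv, opNorm_smul, Complex.norm_real, Real.norm_eq_abs,
      abs_of_pos (inv_pos.2 hK), inv_mul_le_iff₀ hK] at h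

theorem l1SumNorm_add_le {n : ℕ} {x y : Matrix (Fin n) (Fin n) (∀ i, E i)}
    (hx : Summable fun i => N i n (component x i)) (hy : Summable fun i => N i n (component y i)) :
    l1SumNorm N n (x + y) ≤ l1SumNorm N n x + l1SumNorm N n y := by
  refine l1SumNorm_le (add_nonneg (l1SumNorm_nonneg _) (l1SumNorm_nonneg _)) fun m u hu => ?_
  have hs : sumAmp u (x + y) = sumAmp u x + sumAmp u y := by
    ext p q
    simp only [sumAmp, Matrix.of_apply, Matrix.add_apply, Pi.add_apply, map_add]
    exact (summable_apply (fun i y => (hu i).opNorm_amp_le y) hx _ _ _ _).tsum_add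
      (summable_apply (fun i y => (hu i).opNorm_amp_le y) hy _ _ _ _)
  rw [hs]
  exact (opNorm_add_le _ _).trans (add_le_add (opNorm_sumAmp_le hx hu) (opNorm_sumAmp_le hy hu))

theorem sumAmp_scalarMul {ι κ μ : Type*} [Fintype ι] [DecidableEq ι] [Fintype κ]
    (u : ∀ i, E i →ₗ[ℂ] Matrix ι ι ℂ) (a : Matrix μ κ ℂ) {x : Matrix κ κ (∀ i, E i)}
    (b : Matrix κ μ ℂ) (hx : ∀ k l s t, Summable fun i => u i (x k l i) s t) :
    sumAmp u (scalarMul a x b) = Matrix.kronecker a (1 : Matrix ι ι ℂ) * sumAmp u x *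
      Matrix.kronecker b (1 : Matrix ι ι ℂ) := by
  ext ⟨i, s⟩ ⟨j, t⟩
  have h1 : sumAmp u (scalarMul a x b) (i, s) (j, t) =
      ∑ k, ∑ l, (a i k * b l j) * ∑' α, u α (x k l α) s t := by
    simp only [sumAmp, scalarMul, Matrix.of_apply, Finset.sum_apply, Pi.smul_apply, map_sum,
      map_smul, Matrix.sum_apply, Matrix.smul_apply, smul_eq_mul]
    rw [Summable.tsum_finsetSum fun k _ => summable_sum fun l _ => (hx k l s t).mul_left _]
    refine Finset.sum_congr rfl fun k _ => ?_
    rw [Summable.tsum_finsetSum fun l _ => (hx k l s t).mul_left _]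
    exact Finset.sum_congr rfl fun l _ => tsum_mul_left
  rw [h1]
  simp only [Matrix.mul_apply, Fintype.sum_prod_type, CQG.kronecker_apply', Matrix.one_apply,
    sumAmp, Matrix.of_apply, mul_ite, mul_one, mul_zero, ite_mul, zero_mul, Finset.sum_ite_eq,
    Finset.sum_ite_eq', Finset.mem_univ, if_true, Finset.sum_mul]
  rw [Finset.sum_comm]
  refine Finset.sum_congr rfl fun l _ => Finset.sum_congr rfl fun k _ => ?_
  ring

theorem opNorm_sumAmp_scalarMul_le {ι κ μ : Type*} [Fintype ι] [DecidableEq ι] [Fintype κ]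
    [DecidableEq κ] [Fintype μ] [DecidableEq μ]
    (u : ∀ i, E i →ₗ[ℂ] Matrix ι ι ℂ) (a : Matrix μ κ ℂ) {x : Matrix κ κ (∀ i, E i)}
    (b : Matrix κ μ ℂ) (hx : ∀ k l s t, Summable fun i => u i (x k l i) s t) :
    opNorm (sumAmp u (scalarMul a x b)) ≤ opNorm a * opNorm (sumAmp u x) * opNorm b := by
  rw [sumAmp_scalarMul u a b hx]
  refine (opNorm_mul_le _ _).trans ?_
  refine mul_le_mul ((opNorm_mul_le _ _).trans ?_) (opNorm_kronecker_one_le _) (opNorm_nonneg _)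
    (mul_nonneg (opNorm_nonneg _) (opNorm_nonneg _))
  exact mul_le_mul_of_nonneg_right (opNorm_kronecker_one_le _) (opNorm_nonneg _)

theorem l1SumNorm_scalarMul_le {m n : ℕ} (a : Matrix (Fin m) (Fin n) ℂ)
    {x : Matrix (Fin n) (Fin n) (∀ i, E i)} (b : Matrix (Fin n) (Fin m) ℂ)
    (hx : Summable fun i => N i n (component x i)) :
    l1SumNorm N m (scalarMul a x b) ≤ opNorm a * l1SumNorm N n x * opNorm b := by
  refine l1SumNorm_le (mul_nonneg (mul_nonneg (opNorm_nonneg _) (l1SumNorm_nonneg _))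
    (opNorm_nonneg _)) fun r u hu => ?_
  refine (opNorm_sumAmp_scalarMul_le u a b fun k l s t =>
    summable_apply (fun i y => (hu i).opNorm_amp_le y) hx k l s t).trans ?_
  exact mul_le_mul_of_nonneg_right (mul_le_mul_of_nonneg_left (opNorm_sumAmp_le hx hu)
    (opNorm_nonneg _)) (opNorm_nonneg _)

theorem l1SumNorm_smul_le {n : ℕ} (c : ℂ) {x : Matrix (Fin n) (Fin n) (∀ i, E i)}
    (hx : Summable fun i => N i n (component x i)) :
    l1SumNorm N n (c • x) ≤ ‖c‖ * l1SumNorm N n x := by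
  refine l1SumNorm_le (mul_nonneg (norm_nonneg _) (l1SumNorm_nonneg _)) fun m u hu => ?_
  have hs : sumAmp u (c • x) = c • sumAmp u x := by
    ext p q
    simp only [sumAmp, Matrix.of_apply, Matrix.smul_apply, Pi.smul_apply, map_smul, smul_eq_mul,
      tsum_mul_left]
  rw [hs, opNorm_smul]
  exact mul_le_mul_of_nonneg_left (opNorm_sumAmp_le hx hu) (norm_nonneg _)

theorem l1SumNorm_block_diag {m n : ℕ} {x : Matrix (Fin m) (Fin m) (∀ i, E i)}
    {y : Matrix (Fin n) (Fin n) (∀ i, E i)} (hx : Summable fun i => N i m (component x i))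
    (hy : Summable fun i => N i n (component y i))
    (hxy : Summable fun i => N i (m + n) (component ((Matrix.fromBlocks x 0 0 y).submatrix
      finSumFinEquiv.symm finSumFinEquiv.symm) i)) :
    l1SumNorm N (m + n) ((Matrix.fromBlocks x 0 0 y).submatrix
      finSumFinEquiv.symm finSumFinEquiv.symm) = max (l1SumNorm N m x) (l1SumNorm N n y) := by
  have key : ∀ (r : ℕ) (u : ∀ i, E i →ₗ[ℂ] Matrix (Fin r) (Fin r) ℂ),
      opNorm (sumAmp u ((Matrix.fromBlocks x 0 0 y).submatrix
      finSumFinEquiv.symm finSumFinEquiv.symm)) = max (opNorm (sumAmp u x))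
        (opNorm (sumAmp u y)) := by
    intro r u
    rw [← opNorm_fromBlocks_diag]
    let e : Fin (m + n) × Fin r ≃ (Fin m × Fin r) ⊕ (Fin n × Fin r) :=
      (Equiv.prodCongr finSumFinEquiv.symm (Equiv.refl _)).trans (Equiv.sumProdDistrib _ _ _)
    rw [← opNorm_submatrix_equiv _ e.symm e.symm]
    congr 1
    ext p q
    rcases p with ⟨p, a⟩ | ⟨p, a⟩ <;> rcases q with ⟨q, b⟩ | ⟨q, b⟩ <;>
      simp [e, sumAmp]
  refine le_antisymm (l1SumNorm_le (le_max_of_le_left (l1SumNorm_nonneg _)) fun r u hu => ?_)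
    (max_le ?_ ?_)
  · rw [key]
    exact max_le_max (opNorm_sumAmp_le hx hu) (opNorm_sumAmp_le hy hu)
  · refine l1SumNorm_le (l1SumNorm_nonneg _) fun r u hu => ?_
    exact (le_max_left _ _).trans ((key r u).symm.le.trans (opNorm_sumAmp_le hxy hu))
  · refine l1SumNorm_le (l1SumNorm_nonneg _) fun r u hu => ?_
    exact (le_max_right _ _).trans ((key r u).symm.le.trans (opNorm_sumAmp_le hxy hu))

end L1Sum

/-- Every matrix over a tensor product has a representation `a (x ⊗ y) b`. -/
theorem exists_eq_scalarMul_tmul {E F : Type*} [AddCommGroup E] [Module ℂ E] [AddCommGroup F]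
    [Module ℂ F] {n : ℕ} (z : Matrix (Fin n) (Fin n) (E ⊗[ℂ] F)) :
    ∃ (p q : ℕ) (x : Matrix (Fin p) (Fin p) E) (y : Matrix (Fin q) (Fin q) F)
      (a : Matrix (Fin n) (Fin p × Fin q) ℂ) (b : Matrix (Fin p × Fin q) (Fin n) ℂ),
      z = scalarMul a (Matrix.of fun s t => x s.1 t.1 ⊗ₜ[ℂ] y s.2 t.2) b := by
  classical
  choose S hS using fun kl : Fin n × Fin n => TensorProduct.exists_finset (z kl.1 kl.2)
  let J := Σ kl : Fin n × Fin n, S kl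
  let N := Fintype.card J
  let e : Fin N ≃ J := (Fintype.equivFin J).symm
  -- the pure tensors of all entries, as two diagonal matrices
  refine ⟨N, N, Matrix.diagonal fun j => (e j).2.1.1, Matrix.diagonal fun j => (e j).2.1.2,
    Matrix.of fun k s => if s.1 = s.2 ∧ (e s.1).1.1 = k then 1 else 0,
    Matrix.of fun s l => if s.1 = s.2 ∧ (e s.1).1.2 = l then 1 else 0, ?_⟩
  ext k l
  simp only [scalarMul, Matrix.of_apply]
  have h1 : ∀ s : Fin N × Fin N, ∑ t : Fin N × Fin N,
      (((if s.1 = s.2 ∧ (e s.1).1.1 = k then 1 else 0 : ℂ) *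
        (if t.1 = t.2 ∧ (e t.1).1.2 = l then 1 else 0)) •
      (Matrix.diagonal (fun j => (e j).2.1.1) s.1 t.1 ⊗ₜ[ℂ]
        Matrix.diagonal (fun j => (e j).2.1.2) s.2 t.2)) =
      if s.1 = s.2 ∧ (e s.1).1 = (k, l) then (e s.1).2.1.1 ⊗ₜ[ℂ] (e s.2).2.1.2 else 0 := by
    intro s
    rw [Finset.sum_eq_single s]
    · rw [Matrix.diagonal_apply_eq, Matrix.diagonal_apply_eq]
      by_cases h1 : s.1 = s.2 <;> by_cases h2 : (e s.1).1.1 = k <;>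
        by_cases h3 : (e s.1).1.2 = l <;> simp [h1, h2, h3, Prod.ext_iff] <;> simp_all
    · rintro t - ht
      by_cases h1 : s.1 = t.1
      · have h2 : s.2 ≠ t.2 := fun h2 => ht (Prod.ext h1.symm h2.symm)
        rw [Matrix.diagonal_apply_ne _ h2, TensorProduct.tmul_zero, smul_zero]
      · rw [Matrix.diagonal_apply_ne _ h1, TensorProduct.zero_tmul, smul_zero]
    · exact fun h => absurd (Finset.mem_univ _) h
  rw [Finset.sum_congr rfl fun s _ => h1 s, Fintype.sum_prod_type]
  have h2 : ∀ j : Fin N, ∑ i : Fin N, (if j = i ∧ (e j).1 = (k, l) then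
      (e j).2.1.1 ⊗ₜ[ℂ] (e i).2.1.2 else 0) =
      if (e j).1 = (k, l) then (e j).2.1.1 ⊗ₜ[ℂ] (e j).2.1.2 else 0 := by
    intro j
    rw [Finset.sum_eq_single j]
    · simp
    · intro i _ hi
      rw [if_neg fun h => hi h.1.symm]
    · simp
  rw [Finset.sum_congr rfl fun j _ => h2 j,
    Equiv.sum_comp e fun j : J => if j.1 = (k, l) then j.2.1.1 ⊗ₜ[ℂ] j.2.1.2 else 0,
    Fintype.sum_sigma, Finset.sum_eq_single (k, l)]
  · simp only [if_true]
    rw [hS (k, l)]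
    exact (Finset.sum_coe_sort (S (k, l)) fun i => i.1 ⊗ₜ[ℂ] i.2).symm
  · intro kl _ h
    simp [h]
  · simp

end OpSpace

namespace CQG

open OpSpace

/-! ### The operator space `A_Δ(𝔾)` -/

section ADeltaNorm

variable {A : Type*} [Ring A] [StarRing A] [HopfAlgebra ℂ A]

/-- The matrix `x` of elements of the row Hilbert space `(S²_n)_r`, each represented by
`x_{ij} Q^{1/2}`, as a scalar matrix. -/
noncomputable def rowMat (V : IrrRep A) {ι κ : Type*}
    (x : Matrix ι κ (Matrix (Fin V.n) (Fin V.n) ℂ)) : Matrix ι (κ × (Fin V.n × Fin V.n)) ℂ :=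
  Matrix.of fun i q => (x i q.1 * qSqrt V) q.2.1 q.2.2

/-- The weight `d_V^{3/2}`. -/
noncomputable def weight (V : IrrRep A) : ℝ := qDim V ^ (3 / 2 : ℝ)

variable {V : IrrRep A}

theorem IsQMatrix.weight_pos (hQ : IsQMatrix V (qMatrix V)) : 0 < weight V :=
  Real.rpow_pos_of_pos hQ.qDim_pos _

theorem IsQMatrix.weight_sq (hQ : IsQMatrix V (qMatrix V)) : weight V ^ 2 = qDim V ^ 3 := by
  rw [weight, ← Real.rpow_natCast, ← Real.rpow_mul hQ.qDim_pos.le, ← Real.rpow_natCast]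
  norm_num

variable {U : Irr A → IrrRep A}

theorem blockNorm_eq (α : Irr A) {n : ℕ}
    (x : Matrix (Fin n) (Fin n) (Matrix (Fin (U α).n) (Fin (U α).n) ℂ)) :
    blockNorm U α n x = weight (U α) * opNorm (rowMat (U α) x) := rfl

theorem aTerm_eq (X : MatFam U) (α : Irr A) :
    aTerm U X α = weight (U α) * hsNorm (X α * qSqrt (U α)) := rfl

theorem blockNorm_nonneg (hQ : ∀ α, IsQMatrix (U α) (qMatrix (U α))) (α : Irr A) (n : ℕ)
    (x : Matrix (Fin n) (Fin n) (Matrix (Fin (U α).n) (Fin (U α).n) ℂ)) :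
    0 ≤ blockNorm U α n x := by
  rw [blockNorm_eq]
  exact mul_nonneg (hQ α).weight_pos.le (opNorm_nonneg _)

theorem hsNorm_eq_of_sum {ι κ ι' κ' : Type*} [Fintype ι] [Fintype κ] [Fintype ι'] [Fintype κ']
    {M : Matrix ι κ ℂ} {N : Matrix ι' κ' ℂ}
    (h : ∑ i, ∑ j, ‖M i j‖ ^ 2 = ∑ i, ∑ j, ‖N i j‖ ^ 2) : hsNorm M = hsNorm N := by
  rw [hsNorm, hsNorm, h]

theorem blockNorm_one (α : Irr A) (M : Matrix (Fin (U α).n) (Fin (U α).n) ℂ) :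
    blockNorm U α 1 (Matrix.of fun _ _ => M) = weight (U α) * hsNorm (M * qSqrt (U α)) := by
  rw [blockNorm_eq, opNorm_row]
  congr 1
  refine hsNorm_eq_of_sum ?_
  simp [rowMat, Fintype.sum_prod_type]

theorem blockNorm_le_sum (hQ : ∀ α, IsQMatrix (U α) (qMatrix (U α))) (α : Irr A) (n : ℕ)
    (x : Matrix (Fin n) (Fin n) (Matrix (Fin (U α).n) (Fin (U α).n) ℂ)) :
    blockNorm U α n x ≤ ∑ k, ∑ l, weight (U α) * hsNorm (x k l * qSqrt (U α)) := by
  simp only [← Finset.mul_sum]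
  rw [blockNorm_eq]
  refine mul_le_mul_of_nonneg_left ((opNorm_le_hsNorm _).trans ?_) (hQ α).weight_pos.le
  have h0 : ∀ k l, 0 ≤ hsNorm (x k l * qSqrt (U α)) := fun _ _ => hsNorm_nonneg _
  refine Real.sqrt_le_iff.2 ⟨Finset.sum_nonneg fun k _ => Finset.sum_nonneg fun l _ => h0 k l, ?_⟩
  have h1 : ∑ i, ∑ j, ‖rowMat (U α) x i j‖ ^ 2 =
      ∑ k, ∑ l, hsNorm (x k l * qSqrt (U α)) ^ 2 := by
    refine Finset.sum_congr rfl fun k _ => ?_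
    rw [Fintype.sum_prod_type]
    refine Finset.sum_congr rfl fun l _ => ?_
    rw [hsNorm, Real.sq_sqrt (by positivity), Fintype.sum_prod_type]
    rfl
  rw [h1, ← Fintype.sum_prod_type', ← Fintype.sum_prod_type']
  exact Finset.sum_sq_le_sq_sum_of_nonneg fun p _ => h0 p.1 p.2

theorem summable_blockNorm (hQ : ∀ α, IsQMatrix (U α) (qMatrix (U α))) {n : ℕ}
    (x : Matrix (Fin n) (Fin n) (ADelta U)) :
    Summable fun α => blockNorm U α n (component (x.map Subtype.val) α) := by
  have h : Summable fun α => ∑ k, ∑ l, aTerm U (x k l).1 α :=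
    summable_sum fun k _ => summable_sum fun l _ => (x k l).2
  exact Summable.of_nonneg_of_le (fun α => blockNorm_nonneg hQ α n _)
    (fun α => blockNorm_le_sum hQ α n _) h

/-- The functional `M ↦ d^{3/2} ⟨v, M Q^{1/2}⟩` on `M_n`, with values in `M_1 = ℂ`. -/
noncomputable def rowFunctional (V : IrrRep A) (v : Fin V.n × Fin V.n → ℂ) :
    Matrix (Fin V.n) (Fin V.n) ℂ →ₗ[ℂ] Matrix (Fin 1) (Fin 1) ℂ where
  toFun M := Matrix.of fun _ _ => (weight V : ℂ) * ∑ p, (M * qSqrt V) p.1 p.2 * star (v p)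
  map_add' M N := by
    ext
    simp [add_mul, Finset.sum_add_distrib, mul_add]
  map_smul' c M := by
    ext
    simp only [Matrix.smul_mul, Matrix.smul_apply, smul_eq_mul, Matrix.of_apply, mul_assoc,
      ← Finset.mul_sum, RingHom.id_apply]
    ring

theorem isCompletelyContractive_rowFunctional (hQ : ∀ α, IsQMatrix (U α) (qMatrix (U α)))
    (α : Irr A) {v : Fin (U α).n × Fin (U α).n → ℂ} (hv : ∑ p, ‖v p‖ ^ 2 ≤ 1) :
    IsCompletelyContractive (blockNorm U α) (matAlgNorm 1) (rowFunctional (U α) v) := by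
  intro n x
  let c : Matrix (Fin (U α).n × Fin (U α).n) (Fin 1) ℂ := Matrix.of fun p _ => star (v p)
  have h : amp (rowFunctional (U α) v) x = ((weight (U α) : ℂ) •
      (rowMat (U α) x * Matrix.kronecker (1 : Matrix (Fin n) (Fin n) ℂ) c)).submatrix
        (Equiv.prodUnique (Fin n) (Fin 1)) (Equiv.refl _) := by
    ext ⟨i, s⟩ ⟨j, t⟩
    simp only [amp, rowFunctional, LinearMap.coe_mk, AddHom.coe_mk, Matrix.of_apply,
      Matrix.submatrix_apply, Matrix.smul_apply, Matrix.mul_apply (M := rowMat (U α) x),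
      smul_eq_mul, Equiv.prodUnique_apply, Equiv.refl_apply]
    congr 1
    rw [Fintype.sum_prod_type (f := fun q : Fin n × Fin (U α).n × Fin (U α).n => _),
      Finset.sum_eq_single j]
    · simp [c, rowMat]
    · intro k _ hk
      simp [Matrix.one_apply_ne hk]
    · simp
  change opNorm (amp (rowFunctional (U α) v) x) ≤ _
  rw [h, opNorm_submatrix_equiv, opNorm_smul, Complex.norm_real, Real.norm_eq_abs,
    abs_of_pos (hQ α).weight_pos, blockNorm_eq]
  refine mul_le_mul_of_nonneg_left ?_ (hQ α).weight_pos.le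
  refine (opNorm_mul_le _ _).trans (mul_le_of_le_one_right (opNorm_nonneg _) ?_)
  refine (opNorm_one_kronecker_le _).trans ((opNorm_le_hsNorm _).trans ?_)
  rw [hsNorm, Real.sqrt_le_one]
  simpa [c] using hv

/-- At the first matrix level the operator space structure is the norm of `A_Δ(𝔾)`; the lower bound
is attained at norming functionals of the components. -/
theorem aDeltaMatNorm_one (hQ : ∀ α, IsQMatrix (U α) (qMatrix (U α))) (X : ADelta U) :
    aDeltaMatNorm U 1 (Matrix.of fun _ _ => X) = aDeltaNorm U X := by
  have hb : ∀ α, blockNorm U α 1 (component ((Matrix.of fun _ _ : Fin 1 => X).map Subtype.val) α) =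
      aTerm U X.1 α := fun α => blockNorm_one α (X.1 α)
  have hx := summable_blockNorm hQ (Matrix.of fun _ _ : Fin 1 => X)
  refine le_antisymm ?_ ?_
  · refine (l1SumNorm_le_tsum (fun α n x => blockNorm_nonneg hQ α n x) hx).trans ?_
    simp only [hb]
    exact le_rfl
  · -- the functionals which norm each component
    let s : Irr A → ℝ := fun α => hsNorm (X.1 α * qSqrt (U α))
    let v : ∀ α, Fin (U α).n × Fin (U α).n → ℂ := fun α p =>
      ((s α)⁻¹ : ℝ) * (X.1 α * qSqrt (U α)) p.1 p.2
    have hs : ∀ α, ∑ p : Fin (U α).n × Fin (U α).n, ‖(X.1 α * qSqrt (U α)) p.1 p.2‖ ^ 2 =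
        s α ^ 2 := by
      intro α
      rw [Fintype.sum_prod_type]
      exact (Real.sq_sqrt (by positivity)).symm
    have hv : ∀ α, ∑ p, ‖v α p‖ ^ 2 ≤ 1 := by
      intro α
      simp only [v, norm_mul, mul_pow, ← Finset.mul_sum, hs, Complex.norm_real, Real.norm_eq_abs,
        sq_abs]
      rw [← mul_pow]
      rcases eq_or_ne (s α) 0 with h | h
      · simp [h]
      · rw [inv_mul_cancel₀ h, one_pow]
    have hu : ∀ α, rowFunctional (U α) (v α) (X.1 α) 0 0 = ((aTerm U X.1 α : ℝ) : ℂ) := by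
      intro α
      have h1 : ∑ p, (X.1 α * qSqrt (U α)) p.1 p.2 * star (v α p) = ((s α : ℝ) : ℂ) := by
        have h2 : ∀ p, (X.1 α * qSqrt (U α)) p.1 p.2 * star (v α p) =
            (((s α)⁻¹ * ‖(X.1 α * qSqrt (U α)) p.1 p.2‖ ^ 2 : ℝ) : ℂ) := by
          intro p
          rw [show star (v α p) = (starRingEnd ℂ) (((s α)⁻¹ : ℝ) *
            (X.1 α * qSqrt (U α)) p.1 p.2) from rfl, map_mul, Complex.conj_ofReal]
          push_cast
          rw [← Complex.mul_conj']
          ring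
        rw [Finset.sum_congr rfl fun p _ => h2 p, ← Complex.ofReal_sum, ← Finset.mul_sum, hs]
        congr 1
        rcases eq_or_ne (s α) 0 with h | h
        · simp [h]
        · field_simp
      change (weight (U α) : ℂ) * ∑ p, (X.1 α * qSqrt (U α)) p.1 p.2 * star (v α p) = _
      rw [h1, aTerm_eq, Complex.ofReal_mul]
    have h := opNorm_sumAmp_le hx fun α => isCompletelyContractive_rowFunctional hQ α (hv α)
    refine le_trans ?_ h
    refine le_trans ?_ (norm_apply_le_opNorm _ (0, 0) (0, 0))
    have h3 : sumAmp (fun α => rowFunctional (U α) (v α))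
        ((Matrix.of fun _ _ : Fin 1 => X).map Subtype.val) (0, 0) (0, 0) =
        ((aDeltaNorm U X : ℝ) : ℂ) := by
      change ∑' α, rowFunctional (U α) (v α) (X.1 α) 0 0 = _
      simp only [hu]
      rw [← Complex.ofReal_tsum]
      rfl
    rw [h3, Complex.norm_real]
    exact le_abs_self _

theorem IsQMatrix.eq_zero_of_hsNorm (hQ : IsQMatrix V (qMatrix V))
    {M : Matrix (Fin V.n) (Fin V.n) ℂ} (h : hsNorm (M * qSqrt V) = 0) : M = 0 := by
  have h1 := congrArg (· * (qSqrt V)⁻¹) (hsNorm_eq_zero h)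
  simpa [Matrix.mul_nonsing_inv_cancel_right _ _ hQ.isUnit_det_qSqrt] using h1

theorem aTerm_nonneg (hQ : ∀ α, IsQMatrix (U α) (qMatrix (U α))) (X : MatFam U) (α : Irr A) :
    0 ≤ aTerm U X α := mul_nonneg (hQ α).weight_pos.le (hsNorm_nonneg _)

theorem eq_zero_of_aDeltaNorm (hQ : ∀ α, IsQMatrix (U α) (qMatrix (U α))) {X : ADelta U}
    (h : aDeltaNorm U X = 0) : X = 0 := by
  have h1 := (hasSum_zero_iff_of_nonneg (aTerm_nonneg hQ X.1)).1 
    (show HasSum _ 0 from h ▸ Summable.hasSum X.2)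
  ext1
  funext α
  have h2 := congrFun h1 α
  rw [aTerm_eq] at h2
  exact (hQ α).eq_zero_of_hsNorm ((mul_eq_zero.1 h2).resolve_left (hQ α).weight_pos.ne')

/-- The Hilbert space of the component `α` of `A_Δ(𝔾)`. -/
abbrev BlockSpace (U : Irr A → IrrRep A) (α : Irr A) :=
  EuclideanSpace ℂ (Fin (U α).n × Fin (U α).n)

/-- The isometric identification `M ↦ d^{3/2} M Q^{1/2}` of a component of `A_Δ(𝔾)` with a Hilbert
space. -/
noncomputable def blockEquiv (hQ : IsQMatrix V (qMatrix V)) :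
    Matrix (Fin V.n) (Fin V.n) ℂ ≃ₗ[ℂ] EuclideanSpace ℂ (Fin V.n × Fin V.n) where
  toFun M := WithLp.toLp 2 fun p => (weight V : ℂ) * (M * qSqrt V) p.1 p.2
  map_add' M N := by
    ext
    simp [Matrix.add_mul, mul_add]
  map_smul' c M := by
    ext
    simp only [Matrix.smul_mul, Matrix.smul_apply, smul_eq_mul, RingHom.id_apply,
      PiLp.smul_apply]
    ring
  invFun v := (Matrix.of fun i j => (weight V : ℂ)⁻¹ * v (i, j)) * (qSqrt V)⁻¹
  left_inv M := by
    have h : (Matrix.of fun i j => (weight V : ℂ)⁻¹ * ((weight V : ℂ) * (M * qSqrt V) i j)) =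
        M * qSqrt V := by
      ext i j
      have := hQ.weight_pos.ne'
      simp only [Matrix.of_apply]
      rw [inv_mul_cancel_left₀ (by exact_mod_cast this)]
    change (Matrix.of fun i j => (weight V : ℂ)⁻¹ * ((weight V : ℂ) * (M * qSqrt V) i j)) *
      (qSqrt V)⁻¹ = M
    rw [h, Matrix.mul_nonsing_inv_cancel_right _ _ hQ.isUnit_det_qSqrt]
  right_inv v := by
    ext p
    have := hQ.weight_pos.ne'
    change (weight V : ℂ) * (((Matrix.of fun i j => (weight V : ℂ)⁻¹ * v (i, j)) *
      (qSqrt V)⁻¹) * qSqrt V) p.1 p.2 = v p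
    rw [Matrix.nonsing_inv_mul_cancel_right _ _ hQ.isUnit_det_qSqrt, Matrix.of_apply,
      mul_inv_cancel_left₀ (by exact_mod_cast this)]

theorem norm_blockEquiv (hQ : IsQMatrix V (qMatrix V)) (M : Matrix (Fin V.n) (Fin V.n) ℂ) :
    ‖blockEquiv hQ M‖ = weight V * hsNorm (M * qSqrt V) := by
  rw [EuclideanSpace.norm_eq, hsNorm, ← Real.sqrt_sq hQ.weight_pos.le,
    ← Real.sqrt_mul (sq_nonneg _), Finset.mul_sum, Fintype.sum_prod_type]
  congr 1
  refine Finset.sum_congr rfl fun i _ => ?_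
  rw [Finset.mul_sum]
  refine Finset.sum_congr rfl fun j _ => ?_
  change ‖(weight V : ℂ) * (M * qSqrt V) i j‖ ^ 2 = _
  rw [norm_mul, mul_pow, Complex.norm_real, Real.norm_eq_abs, sq_abs]

theorem memℓp_one_iff {I : Type*} {E : I → Type*} [∀ i, NormedAddCommGroup (E i)]
    {f : ∀ i, E i} : Memℓp f 1 ↔ Summable fun i => ‖f i‖ := by
  rw [memℓp_gen_iff (by simp)]
  simp

theorem lp_one_norm_eq {I : Type*} {E : I → Type*} [∀ i, NormedAddCommGroup (E i)]
    (f : lp E 1) : ‖f‖ = ∑' i, ‖f i‖ := by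
  rw [lp.norm_eq_tsum_rpow (by simp)]
  simp

/-- `A_Δ(𝔾)` as an `ℓ¹`-sum of Hilbert spaces. -/
noncomputable def aDeltaEquiv (hQ : ∀ α, IsQMatrix (U α) (qMatrix (U α))) :
    ADelta U ≃ₗ[ℂ] lp (BlockSpace U) 1 where
  toFun X := ⟨fun α => blockEquiv (hQ α) (X.1 α), memℓp_one_iff.2 <| by
    simp only [norm_blockEquiv]
    exact X.2⟩
  map_add' X Y := by
    ext1
    funext α
    exact map_add (blockEquiv (hQ α)) _ _
  map_smul' c X := by
    ext1
    funext α
    exact map_smul (blockEquiv (hQ α)) _ _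
  invFun f := ⟨fun α => (blockEquiv (hQ α)).symm (f α), by
    have h := memℓp_one_iff.1 f.2
    change Summable fun α => aTerm U _ α
    refine h.congr fun α => ?_
    rw [aTerm_eq, ← norm_blockEquiv (hQ α), LinearEquiv.apply_symm_apply]⟩
  left_inv X := by
    ext1
    funext α
    exact LinearEquiv.symm_apply_apply _ _
  right_inv f := by
    ext1
    funext α
    exact LinearEquiv.apply_symm_apply _ _

theorem norm_aDeltaEquiv (hQ : ∀ α, IsQMatrix (U α) (qMatrix (U α))) (X : ADelta U) :
    ‖aDeltaEquiv hQ X‖ = aDeltaNorm U X := by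
  rw [lp_one_norm_eq, aDeltaNorm]
  exact tsum_congr fun α => norm_blockEquiv (hQ α) _

theorem map_val_scalarMul {m n : ℕ} (a : Matrix (Fin m) (Fin n) ℂ)
    (x : Matrix (Fin n) (Fin n) (ADelta U)) (b : Matrix (Fin n) (Fin m) ℂ) :
    (scalarMul a x b).map Subtype.val = scalarMul a (x.map Subtype.val) b := by
  ext1 i j
  simp only [scalarMul, Matrix.map_apply, Matrix.of_apply]
  exact (map_sum (ADelta U).subtype _ _).trans (Finset.sum_congr rfl fun k _ =>
    (map_sum (ADelta U).subtype _ _).trans rfl)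

theorem isOperatorSpace_aDelta (hQ : ∀ α, IsQMatrix (U α) (qMatrix (U α))) :
    IsOperatorSpace (aDeltaMatNorm U) where
  add_le n x y := l1SumNorm_add_le (summable_blockNorm hQ x) (summable_blockNorm hQ y)
  smul_eq n c x := by
    have hle : ∀ (c : ℂ) (x : Matrix (Fin n) (Fin n) (ADelta U)),
        aDeltaMatNorm U n (c • x) ≤ ‖c‖ * aDeltaMatNorm U n x := fun c x =>
      l1SumNorm_smul_le c (summable_blockNorm hQ x)
    refine le_antisymm (hle c x) ?_
    rcases eq_or_ne c 0 with rfl | hc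
    · rw [norm_zero, zero_mul]
      exact l1SumNorm_nonneg _
    · have h := hle c⁻¹ (c • x)
      rwa [smul_smul, inv_mul_cancel₀ hc, one_smul, norm_inv,
        le_inv_mul_iff₀ (norm_pos_iff.2 hc)] at h
  eq_zero n x hx := by
    ext1 k l
    refine eq_zero_of_aDeltaNorm hQ (le_antisymm ?_ (tsum_nonneg (aTerm_nonneg hQ _)))
    -- compress to the entry `(k, l)`
    have h := l1SumNorm_scalarMul_le (Matrix.single 0 k 1 : Matrix (Fin 1) (Fin n) ℂ)
      (Matrix.single l 0 1 : Matrix (Fin n) (Fin 1) ℂ) (summable_blockNorm hQ x)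
    rw [show l1SumNorm (blockNorm U) n (x.map Subtype.val) = 0 from hx, mul_zero, zero_mul,
      ← map_val_scalarMul] at h
    have h1 : scalarMul (Matrix.single 0 k 1 : Matrix (Fin 1) (Fin n) ℂ) x
        (Matrix.single l 0 1 : Matrix (Fin n) (Fin 1) ℂ) = Matrix.of fun _ _ => x k l := by
      ext1 i j
      rw [Subsingleton.elim i 0, Subsingleton.elim j 0]
      simp [scalarMul, Matrix.single_apply, ite_and]
    rw [h1] at h
    rw [← aDeltaMatNorm_one hQ]
    exact h
  block_diag m n x y := by
    have h : ((Matrix.fromBlocks x 0 0 y).submatrix finSumFinEquiv.symm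
        finSumFinEquiv.symm).map Subtype.val = (Matrix.fromBlocks (x.map Subtype.val) 0 0
          (y.map Subtype.val)).submatrix finSumFinEquiv.symm
          (finSumFinEquiv (m := m) (n := n)).symm := by
      ext1 p q
      simp only [Matrix.map_apply, Matrix.submatrix_apply]
      rcases finSumFinEquiv.symm p with p | p <;> rcases finSumFinEquiv.symm q with q | q <;> rfl
    have h1 := summable_blockNorm hQ ((Matrix.fromBlocks x 0 0 y).submatrix finSumFinEquiv.symm
        finSumFinEquiv.symm)
    rw [h] at h1
    refine Eq.trans ?_ (l1SumNorm_block_diag (summable_blockNorm hQ x) (summable_blockNorm hQ y) h1)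
    rw [aDeltaMatNorm, h]
  scalarMul_le m n a x b := by
    rw [aDeltaMatNorm, map_val_scalarMul]
    exact l1SumNorm_scalarMul_le a b (summable_blockNorm hQ x)
  complete s hs := by
    have hd : ∀ X Y, aDeltaMatNorm U 1 (Matrix.of fun _ _ => X - Y) =
        dist (aDeltaEquiv hQ X) (aDeltaEquiv hQ Y) := by
      intro X Y
      rw [aDeltaMatNorm_one hQ, dist_eq_norm, ← map_sub, norm_aDeltaEquiv]
    have hc : CauchySeq fun i => aDeltaEquiv hQ (s i) := by
      rw [Metric.cauchySeq_iff]
      intro ε hε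
      obtain ⟨K, hK⟩ := hs ε hε
      refine ⟨K, fun i hi j hj => ?_⟩
      rw [← hd]
      exact hK i hi j hj
    obtain ⟨f, hf⟩ := cauchySeq_tendsto_of_complete hc
    refine ⟨(aDeltaEquiv hQ).symm f, fun ε hε => ?_⟩
    obtain ⟨K, hK⟩ := Metric.tendsto_atTop.1 hf ε hε
    refine ⟨K, fun i hi => ?_⟩
    rw [hd, LinearEquiv.apply_symm_apply]
    exact hK i hi

end ADeltaNorm

/-! ### The product of two components -/

section KeyEstimate

variable {A : Type*} [Ring A] [StarRing A] [HopfAlgebra ℂ A] {U : Irr A → IrrRep A}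

theorem opNorm_amp_le_rowMat {α : Irr A} {m : ℕ}
    {u : Matrix (Fin (U α).n) (Fin (U α).n) ℂ →ₗ[ℂ] Matrix (Fin m) (Fin m) ℂ}
    (hu : IsCompletelyContractive (blockNorm U α) (matAlgNorm m) u) {κ : Type*} [Fintype κ]
    [DecidableEq κ] (x : Matrix κ κ (Matrix (Fin (U α).n) (Fin (U α).n) ℂ)) :
    opNorm (Matrix.of fun (p q : κ × Fin m) => u (x p.1 q.1) p.2 q.2) ≤
      weight (U α) * opNorm (rowMat (U α) x) := by
  let e := Fintype.equivFin κ
  have h := hu _ (x.submatrix e.symm e.symm)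
  rw [blockNorm_eq] at h
  rw [← opNorm_submatrix_equiv _ (Equiv.prodCongr e.symm (Equiv.refl _))
    (Equiv.prodCongr e.symm (Equiv.refl _)), ← opNorm_submatrix_equiv (rowMat (U α) x) e.symm
    (Equiv.prodCongr e.symm (Equiv.refl _))]
  exact h

/-- The column of the matrices `u(e_{ab} Q^{-1/2})`. -/
noncomputable def unitColumn (V : IrrRep A) {ι : Type*}
    (u : Matrix (Fin V.n) (Fin V.n) ℂ →ₗ[ℂ] Matrix ι ι ℂ) :
    Matrix ((Fin V.n × Fin V.n) × ι) ι ℂ :=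
  Matrix.of fun p c => u (Matrix.single p.1.1 p.1.2 1 * (qSqrt V)⁻¹) p.2 c

theorem opNorm_one_le {ι : Type*} [Fintype ι] [DecidableEq ι] :
    opNorm (1 : Matrix ι ι ℂ) ≤ 1 :=
  opNorm_le_one_of_isometry (by rw [Matrix.conjTranspose_one, Matrix.one_mul])

/-- The unit matrices form an orthonormal family of the row Hilbert space, so that the column of
their images under a complete contraction is bounded by the weight `d^{3/2}`. -/
theorem opNorm_unitColumn_le (hQ : ∀ α, IsQMatrix (U α) (qMatrix (U α))) {α : Irr A} {m : ℕ}
    {u : Matrix (Fin (U α).n) (Fin (U α).n) ℂ →ₗ[ℂ] Matrix (Fin m) (Fin m) ℂ}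
    (hu : IsCompletelyContractive (blockNorm U α) (matAlgNorm m) u) :
    opNorm (unitColumn (U α) u) ≤ weight (U α) := by
  let o : Fin (U α).n × Fin (U α).n := (⟨0, (U α).n_pos⟩, ⟨0, (U α).n_pos⟩)
  let z : Matrix (Fin (U α).n × Fin (U α).n) (Fin (U α).n × Fin (U α).n)
      (Matrix (Fin (U α).n) (Fin (U α).n) ℂ) := Matrix.of fun p q =>
    if q = o then Matrix.single p.1 p.2 1 * (qSqrt (U α))⁻¹ else 0
  have h1 : unitColumn (U α) u = (Matrix.of fun (p q : (Fin (U α).n × Fin (U α).n) × Fin m) =>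
      u (z p.1 q.1) p.2 q.2).submatrix id fun c => (o, c) := by
    ext p c
    simp [z, unitColumn]
  have h2 : rowMat (U α) z = (1 : Matrix ((Fin (U α).n × Fin (U α).n) × Fin (U α).n × Fin (U α).n)
      ((Fin (U α).n × Fin (U α).n) × Fin (U α).n × Fin (U α).n) ℂ).submatrix
      (fun p => (o, p)) id := by
    ext p ⟨q, r⟩
    simp only [rowMat, z, Matrix.of_apply, Matrix.submatrix_apply, Matrix.one_apply, id,
      Prod.mk.injEq]
    by_cases h : q = o
    · rw [if_pos h, Matrix.nonsing_inv_mul_cancel_right _ _ (hQ α).isUnit_det_qSqrt,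
        Matrix.single_apply]
      simp [h, Prod.ext_iff]
    · rw [if_neg h, if_neg fun h' => h h'.1.symm]
      simp
  rw [h1]
  refine (opNorm_submatrix_le _ Function.injective_id (Prod.mk_right_injective o)).trans
    ((opNorm_amp_le_rowMat hu z).trans ?_)
  rw [h2]
  refine mul_le_of_le_one_right (hQ α).weight_pos.le ((opNorm_submatrix_le _
    (Prod.mk_right_injective o) Function.injective_id).trans opNorm_one_le)

theorem IsQMatrix.apply_eq_sum {V : IrrRep A} (hQ : IsQMatrix V (qMatrix V)) {ι : Type*}
    (u : Matrix (Fin V.n) (Fin V.n) ℂ →ₗ[ℂ] Matrix ι ι ℂ) (Z : Matrix (Fin V.n) (Fin V.n) ℂ)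
    (c c' : ι) : u Z c c' =
      ∑ p : Fin V.n × Fin V.n, (Z * qSqrt V) p.1 p.2 * unitColumn V u (p, c) c' := by
  have h : Z = ∑ p : Fin V.n × Fin V.n, (Z * qSqrt V) p.1 p.2 •
      (Matrix.single p.1 p.2 1 * (qSqrt V)⁻¹) := by
    conv_lhs => rw [← Matrix.mul_nonsing_inv_cancel_right _ Z hQ.isUnit_det_qSqrt,
      Matrix.matrix_eq_sum_single (Z * qSqrt V)]
    rw [Fintype.sum_prod_type]
    simp only [Matrix.sum_mul, ← Matrix.smul_mul, Matrix.smul_single, smul_eq_mul, mul_one]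
  conv_lhs => rw [h]
  simp only [map_sum, map_smul, Matrix.sum_apply, Matrix.smul_apply, smul_eq_mul]
  rfl

/-- The matrix of the map `⨁_r W̄_r ⊗ W_r` on `⨁_r ℂ^{n_r} ⊗ ℂ^{n_r}`, for the inclusions `W_r` of
the summands of the tensor product of `β` and `γ`. The indices of the range are grouped by `β` and
`γ`. -/
noncomputable def Decomp.hsIsometry {β γ : Irr A}
    (D : Decomp U (tensorRep (U β).toUnitaryRep (U γ).toUnitaryRep)) :
    Matrix ((Fin (U β).n × Fin (U β).n) × Fin (U γ).n × Fin (U γ).n)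
      (Σ r, Fin (U (D.cls r)).n × Fin (U (D.cls r)).n) ℂ :=
  Matrix.of fun q s => star (D.W s.1 (q.1.1, q.2.1) s.2.1) * D.W s.1 (q.1.2, q.2.2) s.2.2

/-- `hsIsometry` is a restriction of `W̄ ⊗ W`, where `W` is the isometry with the columns `W_r`. -/
theorem Decomp.opNorm_hsIsometry_le {β γ : Irr A}
    (D : Decomp U (tensorRep (U β).toUnitaryRep (U γ).toUnitaryRep)) [DecidableEq D.R] :
    opNorm D.hsIsometry ≤ 1 := by
  let W : Matrix (Fin (U β).n × Fin (U γ).n) (Σ r, Fin (U (D.cls r)).n) ℂ :=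
    Matrix.of fun q s => D.W s.1 q s.2
  have hW : Wᴴ * W = 1 := by
    ext ⟨r, a⟩ ⟨r', b⟩
    have h : (Wᴴ * W) ⟨r, a⟩ ⟨r', b⟩ = ((D.W r)ᴴ * D.W r') a b := rfl
    rw [h]
    by_cases hr : r = r'
    · subst hr
      rw [D.isometry, Matrix.one_apply, Matrix.one_apply]
      simp
    · rw [D.orthogonal r r' hr, Matrix.one_apply_ne fun h => hr (congrArg Sigma.fst h)]
      rfl
  have hW' : (W.map star)ᴴ * W.map star = 1 := by
    have h : (W.map star)ᴴ * W.map star = (Wᴴ * W).map star := by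
      ext s t
      simp [Matrix.mul_apply]
    rw [h, hW, Matrix.map_one star (star_zero ℂ) (star_one ℂ)]
  have h : D.hsIsometry = (Matrix.kronecker (W.map star) W).submatrix
      (fun q => ((q.1.1, q.2.1), (q.1.2, q.2.2))) (fun s => (⟨s.1, s.2.1⟩, ⟨s.1, s.2.2⟩)) := by
    ext q s
    rfl
  rw [h]
  refine (opNorm_submatrix_le _ ?_ ?_).trans ((opNorm_kronecker_le _ _).trans
    (mul_le_one₀ (opNorm_le_one_of_isometry hW') (opNorm_nonneg _) (opNorm_le_one_of_isometry hW)))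
  · rintro ⟨⟨a, b⟩, c, d⟩ ⟨⟨a', b'⟩, c', d'⟩ h
    simp only [Prod.mk.injEq] at h ⊢
    tauto
  · rintro ⟨r, a, b⟩ ⟨r', a', b'⟩ h
    simp only [Prod.mk.injEq, Sigma.mk.injEq] at h
    obtain ⟨⟨rfl, h1⟩, _, h2⟩ := h
    rw [eq_of_heq h1, eq_of_heq h2]

/-- The column of the `d_β d_γ / d_r` multiples of the columns `unitColumn` of the summands of the
tensor product of `β` and `γ`. -/
noncomputable def Decomp.column {β γ : Irr A}
    (D : Decomp U (tensorRep (U β).toUnitaryRep (U γ).toUnitaryRep)) {ι : Type*}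
    (u : ∀ α, Matrix (Fin (U α).n) (Fin (U α).n) ℂ →ₗ[ℂ] Matrix ι ι ℂ) :
    Matrix ((Σ r, Fin (U (D.cls r)).n × Fin (U (D.cls r)).n) × ι) ι ℂ :=
  Matrix.of fun s c => ((qDim (U β) * qDim (U γ) / qDim (U (D.cls s.1.1)) : ℝ) : ℂ) *
    unitColumn (U (D.cls s.1.1)) (u (D.cls s.1.1)) (s.1.2, s.2) c

variable [StarModule ℂ A] [IsPol A]

/-- With `opNorm_unitColumn_le` the square of the norm is at most `∑_r (d_β d_γ / d_r)² d_r³`, which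
is `(d_β d_γ)³` since the quantum dimension is multiplicative. -/
theorem Decomp.opNorm_column_le (hU : ∀ α, (Quotient.mk _ (U α) : Irr A) = α) {β γ : Irr A}
    (D : Decomp U (tensorRep (U β).toUnitaryRep (U γ).toUnitaryRep)) {m : ℕ}
    {u : ∀ α, Matrix (Fin (U α).n) (Fin (U α).n) ℂ →ₗ[ℂ] Matrix (Fin m) (Fin m) ℂ}
    (hu : ∀ α, IsCompletelyContractive (blockNorm U α) (matAlgNorm m) (u α)) :
    opNorm (D.column u) ≤ weight (U β) * weight (U γ) := by
  have hQ : ∀ α, IsQMatrix (U α) (qMatrix (U α)) := fun α => isQMatrix_qMatrix hU (U α)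
  have hβ := (hQ β).qDim_pos
  have hγ := (hQ γ).qDim_pos
  refine (sq_le_sq₀ (opNorm_nonneg _)
    (mul_nonneg (hQ β).weight_pos.le (hQ γ).weight_pos.le)).1 ?_
  rw [← opNorm_submatrix_equiv _ (Equiv.sigmaProdDistrib
    (fun r => Fin (U (D.cls r)).n × Fin (U (D.cls r)).n) (Fin m)).symm (Equiv.refl _)]
  refine (opNorm_sq_le_sum _).trans ?_
  have h1 : ∀ r, opNorm (((D.column u).submatrix (Equiv.sigmaProdDistrib
      (fun r => Fin (U (D.cls r)).n × Fin (U (D.cls r)).n) (Fin m)).symm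
        (Equiv.refl _)).submatrix (Sigma.mk r) id) ^ 2 ≤
      (qDim (U β) * qDim (U γ)) ^ 2 * qDim (U (D.cls r)) := by
    intro r
    have hr := (hQ (D.cls r)).qDim_pos
    have h2 : ((D.column u).submatrix (Equiv.sigmaProdDistrib
      (fun r => Fin (U (D.cls r)).n × Fin (U (D.cls r)).n) (Fin m)).symm
        (Equiv.refl _)).submatrix (Sigma.mk r) id =
        ((qDim (U β) * qDim (U γ) / qDim (U (D.cls r)) : ℝ) : ℂ) •
          unitColumn (U (D.cls r)) (u (D.cls r)) := by
      ext s c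
      rfl
    rw [h2, opNorm_smul, mul_pow, Complex.norm_real, Real.norm_eq_abs, sq_abs]
    calc (qDim (U β) * qDim (U γ) / qDim (U (D.cls r))) ^ 2 *
          opNorm (unitColumn (U (D.cls r)) (u (D.cls r))) ^ 2
        ≤ (qDim (U β) * qDim (U γ) / qDim (U (D.cls r))) ^ 2 * weight (U (D.cls r)) ^ 2 := by
          refine mul_le_mul_of_nonneg_left ?_ (sq_nonneg _)
          exact pow_le_pow_left₀ (opNorm_nonneg _) (opNorm_unitColumn_le hQ (hu _)) 2
      _ = (qDim (U β) * qDim (U γ)) ^ 2 * qDim (U (D.cls r)) := by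
          rw [(hQ _).weight_sq]
          field_simp
  refine (Finset.sum_le_sum fun r _ => h1 r).trans (le_of_eq ?_)
  rw [← Finset.mul_sum, ← qDim_mul_qDim hU D, mul_pow (weight (U β)), (hQ β).weight_sq,
    (hQ γ).weight_sq]
  ring

theorem tsum_apply_fourier_block_mul (hU : ∀ α, (Quotient.mk _ (U α) : Irr A) = α) {β γ : Irr A}
    (D : Decomp U (tensorRep (U β).toUnitaryRep (U γ).toUnitaryRep)) {ι : Type*}
    (u : ∀ α, Matrix (Fin (U α).n) (Fin (U α).n) ℂ →ₗ[ℂ] Matrix ι ι ℂ)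
    (X : Matrix (Fin (U β).n) (Fin (U β).n) ℂ) (Y : Matrix (Fin (U γ).n) (Fin (U γ).n) ℂ)
    (c c' : ι) : ∑' α, u α (fourier U (block U β X * block U γ Y) α) c c' =
      ∑ r, ((qDim (U β) * qDim (U γ) / qDim (U (D.cls r)) : ℝ) : ℂ) *
        u (D.cls r) ((D.W r)ᴴ * Matrix.kronecker X Y * D.W r) c c' := by
  classical
  have h1 : ∀ α, u α (fourier U (block U β X * block U γ Y) α) c c' =
      ∑ r, u α ((Pi.single (D.cls r) (((qDim (U β) * qDim (U γ) / qDim (U (D.cls r)) : ℝ) : ℂ) •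
        ((D.W r)ᴴ * Matrix.kronecker X Y * D.W r)) : MatFam U) α) c c' := by
    intro α
    rw [block_mul_block hU D, ← fourierLin_apply, map_sum, Finset.sum_apply, map_sum,
      Matrix.sum_apply]
    simp only [fourierLin_apply, fourier_block hU]
  have h2 : ∀ (r : D.R) (α : Irr A), α ≠ D.cls r → u α ((Pi.single (D.cls r)
      (((qDim (U β) * qDim (U γ) / qDim (U (D.cls r)) : ℝ) : ℂ) •
        ((D.W r)ᴴ * Matrix.kronecker X Y * D.W r)) : MatFam U) α) c c' = 0 := by
    intro r α h
    rw [Pi.single_eq_of_ne h, map_zero]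
    rfl
  simp only [h1]
  rw [Summable.tsum_finsetSum fun r _ => (hasSum_single _ (h2 r)).summable]
  refine Finset.sum_congr rfl fun r _ => ?_
  rw [tsum_eq_single _ (h2 r), Pi.single_eq_same, map_smul]
  rfl

/-- The multiplicativity of `Q^{1/2}` turns the compression of `X ⊗ Y` to a summand into one of
`X Q^{1/2} ⊗ Y Q^{1/2}`. -/
theorem Decomp.compress_mul_qSqrt_apply (hU : ∀ α, (Quotient.mk _ (U α) : Irr A) = α)
    {β γ : Irr A} (D : Decomp U (tensorRep (U β).toUnitaryRep (U γ).toUnitaryRep))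
    (X : Matrix (Fin (U β).n) (Fin (U β).n) ℂ) (Y : Matrix (Fin (U γ).n) (Fin (U γ).n) ℂ)
    (r : D.R) (p : Fin (U (D.cls r)).n × Fin (U (D.cls r)).n) :
    ((D.W r)ᴴ * Matrix.kronecker X Y * D.W r * qSqrt (U (D.cls r))) p.1 p.2 =
      ∑ q : (Fin (U β).n × Fin (U β).n) × Fin (U γ).n × Fin (U γ).n,
        (X * qSqrt (U β)) q.1.1 q.1.2 * (Y * qSqrt (U γ)) q.2.1 q.2.2 *
          D.hsIsometry q ⟨r, p⟩ := by
  have h : (D.W r)ᴴ * Matrix.kronecker X Y * D.W r * qSqrt (U (D.cls r)) =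
      (D.W r)ᴴ * Matrix.kronecker (X * qSqrt (U β)) (Y * qSqrt (U γ)) * D.W r := by
    have h1 : Matrix.kronecker (X * qSqrt (U β)) (Y * qSqrt (U γ)) =
        Matrix.kronecker X Y * Matrix.kronecker (qSqrt (U β)) (qSqrt (U γ)) :=
      Matrix.mul_kronecker_mul _ _ _ _
    rw [h1, Matrix.mul_assoc _ (D.W r), ← kronecker_qSqrt_mul hU D]
    simp only [Matrix.mul_assoc]
  have h2 : ((D.W r)ᴴ * Matrix.kronecker (X * qSqrt (U β)) (Y * qSqrt (U γ)) * D.W r) p.1 p.2 =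
      ∑ t, ∑ s, star (D.W r s p.1) * ((X * qSqrt (U β)) s.1 t.1 * (Y * qSqrt (U γ)) s.2 t.2) *
        D.W r t p.2 := by
    rw [Matrix.mul_apply]
    refine Finset.sum_congr rfl fun t _ => ?_
    rw [Matrix.mul_apply, Finset.sum_mul]
    rfl
  rw [h, h2, Finset.sum_comm, ← Fintype.sum_prod_type']
  refine Fintype.sum_equiv (Equiv.prodProdProdComm _ _ _ _) _ _ fun q => ?_
  simp only [Decomp.hsIsometry, Matrix.of_apply, Equiv.prodProdProdComm_apply]
  ring

/-- The product of two components of `A_Δ(𝔾)` is jointly completely contractive. The image of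
`x ⊗ y` under complete contractions is the product of the row of the entries of
`x Q^{1/2} ⊗ y Q^{1/2}`, of norm at most `‖x‖ ‖y‖ / (d_β d_γ)^{3/2}`, and a column of norm at most
`(d_β d_γ)^{3/2}`. -/
theorem opNorm_fourier_block_mul_le (hU : ∀ α, (Quotient.mk _ (U α) : Irr A) = α) {β γ : Irr A}
    {m : ℕ} {u : ∀ α, Matrix (Fin (U α).n) (Fin (U α).n) ℂ →ₗ[ℂ] Matrix (Fin m) (Fin m) ℂ}
    (hu : ∀ α, IsCompletelyContractive (blockNorm U α) (matAlgNorm m) (u α)) {p q : ℕ}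
    (x : Matrix (Fin p) (Fin p) (Matrix (Fin (U β).n) (Fin (U β).n) ℂ))
    (y : Matrix (Fin q) (Fin q) (Matrix (Fin (U γ).n) (Fin (U γ).n) ℂ)) :
    opNorm (Matrix.of fun (s t : (Fin p × Fin q) × Fin m) => ∑' α, u α (fourier U
      (block U β (x s.1.1 t.1.1) * block U γ (y s.1.2 t.1.2)) α) s.2 t.2) ≤
      blockNorm U β p x * blockNorm U γ q y := by
  classical
  have hQ : ∀ α, IsQMatrix (U α) (qMatrix (U α)) := fun α => isQMatrix_qMatrix hU (U α)
  obtain ⟨D⟩ := (tensorRep_isUnitaryCorep (U β).toUnitaryRep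
    (U γ).toUnitaryRep).nonempty_decomp U hU _ rfl
  let Q := (Fin (U β).n × Fin (U β).n) × Fin (U γ).n × Fin (U γ).n
  let e : (Fin p × Fin q) × Q ≃ (Fin p × (Fin (U β).n × Fin (U β).n)) ×
    (Fin q × (Fin (U γ).n × Fin (U γ).n)) := Equiv.prodProdProdComm _ _ _ _
  -- the row of the two elements, and the column of the images
  let R : Matrix (Fin p × Fin q) ((Fin p × Fin q) × Q) ℂ :=
    (Matrix.kronecker (rowMat (U β) x) (rowMat (U γ) y)).submatrix id e
  let G : Matrix (Q × Fin m) (Fin m) ℂ :=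
    Matrix.kronecker D.hsIsometry (1 : Matrix (Fin m) (Fin m) ℂ) * D.column u
  have hG : opNorm G ≤ weight (U β) * weight (U γ) := by
    refine (opNorm_mul_le _ _).trans ?_
    rw [← one_mul (weight (U β) * weight (U γ))]
    exact mul_le_mul ((opNorm_kronecker_one_le _).trans D.opNorm_hsIsometry_le)
      (D.opNorm_column_le hU hu) (opNorm_nonneg _) zero_le_one
  have hR : opNorm R ≤ opNorm (rowMat (U β) x) * opNorm (rowMat (U γ) y) :=
    (opNorm_submatrix_le _ Function.injective_id e.injective).trans (opNorm_kronecker_le _ _)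
  have hGa : ∀ (b : Q) (c c' : Fin m), G (b, c) c' =
      ∑ r, ((qDim (U β) * qDim (U γ) / qDim (U (D.cls r)) : ℝ) : ℂ) *
        ∑ a, D.hsIsometry b ⟨r, a⟩ * unitColumn (U (D.cls r)) (u (D.cls r)) (a, c) c' := by
    intro b c c'
    simp only [G, Matrix.mul_apply]
    rw [Fintype.sum_prod_type, Fintype.sum_sigma]
    refine Finset.sum_congr rfl fun r _ => ?_
    rw [Finset.mul_sum]
    refine Finset.sum_congr rfl fun a _ => ?_
    rw [Finset.sum_eq_single c]
    · simp only [kronecker_apply', Matrix.one_apply_eq, Decomp.column, Matrix.of_apply]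
      ring
    · intro k _ hk
      rw [kronecker_apply', Matrix.one_apply_ne hk.symm, mul_zero, zero_mul]
    · simp
  have hfac : (Matrix.of fun (s t : (Fin p × Fin q) × Fin m) => ∑' α, u α (fourier U
      (block U β (x s.1.1 t.1.1) * block U γ (y s.1.2 t.1.2)) α) s.2 t.2) =
      Matrix.kronecker R (1 : Matrix (Fin m) (Fin m) ℂ) *
        (Matrix.kronecker (1 : Matrix (Fin p × Fin q) (Fin p × Fin q) ℂ) G).submatrix
          (Equiv.prodAssoc _ _ _) id := by
    ext ⟨s, c⟩ ⟨t, c'⟩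
    have h1 : (Matrix.kronecker R (1 : Matrix (Fin m) (Fin m) ℂ) *
        (Matrix.kronecker (1 : Matrix (Fin p × Fin q) (Fin p × Fin q) ℂ) G).submatrix
          (Equiv.prodAssoc _ _ _) id) (s, c) (t, c') = ∑ b, R s (t, b) * G (b, c) c' := by
      rw [Matrix.mul_apply, Fintype.sum_prod_type, Fintype.sum_prod_type, Finset.sum_eq_single t]
      · refine Finset.sum_congr rfl fun b _ => ?_
        rw [Finset.sum_eq_single c]
        · simp
        · intro k _ hk
          rw [kronecker_apply', Matrix.one_apply_ne hk.symm, mul_zero, zero_mul]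
        · simp
      · intro k _ hk
        refine Finset.sum_eq_zero fun b _ => Finset.sum_eq_zero fun d _ => ?_
        simp [Matrix.one_apply_ne hk]
      · simp
    rw [h1, Matrix.of_apply, tsum_apply_fourier_block_mul hU D]
    simp only [hGa, (hQ _).apply_eq_sum (u _), D.compress_mul_qSqrt_apply hU, Finset.mul_sum,
      Finset.sum_mul]
    rw [Finset.sum_comm (s := (Finset.univ : Finset Q))]
    refine Finset.sum_congr rfl fun r _ => ?_
    rw [Finset.sum_comm]
    refine Finset.sum_congr rfl fun b _ => Finset.sum_congr rfl fun a _ => ?_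
    rw [show R s (t, b) = (x s.1 t.1 * qSqrt (U β)) b.1.1 b.1.2 *
      (y s.2 t.2 * qSqrt (U γ)) b.2.1 b.2.2 from rfl]
    ring
  rw [hfac, blockNorm_eq, blockNorm_eq]
  calc _ ≤ opNorm R * opNorm G := by
        refine (opNorm_mul_le _ _).trans (mul_le_mul (opNorm_kronecker_one_le _) ?_
          (opNorm_nonneg _) (opNorm_nonneg _))
        exact (opNorm_submatrix_le _ (Equiv.injective _) Function.injective_id).trans
          (opNorm_one_kronecker_le _)
    _ ≤ (opNorm (rowMat (U β) x) * opNorm (rowMat (U γ) y)) *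
          (weight (U β) * weight (U γ)) :=
        mul_le_mul hR hG (opNorm_nonneg _) (mul_nonneg (opNorm_nonneg _) (opNorm_nonneg _))
    _ = _ := by ring

end KeyEstimate

/-! ### The multiplication of `A_Δ(𝔾)` -/

section Multiplication

variable {A : Type*} [Ring A] [StarRing A] [HopfAlgebra ℂ A] [StarModule ℂ A] [IsPol A]
variable {U : Irr A → IrrRep A} (hU : ∀ α, (Quotient.mk _ (U α) : Irr A) = α)

/-- `A_Δ(𝔾)` as an `ℓ¹`-sum of Hilbert spaces, for a family of representatives. -/
noncomputable def toLp : ADelta U ≃ₗ[ℂ] lp (BlockSpace U) 1 :=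
  aDeltaEquiv fun α => isQMatrix_qMatrix hU (U α)

theorem norm_toLp (X : ADelta U) : ‖toLp hU X‖ = aDeltaNorm U X := norm_aDeltaEquiv _ X

theorem toLp_apply (X : ADelta U) (α : Irr A) :
    toLp hU X α = blockEquiv (isQMatrix_qMatrix hU (U α)) (X.1 α) := rfl

/-- The product of two components of `A_Δ(𝔾)`. -/
noncomputable def blockMul (β γ : Irr A) : Matrix (Fin (U β).n) (Fin (U β).n) ℂ →ₗ[ℂ]
    Matrix (Fin (U γ).n) (Fin (U γ).n) ℂ →ₗ[ℂ] lp (BlockSpace U) 1 :=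
  ((LinearMap.mul ℂ A).compl₁₂ (block U β) (block U γ)).compr₂
    ((toLp hU).toLinearMap ∘ₗ toADelta hU)

theorem blockMul_apply {β γ : Irr A} (M : Matrix (Fin (U β).n) (Fin (U β).n) ℂ)
    (N : Matrix (Fin (U γ).n) (Fin (U γ).n) ℂ) :
    blockMul hU β γ M N = toLp hU (toADelta hU (block U β M * block U γ N)) := rfl

theorem norm_blockMul_le {β γ : Irr A} (M : Matrix (Fin (U β).n) (Fin (U β).n) ℂ)
    (N : Matrix (Fin (U γ).n) (Fin (U γ).n) ℂ) : ‖blockMul hU β γ M N‖ ≤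
      (weight (U β) * hsNorm (M * qSqrt (U β))) * (weight (U γ) * hsNorm (N * qSqrt (U γ))) := by
  have hQ : ∀ α, IsQMatrix (U α) (qMatrix (U α)) := fun α => isQMatrix_qMatrix hU (U α)
  rw [blockMul_apply, norm_toLp, ← aDeltaMatNorm_one hQ, ← blockNorm_one, ← blockNorm_one]
  refine l1SumNorm_le (mul_nonneg (blockNorm_nonneg hQ _ _ _) (blockNorm_nonneg hQ _ _ _))
    fun m u hu => ?_
  have h := opNorm_fourier_block_mul_le hU hu (Matrix.of fun _ _ : Fin 1 => M)
    (Matrix.of fun _ _ : Fin 1 => N)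
  refine le_trans ?_ h
  let f : Fin 1 × Fin m ≃ (Fin 1 × Fin 1) × Fin m :=
    Equiv.prodCongr (Equiv.prodUnique (Fin 1) (Fin 1)).symm (Equiv.refl _)
  rw [← opNorm_submatrix_equiv _ f f]
  exact le_rfl

include hU

theorem summable_mul_aTerm (X Y : ADelta U) :
    Summable fun p : Irr A × Irr A => aTerm U X.1 p.1 * aTerm U Y.1 p.2 :=
  Summable.mul_of_nonneg X.2 Y.2
    (aTerm_nonneg (fun α => isQMatrix_qMatrix hU (U α)) _)
    (aTerm_nonneg (fun α => isQMatrix_qMatrix hU (U α)) _)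

theorem summable_blockMul (X Y : ADelta U) :
    Summable fun p : Irr A × Irr A => blockMul hU p.1 p.2 (X.1 p.1) (Y.1 p.2) :=
  Summable.of_norm_bounded (summable_mul_aTerm hU X Y) fun _ => norm_blockMul_le hU _ _

/-- The multiplication of `A_Δ(𝔾)`. -/
noncomputable def aDeltaMul : ADelta U →ₗ[ℂ] ADelta U →ₗ[ℂ] ADelta U :=
  (LinearMap.mk₂ ℂ
    (fun X Y : ADelta U => ∑' p : Irr A × Irr A, blockMul hU p.1 p.2 (X.1 p.1) (Y.1 p.2))
    (fun X X' Y => by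
      rw [← (summable_blockMul hU X Y).tsum_add (summable_blockMul hU X' Y)]
      exact tsum_congr fun p => (blockMul hU p.1 p.2).map_add₂ _ _ _)
    (fun c X Y => by
      rw [← (summable_blockMul hU X Y).tsum_const_smul]
      exact tsum_congr fun p => (blockMul hU p.1 p.2).map_smul₂ _ _ _)
    (fun X Y Y' => by
      rw [← (summable_blockMul hU X Y).tsum_add (summable_blockMul hU X Y')]
      exact tsum_congr fun p => map_add _ _ _)
    (fun c X Y => by
      rw [← (summable_blockMul hU X Y).tsum_const_smul]
      exact tsum_congr fun p => (blockMul hU p.1 p.2 (X.1 p.1)).map_smul c (Y.1 p.2))).compr₂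
    (toLp hU).symm.toLinearMap

theorem toLp_aDeltaMul (X Y : ADelta U) : toLp hU (aDeltaMul hU X Y) =
    ∑' p : Irr A × Irr A, blockMul hU p.1 p.2 (X.1 p.1) (Y.1 p.2) :=
  LinearEquiv.apply_symm_apply _ _

theorem aDeltaNorm_aDeltaMul_le (X Y : ADelta U) :
    aDeltaNorm U (aDeltaMul hU X Y) ≤ aDeltaNorm U X * aDeltaNorm U Y := by
  rw [← norm_toLp hU, toLp_aDeltaMul, aDeltaNorm, aDeltaNorm,
    Summable.tsum_mul_tsum X.2 Y.2 (summable_mul_aTerm hU X Y)]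
  exact tsum_of_norm_bounded (summable_mul_aTerm hU X Y).hasSum fun _ => norm_blockMul_le hU _ _

theorem exists_eq_sum_block (x : A) : ∃ F : Finset (Irr A), (∀ α ∉ F, fourier U x α = 0) ∧
    x = ∑ α ∈ F, block U α (fourier U x α) := by
  have hF : ∀ α ∉ (finite_support_fourier hU x).toFinset, fourier U x α = 0 := by
    intro α hα
    simpa using hα
  exact ⟨_, hF, fourier_injective hU (fourier_sum_block hU hF).symm⟩

theorem aDeltaMul_toADelta (x y : A) :
    aDeltaMul hU (toADelta hU x) (toADelta hU y) = toADelta hU (x * y) := by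
  obtain ⟨F, hF, hx⟩ := exists_eq_sum_block hU x
  obtain ⟨G, hG, hy⟩ := exists_eq_sum_block hU y
  apply (toLp hU).injective
  rw [toLp_aDeltaMul, tsum_eq_sum (s := F ×ˢ G)]
  · conv_rhs => rw [hx, hy]
    rw [Finset.sum_mul_sum, map_sum, map_sum, Finset.sum_product]
    refine Finset.sum_congr rfl fun β _ => ?_
    rw [map_sum, map_sum]
    rfl
  · rintro ⟨β, γ⟩ h
    rw [Finset.mem_product, not_and_or] at h
    rcases h with h | h
    · rw [coe_toADelta, hF _ h, map_zero, LinearMap.zero_apply]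
    · rw [coe_toADelta hU y, hG _ h, map_zero]

theorem exists_toADelta_eq {X : ADelta U} (hX : {α | X.1 α ≠ 0}.Finite) :
    ∃ F : Finset (Irr A), (∀ α ∉ F, X.1 α = 0) ∧
      X = toADelta hU (∑ α ∈ F, block U α (X.1 α)) := by
  have hF : ∀ α ∉ hX.toFinset, X.1 α = 0 := by
    intro α hα
    simpa using hα
  exact ⟨_, hF, Subtype.ext (fourier_sum_block hU hF).symm⟩

theorem extendsDualConv_aDeltaMul : ExtendsDualConv U (aDeltaMul hU) := by
  intro X Y hX hY
  obtain ⟨F, hF, hx⟩ := exists_toADelta_eq hU hX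
  obtain ⟨G, hG, hy⟩ := exists_toADelta_eq hU hY
  have h : aDeltaMul hU X Y = toADelta hU
      ((∑ α ∈ F, block U α (X.1 α)) * ∑ α ∈ G, block U α (Y.1 α)) := by
    conv_lhs => rw [hx, hy]
    exact aDeltaMul_toADelta hU _ _
  rw [h]
  exact ⟨finite_support_fourier hU _, fun a => (dualConv_eq hU hF hG a).symm⟩

/-- The finitely supported elements are dense. -/
theorem denseRange_toADelta : DenseRange fun x : A => toLp hU (toADelta hU x) := by
  classical
  intro f
  have hs := lp.hasSum_single (E := BlockSpace U) (p := 1) (by simp) f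
  refine mem_closure_of_tendsto hs (Filter.Eventually.of_forall fun F => ?_)
  refine ⟨∑ α ∈ F, block U α ((blockEquiv (isQMatrix_qMatrix hU (U α))).symm (f α)), ?_⟩
  simp only [map_sum]
  refine Finset.sum_congr rfl fun α _ => ?_
  ext1
  funext β
  rw [toLp_apply, coe_toADelta, fourier_block hU]
  by_cases h : β = α
  · subst h
    rw [Pi.single_eq_same, LinearEquiv.apply_symm_apply]
    simp
  · rw [Pi.single_eq_of_ne h, map_zero]
    simp [h]

/-- A bounded bilinear multiplication of `A_Δ(𝔾)`, on the `ℓ¹`-sum. -/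
noncomputable def lpMul (mul : ADelta U →ₗ[ℂ] ADelta U →ₗ[ℂ] ADelta U)
    (h : ∀ X Y, aDeltaNorm U (mul X Y) ≤ aDeltaNorm U X * aDeltaNorm U Y) :
    lp (BlockSpace U) 1 →L[ℂ] lp (BlockSpace U) 1 →L[ℂ] lp (BlockSpace U) 1 :=
  LinearMap.mkContinuous₂ ((mul.compl₁₂ (toLp hU).symm.toLinearMap
    (toLp hU).symm.toLinearMap).compr₂ (toLp hU).toLinearMap) 1 fun f g => by
      rw [one_mul]
      change ‖toLp hU (mul ((toLp hU).symm f) ((toLp hU).symm g))‖ ≤ _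
      rw [norm_toLp]
      refine (h _ _).trans (le_of_eq ?_)
      rw [← norm_toLp hU, ← norm_toLp hU, LinearEquiv.apply_symm_apply,
        LinearEquiv.apply_symm_apply]

theorem lpMul_toLp (mul : ADelta U →ₗ[ℂ] ADelta U →ₗ[ℂ] ADelta U)
    (h : ∀ X Y, aDeltaNorm U (mul X Y) ≤ aDeltaNorm U X * aDeltaNorm U Y) (X Y : ADelta U) :
    lpMul hU mul h (toLp hU X) (toLp hU Y) = toLp hU (mul X Y) := by
  change toLp hU (mul ((toLp hU).symm (toLp hU X)) ((toLp hU).symm (toLp hU Y))) = _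
  rw [LinearEquiv.symm_apply_apply, LinearEquiv.symm_apply_apply]

/-- Bounded multiplications are determined by their values on finitely supported elements. -/
theorem mul_eq_of_toADelta {mul mul' : ADelta U →ₗ[ℂ] ADelta U →ₗ[ℂ] ADelta U}
    (h : ∀ X Y, aDeltaNorm U (mul X Y) ≤ aDeltaNorm U X * aDeltaNorm U Y)
    (h' : ∀ X Y, aDeltaNorm U (mul' X Y) ≤ aDeltaNorm U X * aDeltaNorm U Y)
    (heq : ∀ x y, mul (toADelta hU x) (toADelta hU y) = mul' (toADelta hU x) (toADelta hU y)) :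
    mul = mul' := by
  ext1 X
  ext1 Y
  apply (toLp hU).injective
  rw [← lpMul_toLp hU mul h, ← lpMul_toLp hU mul' h']
  refine (denseRange_toADelta hU).induction_on₂
    (p := fun f g => lpMul hU mul h f g = lpMul hU mul' h' f g) ?_ (fun x y => ?_) _ _
  · exact isClosed_eq (by fun_prop) (by fun_prop)
  · rw [lpMul_toLp, lpMul_toLp, heq]

theorem aDeltaMul_assoc (X Y Z : ADelta U) :
    aDeltaMul hU (aDeltaMul hU X Y) Z = aDeltaMul hU X (aDeltaMul hU Y Z) := by
  have h := aDeltaNorm_aDeltaMul_le hU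
  apply (toLp hU).injective
  simp only [← lpMul_toLp hU _ h]
  refine (denseRange_toADelta hU).induction_on₃
    (p := fun f g k => lpMul hU _ h (lpMul hU _ h f g) k = lpMul hU _ h f (lpMul hU _ h g k))
    ?_ (fun x y z => ?_) _ _ _
  · exact isClosed_eq (by fun_prop) (by fun_prop)
  · simp only [lpMul_toLp, aDeltaMul_toADelta, mul_assoc]

theorem eq_of_funct_eq {X Y : MatFam U} (h : ∀ a, funct U X a = funct U Y a) : X = Y := by
  funext α
  refine eq_of_mul_qMatrix_eq hU fun i j => ?_
  rw [← funct_matUnit, ← funct_matUnit]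
  exact h _

/-- A bounded multiplication which extends `Δ̂_*` is the multiplication of `A_Δ(𝔾)`. -/
theorem eq_aDeltaMul {mul : ADelta U →ₗ[ℂ] ADelta U →ₗ[ℂ] ADelta U} (hm : ExtendsDualConv U mul)
    (h : ∀ X Y, aDeltaNorm U (mul X Y) ≤ aDeltaNorm U X * aDeltaNorm U Y) :
    mul = aDeltaMul hU := by
  refine mul_eq_of_toADelta hU h (aDeltaNorm_aDeltaMul_le hU) fun x y => Subtype.ext ?_
  have hx := finite_support_fourier hU x
  have hy := finite_support_fourier hU y
  refine eq_of_funct_eq hU fun a => ?_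
  rw [(hm _ _ hx hy).2, (extendsDualConv_aDeltaMul hU _ _ hx hy).2]

end Multiplication

/-! ### Complete contractivity of the multiplication -/

section JointlyContractive

variable {A : Type*} [Ring A] [StarRing A] [HopfAlgebra ℂ A] [StarModule ℂ A] [IsPol A]
variable {U : Irr A → IrrRep A} (hU : ∀ α, (Quotient.mk _ (U α) : Irr A) = α)
variable {m : ℕ} {u : ∀ α, Matrix (Fin (U α).n) (Fin (U α).n) ℂ →ₗ[ℂ] Matrix (Fin m) (Fin m) ℂ}
  (hu : ∀ α, IsCompletelyContractive (blockNorm U α) (matAlgNorm m) (u α))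

omit [StarModule ℂ A] [IsPol A] in
include hu in
theorem norm_apply_le_aTerm (X : MatFam U) (α : Irr A) (c c' : Fin m) :
    ‖u α (X α) c c'‖ ≤ aTerm U X α := by
  rw [aTerm_eq, ← blockNorm_one]
  refine (norm_apply_le_amp (u α) (Matrix.of fun _ _ : Fin 1 => X α) 0 0 c c').trans ?_
  exact hu α 1 _

/-- The matrix coefficients of the map `∑_α u_α` on `A_Δ(𝔾)`, for complete contractions `u_α`. -/
noncomputable def coefFunctional (c c' : Fin m) : lp (BlockSpace U) 1 →L[ℂ] ℂ :=
  LinearMap.mkContinuous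
    ({ toFun := fun X => ∑' α, u α (X.1 α) c c'
       map_add' := fun X Y => by
        rw [← (Summable.of_norm_bounded X.2 fun α =>
          norm_apply_le_aTerm hu X.1 α c c').tsum_add (Summable.of_norm_bounded Y.2 fun α =>
          norm_apply_le_aTerm hu Y.1 α c c')]
        exact tsum_congr fun α => congrFun (congrFun (map_add (u α) _ _) c) c'
       map_smul' := fun k X => by
        rw [RingHom.id_apply, smul_eq_mul, ← tsum_mul_left]
        exact tsum_congr fun α => congrFun (congrFun (map_smul (u α) _ _) c) c' } ∘ₗ
      (toLp hU).symm.toLinearMap : lp (BlockSpace U) 1 →ₗ[ℂ] ℂ) 1 fun f => by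
    rw [one_mul, ← (toLp hU).apply_symm_apply f, norm_toLp, LinearEquiv.apply_symm_apply]
    exact tsum_of_norm_bounded ((toLp hU).symm f).2.hasSum fun α =>
      norm_apply_le_aTerm hu _ α c c'

theorem coefFunctional_toLp (X : ADelta U) (c c' : Fin m) :
    coefFunctional hU hu c c' (toLp hU X) = ∑' α, u α (X.1 α) c c' := by
  change ∑' α, u α (((toLp hU).symm (toLp hU X)).1 α) c c' = _
  rw [LinearEquiv.symm_apply_apply]

theorem norm_coefFunctional_le (f : lp (BlockSpace U) 1) (c c' : Fin m) :
    ‖coefFunctional hU hu c c' f‖ ≤ ‖f‖ := by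
  rw [← one_mul ‖f‖]
  exact ContinuousLinearMap.le_of_opNorm_le _ (LinearMap.mkContinuous_norm_le _ zero_le_one _) f

/-- Multiplication from the left by a matrix over the component `β`, restricted to the component
`γ` and followed by `∑_α u_α`. -/
noncomputable def leftMulMap {β : Irr A} {p : ℕ}
    (x : Matrix (Fin p) (Fin p) (Matrix (Fin (U β).n) (Fin (U β).n) ℂ)) (γ : Irr A) :
    Matrix (Fin (U γ).n) (Fin (U γ).n) ℂ →ₗ[ℂ] Matrix (Fin p × Fin m) (Fin p × Fin m) ℂ where
  toFun N := Matrix.of fun s t => coefFunctional hU hu s.2 t.2 (blockMul hU β γ (x s.1 t.1) N)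
  map_add' N N' := by
    ext s t
    simp only [Matrix.of_apply, map_add, Matrix.add_apply]
  map_smul' k N := by
    ext s t
    simp only [Matrix.of_apply, map_smul, Matrix.smul_apply, RingHom.id_apply]

theorem opNorm_amp_leftMulMap_le {β γ : Irr A} {p q : ℕ}
    (x : Matrix (Fin p) (Fin p) (Matrix (Fin (U β).n) (Fin (U β).n) ℂ))
    (y : Matrix (Fin q) (Fin q) (Matrix (Fin (U γ).n) (Fin (U γ).n) ℂ)) :
    opNorm (amp (leftMulMap hU hu x γ) y) ≤ blockNorm U β p x * blockNorm U γ q y := by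
  have h := opNorm_fourier_block_mul_le hU hu x y
  let e : Fin q × (Fin p × Fin m) ≃ (Fin p × Fin q) × Fin m :=
    (Equiv.prodAssoc _ _ _).symm.trans (Equiv.prodCongr (Equiv.prodComm _ _) (Equiv.refl _))
  rw [← opNorm_submatrix_equiv _ e e] at h
  refine le_trans (le_of_eq ?_) h
  congr 1
  ext s t
  exact coefFunctional_toLp hU hu _ _ _

theorem summable_coefFunctional_blockMul {β : Irr A} (M : Matrix (Fin (U β).n) (Fin (U β).n) ℂ)
    (Y : ADelta U) (c c' : Fin m) :
    Summable fun γ => coefFunctional hU hu c c' (blockMul hU β γ M (Y.1 γ)) :=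
  Summable.of_norm_bounded (Summable.mul_left (weight (U β) * hsNorm (M * qSqrt (U β))) Y.2)
    fun _ => (norm_coefFunctional_le hU hu _ c c').trans (norm_blockMul_le hU _ _)

/-- Multiplication from the right by a matrix over `A_Δ(𝔾)`, restricted to the component `β` and
followed by `∑_α u_α`. -/
noncomputable def rightMulMap {q : ℕ} (y : Matrix (Fin q) (Fin q) (ADelta U)) (β : Irr A) :
    Matrix (Fin (U β).n) (Fin (U β).n) ℂ →ₗ[ℂ] Matrix (Fin q × Fin m) (Fin q × Fin m) ℂ where
  toFun M := Matrix.of fun s t => ∑' γ, coefFunctional hU hu s.2 t.2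
    (blockMul hU β γ M ((y s.1 t.1).1 γ))
  map_add' M M' := by
    ext s t
    simp only [Matrix.of_apply, map_add, LinearMap.add_apply, Matrix.add_apply]
    exact (summable_coefFunctional_blockMul hU hu M _ _ _).tsum_add
      (summable_coefFunctional_blockMul hU hu M' _ _ _)
  map_smul' k M := by
    ext s t
    simp only [Matrix.of_apply, map_smul, LinearMap.smul_apply, Matrix.smul_apply,
      RingHom.id_apply, smul_eq_mul, tsum_mul_left]

theorem opNorm_amp_rightMulMap_le {β : Irr A} {p q : ℕ}
    (y : Matrix (Fin q) (Fin q) (ADelta U))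
    (x : Matrix (Fin p) (Fin p) (Matrix (Fin (U β).n) (Fin (U β).n) ℂ)) :
    opNorm (amp (rightMulMap hU hu y β) x) ≤ aDeltaMatNorm U q y * blockNorm U β p x := by
  have hQ : ∀ α, IsQMatrix (U α) (qMatrix (U α)) := fun α => isQMatrix_qMatrix hU (U α)
  have h := opNorm_sumAmp_le_mul (blockNorm_nonneg hQ β p x)
    (fun γ q y => opNorm_amp_leftMulMap_le hU hu x y) (summable_blockNorm hQ y)
  let e : Fin p × (Fin q × Fin m) ≃ Fin q × (Fin p × Fin m) :=
    ((Equiv.prodAssoc _ _ _).symm.trans (Equiv.prodCongr (Equiv.prodComm _ _)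
      (Equiv.refl _))).trans (Equiv.prodAssoc _ _ _)
  rw [← opNorm_submatrix_equiv _ e e] at h
  rw [mul_comm]
  exact h

theorem tsum_apply_aDeltaMul (X Y : ADelta U) (c c' : Fin m) :
    ∑' α, u α ((aDeltaMul hU X Y).1 α) c c' =
      ∑' β, ∑' γ, coefFunctional hU hu c c' (blockMul hU β γ (X.1 β) (Y.1 γ)) := by
  have hs := summable_blockMul hU X Y
  rw [← coefFunctional_toLp hU hu, toLp_aDeltaMul, ContinuousLinearMap.map_tsum _ hs]
  exact ((coefFunctional hU hu c c').summable hs).tsum_prod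

include hu in
/-- The multiplication is jointly completely contractive, by the universal property of the
`ℓ¹`-direct sum applied in each of the two variables. -/
theorem opNorm_sumAmp_aDeltaMul_le {p q : ℕ} (x : Matrix (Fin p) (Fin p) (ADelta U))
    (y : Matrix (Fin q) (Fin q) (ADelta U)) :
    opNorm (sumAmp u (Matrix.of fun s t : Fin p × Fin q =>
      (aDeltaMul hU (x s.1 t.1) (y s.2 t.2)).1)) ≤ aDeltaMatNorm U p x * aDeltaMatNorm U q y := by
  have hQ : ∀ α, IsQMatrix (U α) (qMatrix (U α)) := fun α => isQMatrix_qMatrix hU (U α)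
  have h := opNorm_sumAmp_le_mul (l1SumNorm_nonneg _)
    (fun β p x => opNorm_amp_rightMulMap_le hU hu y x) (summable_blockNorm hQ x)
  rw [← opNorm_submatrix_equiv _ (Equiv.prodAssoc _ _ _) (Equiv.prodAssoc _ _ _)] at h
  rw [mul_comm]
  refine le_trans (le_of_eq ?_) h
  congr 1
  ext s t
  exact tsum_apply_aDeltaMul hU hu _ _ _ _

/-- A jointly completely contractive map is completely contractive on the projective
tensor product. -/
theorem isCompletelyContractive_lift_aDeltaMul :
    IsCompletelyContractive (projNorm (aDeltaMatNorm U) (aDeltaMatNorm U)) (aDeltaMatNorm U)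
      (TensorProduct.lift (aDeltaMul hU)) := by
  intro n z
  refine le_csInf ?_ ?_
  · obtain ⟨p, q, x, y, a, b, h⟩ := exists_eq_scalarMul_tmul z
    exact ⟨_, p, q, x, y, a, b, h, rfl⟩
  rintro r ⟨p, q, x, y, a, b, rfl, rfl⟩
  have h0 : ∀ (k : ℕ) (x : Matrix (Fin k) (Fin k) (ADelta U)), 0 ≤ aDeltaMatNorm U k x :=
    fun k x => l1SumNorm_nonneg _
  refine l1SumNorm_le (mul_nonneg (mul_nonneg (mul_nonneg (opNorm_nonneg _) (h0 _ _)) (h0 _ _))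
    (opNorm_nonneg _)) fun m u hu => ?_
  have h1 : (((scalarMul a (Matrix.of fun s t => x s.1 t.1 ⊗ₜ[ℂ] y s.2 t.2) b).map
      (TensorProduct.lift (aDeltaMul hU))).map Subtype.val) =
      scalarMul a (Matrix.of fun s t : Fin p × Fin q =>
        (aDeltaMul hU (x s.1 t.1) (y s.2 t.2)).1) b := by
    ext1 k l
    change (ADelta U).subtype (TensorProduct.lift (aDeltaMul hU) _) = _
    simp only [scalarMul, Matrix.of_apply, map_sum, map_smul, TensorProduct.lift.tmul]
    rfl
  rw [h1, mul_assoc (opNorm a)]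
  refine (opNorm_sumAmp_scalarMul_le u a b fun s t c c' => ?_).trans ?_
  · exact Summable.of_norm_bounded (aDeltaMul hU (x s.1 t.1) (y s.2 t.2)).2 fun α =>
      norm_apply_le_aTerm hu _ α c c'
  · exact mul_le_mul_of_nonneg_right (mul_le_mul_of_nonneg_left
      (opNorm_sumAmp_aDeltaMul_le hU hu x y) (opNorm_nonneg _)) (opNorm_nonneg _)

end JointlyContractive

end CQG

theorem mainTheorem4 {A : Type*} [Ring A] [StarRing A] [HopfAlgebra ℂ A] [StarModule ℂ A]
    [CQG.IsPol A] (U : CQG.Irr A → CQG.IrrRep A) (hU : ∀ α, (Quotient.mk _ (U α) : CQG.Irr A) = α) :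
    CQG.IsHaarState (CQG.haar A) ∧
    (∀ α, CQG.IsQMatrix (U α) (CQG.qMatrix (U α))) ∧
    (∀ (β γ : CQG.Irr A) (k l : Fin (U β).n) (p q : Fin (U γ).n),
      (U β).u k l * (U γ).u p q = ∑ᶠ α, ∑ i, ∑ j,
        CQG.dualComul U (CQG.matUnit U α i j) β γ (k, p) (l, q) • (U α).u i j) ∧
    (∀ X : CQG.ADelta U,
      CQG.aDeltaMatNorm U 1 (Matrix.of fun _ _ => X) = CQG.aDeltaNorm U X) ∧
    ∃! mul : CQG.ADelta U →ₗ[ℂ] CQG.ADelta U →ₗ[ℂ] CQG.ADelta U,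
      CQG.ExtendsDualConv U mul ∧
      OpSpace.IsCompletelyContractiveBanachAlgebra (CQG.aDeltaMatNorm U) mul := by
  have hQ : ∀ α, CQG.IsQMatrix (U α) (CQG.qMatrix (U α)) :=
    fun α => CQG.isQMatrix_qMatrix hU (U α)
  refine ⟨CQG.isHaarState_haar hU, hQ, fun β γ k l p q => CQG.coef_mul_coef hU β γ k l p q,
    CQG.aDeltaMatNorm_one hQ, CQG.aDeltaMul hU, ⟨CQG.extendsDualConv_aDeltaMul hU,
      CQG.isOperatorSpace_aDelta hQ, CQG.aDeltaMul_assoc hU, fun X Y => ?_,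
      CQG.isCompletelyContractive_lift_aDeltaMul hU⟩, fun mul hm => ?_⟩
  · simp only [CQG.aDeltaMatNorm_one hQ]
    exact CQG.aDeltaNorm_aDeltaMul_le hU X Y
  · refine CQG.eq_aDeltaMul hU hm.1 fun X Y => ?_
    simp only [← CQG.aDeltaMatNorm_one hQ]
    exact hm.2.norm_mul_le X Y
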